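/- **Setting.** An MDP has a measurable state space $\mathcal S$, a finite ordered action set $\mathcal A=(\mathcal A_1,\dots,\mathcal A_{|\mathcal A|})$ and a transition-reward kernel $\mathcal Q:\mathcal S\times\mathcal A\to\mathrm{Dists}(\mathcal S\times[0,1])$. For a stationary memoryless policy $\pi$ and $\gamma\in(0,1)$, let $v^\pi(s)=\mathbb E_{\pi,s}[\sum_t\gamma^tR_t]$, $q^\pi(s,a)=\mathbb E_{\pi,s,a}[\sum_t\gamma^tR_t]$ and $v^\star(s)=\sup_\pi v^\pi(s)$. Let $d\ge1$, $B>0$, and let $\phi:\mathcal S\times\mathcal A\to\mathbb R^d$ be a (measurable) feature map with $\|\phi(s,a)\|_2\le L$. Its uniform policy value-function approximation error is $$\sup_{\pi}\ \inf_{\|\theta\|_2\le B}\ \sup_{(s,a)}|q^\pi(s,a)-\langle\phi(s,a),\theta\rangle| ,$$ with $\pi$ ranging over the deterministic stationary memoryless policies; let $\varepsilon$ be this error, or any upper bound on it, known to the planner. In the *local access* setting a planner may query a simulator at pairs $(s,a)$ where $s$ is the initial state $s_0$ or a state returned by an earlier query; the answer is a fresh sample $(S',R)\sim\mathcal Q(s,a)$.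 The planner sees the features $\phi(s,\cdot)$ of such states only. **The planner CAPI-Qpi-Plan**, with inputs $s_0,\gamma,\omega,\varepsilon,\delta,L,B$. Put $\lambda=\omega^2/B^2$, $H=\max\{0,\lceil\log((\omega/4)(1-\gamma))/\log\gamma\rceil\}$, $\tilde d=4d\log(1+4L^2/\lambda)$, $\omega'=(\omega+\varepsilon)(\sqrt{\tilde d}+1)$. For a list $C$ of pairs $(s_i,a_i)$ with estimates $\bar q_i$ let $V(C)=\lambda\mathbb I+\sum_i\phi(s_i,a_i)\phi(s_i,a_i)^\top$, $\mathrm{LSE}_{C,\bar q}(s,a)=\langle\phi(s,a),V(C)^{-1}\sum_i\phi(s_i,a_i)\bar q_i\rangle$, $\mathrm{ActionCover}(C)=\{(s,a):\phi(s,a)^\top V(C)^{-1}\phi(s,a)\le1\}$ and $\mathrm{Cover}(C)=\{s:(s,a)\in\mathrm{ActionCover}(C)\ \forall a\}$. *Measure*$(s,a,\pi,\mathcal S',\zeta)$: run $n=\lceil(\omega/4)^{-2}(1-\gamma)^{-2}\log(2/\zeta)/2\rceil$ episodes of $H$ queries, the first at $(s,a)$, each later one at $(S,\pi(S))$ for the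 current state $S$; if before such a later query $S\notin\mathcal S'$, stop and return (discover, $S$). Otherwise return (success, average over the episodes of $\sum_{h<H}\gamma^hR_h$). For levels $l=0,\dots,H$ start with empty lists $C_l,\bar q_l$ and $\pi_l\equiv\mathcal A_1$. Repeat: 1. If $(s_0,a)\notin\mathrm{ActionCover}(C_0)$ for some $a$, append such a pair to $C_0$ and $\bot$ to $\bar q_0$, and start the next iteration. 2. Let $l$ be the least level such that $\bar q_l$ contains $\bot$, at some index $m$ ($l=H$ if there is none). If $l=H$, return $\pi_H$. 3. Call Measure$(C_{l,m},\pi_l,\mathrm{Cover}(C_l),\delta/(\tilde dH))$. On (discover, $s$), append $(s,a)$ to $C_0$ and $\bot$ to $\bar q_0$, for some $a$ with $(s,a)\notin\mathrm{ActionCover}(C_0)$, and start the next iteration. 4. On (success, $q$), set $\bar q_{l,m}=q$. If $\bar q_l$ contains no $\bot$ any more, put $\hat q=\mathrm{LSE}_{C_l,\bar q_l}$; let $\pi'(s)$ be the first maximizer of $\hat q(s,\cdot)$ if $s\in\mathrm{Cover}(C_l)$ and $\hat q(s,\pi_l(s))+\omega'<\max_a\hat q(s,a)-\omega'$, and $\pi'(s)=\pi_l(s)$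 otherwise; replace $\pi_{l+1}$ by $\pi'$ outside $\mathrm{Cover}(C_{l+1})$; then append all pairs of $C_l$ that are not in $C_{l+1}$ to $C_{l+1}$, with entries $\bot$ in $\bar q_{l+1}$. **Theorem.** There are universal constants $K>0$ and $k\in\mathbb N$ such that for every such MDP, feature map, $\varepsilon$, every $\delta\in(0,1]$, $\omega>0$ and $s_0\in\mathcal S$, and however the planner makes the choices of $a$ and $m$ left open above, the following holds. Whatever the simulator answers, CAPI-Qpi-Plan halts, respects local access, and issues at most $$K\,\frac{d}{(1-\gamma)^{4}\omega^{2}}\,\log^k\!\Big(2+d+\frac{LB}\omega+\frac1\omega+\frac1{1-\gamma}+\frac1\delta\Big)=\tilde{\mathcal O}\big(d(1-\gamma)^{-4}\omega^{-2}\big)$$ queries. With probability at least $1-\delta$ it outputs a policy $\pi$ with $$v^\star(s_0)-v^\pi(s_0)\le K\,\frac{(\varepsilon+\omega)\sqrt d}{1-\gamma}\,\log^k\!\Big(2+\frac{LB}\omega\Big)=\tilde{\mathcal O}\big((\varepsilon+\omega)\sqrt d\,(1-\gamma)^{-1}\big).$$ -/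

import Mathlib

open MeasureTheory ProbabilityTheory
open scoped ENNReal unitInterval

/-! ## Markov decision processes

An MDP with state space `S`, finite action set `A` and rewards in `[0,1]` is its
transition-reward kernel `Q : Kernel (S × A) (S × I)` (a Markov kernel; `I = [0,1]`).
A stationary memoryless policy is a Markov kernel `π : Kernel S A`. -/

namespace MDP

variable {S A : Type*} [MeasurableSpace S] [MeasurableSpace A]

/-- One transition of the chain `Z_i = ((S_i, A_i), R_{i-1})` under the policy `π`:
`(S_{i+1}, R_i) ∼ Q (S_i, A_i)`, then `A_{i+1} ∼ π (S_{i+1})`. -/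
noncomputable def stepKernel (Q : Kernel (S × A) (S × I)) (π : Kernel S A) :
    Kernel ((S × A) × I) ((S × A) × I) :=
  ((Q ⊗ₖ (π.comap (fun p : (S × A) × (S × I) => p.2.1)
      (measurable_fst.comp measurable_snd))).map
    (fun y : (S × I) × A => ((y.1.1, y.2), y.1.2))).comap Prod.fst measurable_fst

instance (Q : Kernel (S × A) (S × I)) (π : Kernel S A) [IsMarkovKernel Q] [IsMarkovKernel π] :
    IsMarkovKernel (stepKernel Q π) := by
  have h : Measurable (fun y : (S × I) × A => ((y.1.1, y.2), y.1.2)) := by fun_prop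
  have := Kernel.IsMarkovKernel.map (Q ⊗ₖ (π.comap (fun p : (S × A) × (S × I) => p.2.1)
      (measurable_fst.comp measurable_snd))) h
  unfold stepKernel
  infer_instance

/-- `stepKernel` as a kernel from histories `Z_0, …, Z_n` to `Z_{n+1}`. -/
noncomputable def histKernel (Q : Kernel (S × A) (S × I)) (π : Kernel S A) (n : ℕ) :
    Kernel ((i : Finset.Iic n) → (fun _ : ℕ => (S × A) × I) i) ((S × A) × I) :=
  (stepKernel Q π).comap (fun h => h ⟨n, Finset.mem_Iic.2 le_rfl⟩) (measurable_pi_apply _)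

instance (Q : Kernel (S × A) (S × I)) (π : Kernel S A) [IsMarkovKernel Q] [IsMarkovKernel π]
    (n : ℕ) : IsMarkovKernel (histKernel Q π n) := by
  unfold histKernel
  infer_instance

/-- The law `P_{π,s,a}` of the trajectory `(Z_i)`, `Z_i = ((S_i, A_i), R_{i-1})`, started from
`S_0 = s`, `A_0 = a` (the reward slot of `Z_0` is a dummy `0`). -/
noncomputable def trajSA (Q : Kernel (S × A) (S × I)) [IsMarkovKernel Q]
    (π : Kernel S A) [IsMarkovKernel π] (s : S) (a : A) : Measure (ℕ → (S × A) × I) :=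
  Kernel.traj (X := fun _ : ℕ => (S × A) × I) (histKernel Q π) 0 (fun _ => ((s, a), 0))

/-- The law `P_{π,s}` of the trajectory started from `S_0 = s`, `A_0 ∼ π s`. -/
noncomputable def trajS (Q : Kernel (S × A) (S × I)) [IsMarkovKernel Q]
    (π : Kernel S A) [IsMarkovKernel π] (s : S) : Measure (ℕ → (S × A) × I) :=
  (π s).bind (fun a => trajSA Q π s a)

/-- The discounted return `∑ γ^t R_t`; the reward `R_t` is stored in `Z_{t+1}`. -/
noncomputable def discountedReturn (γ : ℝ) (z : ℕ → (S × A) × I) : ℝ :=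
  ∑' t : ℕ, γ ^ t * ((z (t + 1)).2 : ℝ)

/-- State value `v^π(s)`. -/
noncomputable def value (Q : Kernel (S × A) (S × I)) [IsMarkovKernel Q] (γ : ℝ)
    (π : Kernel S A) [IsMarkovKernel π] (s : S) : ℝ :=
  ∫ z, discountedReturn γ z ∂(trajS Q π s)

/-- Action value `q^π(s,a)`. -/
noncomputable def qValue (Q : Kernel (S × A) (S × I)) [IsMarkovKernel Q] (γ : ℝ)
    (π : Kernel S A) [IsMarkovKernel π] (s : S) (a : A) : ℝ :=
  ∫ z, discountedReturn γ z ∂(trajSA Q π s a)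

/-- Optimal value `v^⋆(s)`: the supremum over all stationary memoryless policies. -/
noncomputable def optValue (Q : Kernel (S × A) (S × I)) [IsMarkovKernel Q] (γ : ℝ) (s : S) : ℝ :=
  ⨆ π : {π : Kernel S A // IsMarkovKernel π},
    haveI := π.2
    value Q γ π.1 s

/-- Uniform policy value-function approximation error of the feature map `φ` with parameters in
the ball of radius `B`:
`sup_π inf_{‖θ‖ ≤ B} sup_{(s,a)} |q^π(s,a) - ⟨φ(s,a), θ⟩|`,
`π` ranging over the deterministic stationary memoryless policies. -/
noncomputable def approxError (Q : Kernel (S × A) (S × I)) [IsMarkovKernel Q] (γ : ℝ) {d : ℕ}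
    (φ : S → A → EuclideanSpace ℝ (Fin d)) (B : ℝ) : ℝ :=
  ⨆ π : {π : S → A // Measurable π},
    ⨅ θ : {θ : EuclideanSpace ℝ (Fin d) // ‖θ‖ ≤ B},
      ⨆ x : S × A, |qValue Q γ (Kernel.deterministic π.1 π.2) x.1 x.2 - inner ℝ (φ x.1 x.2) θ.1|

end MDP

/-! ## Programs with local access to a simulator

A program receives a state only as an answer of the simulator, together with the features of that
state. `F` is the type of the features `φ(s,·)` of a state. -/

/-- A program that returns a value, or queries the simulator at `(s, a)` and continues with the next
state, the features of the next state, and the reward. -/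
inductive Prog (S A F : Type*) (R : Type*) where
  | ret : R → Prog S A F R
  | query : S → A → (S → F → ℝ → Prog S A F R) → Prog S A F R

namespace Prog

variable {S A F R T : Type*}

/-- Sequential composition. -/
def bind : Prog S A F R → (R → Prog S A F T) → Prog S A F T
  | ret r, f => f r
  | query s a k, f => query s a (fun s' x r => (k s' x r).bind f)

/-- Run against a fixed stream `y` of simulator answers (next state and reward): the list of queries
issued, in order, and the returned value. -/
def run (φ : S → F) : Prog S A F R → (ℕ → S × I) → List (S × A) × R
  | ret r, _ => ([], r)
  | query s a k, y =>
      let out := (k (y 0).1 (φ (y 0).1) ((y 0).2 : ℝ)).run φ (fun n => y (n + 1))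
      ((s, a) :: out.1, out.2)

open Classical in
/-- Probability that the returned value lies in `E` when every query `(s, a)` is answered by a fresh
sample of `Q (s, a)`. -/
noncomputable def prob [MeasurableSpace S] [MeasurableSpace A] (Q : Kernel (S × A) (S × I))
    (φ : S → F) : Prog S A F R → Set R → ℝ≥0∞
  | ret r, E => if r ∈ E then 1 else 0
  | query s a k, E => ∫⁻ y, (k y.1 (φ y.1) (y.2 : ℝ)).prob Q φ E ∂(Q (s, a))

end Prog

/-- Local access: when `qs` is the list of queries and `y` the stream of answers, each queried state is
the initial state or the next state in the answer to an earlier query. -/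
def LocalAccess {S A : Type*} (s₀ : S) (y : ℕ → S × I) (qs : List (S × A)) : Prop :=
  ∀ (i : ℕ) (p : S × A), qs[i]? = some p → p.1 = s₀ ∨ ∃ j < i, p.1 = (y j).1

/-! ## The planner CAPI-Qpi-Plan -/

namespace Capi

/-- The features `φ(s,·)` of one state. -/
abbrev Row (A : Type*) (d : ℕ) := A → EuclideanSpace ℝ (Fin d)

/-- Inputs of the planner: discount `γ`, accuracy `ω`, approximation error `ε`, failure probability `δ`,
feature bound `L`, parameter bound `B`. -/
structure Params where
  γ : ℝ
  ω : ℝ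
  ε : ℝ
  δ : ℝ
  L : ℝ
  B : ℝ

namespace Params

/-- Regularization `λ = ω² / B²`. -/
noncomputable def lam (P : Params) : ℝ := P.ω ^ 2 / P.B ^ 2

/-- Effective horizon `H = ⌈log((ω/4)(1-γ)) / log γ⌉` (`0` if this is negative). -/
noncomputable def H (P : Params) : ℕ :=
  ⌈Real.log ((P.ω / 4) * (1 - P.γ)) / Real.log P.γ⌉₊

/-- `d̃ = 4 d log(1 + 4 L² / λ)`. -/
noncomputable def dTilde (P : Params) (d : ℕ) : ℝ :=
  4 * d * Real.log (1 + 4 * P.L ^ 2 / P.lam)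

/-- Accuracy `(ω + ε)(√d̃ + 1)` of the least-squares estimates on covered states; the confidence
width of the policy update. -/
noncomputable def width (P : Params) (d : ℕ) : ℝ :=
  (P.ω + P.ε) * (Real.sqrt (P.dTilde d) + 1)

/-- Number of rollouts for failure probability `ζ`. -/
noncomputable def rollouts (P : Params) (ζ : ℝ) : ℕ :=
  ⌈((P.ω / 4) ^ 2)⁻¹ * ((1 - P.γ) ^ 2)⁻¹ * Real.log (2 / ζ) / 2⌉₊

end Params

/-- An element of a core set `C_l` together with its entry of `q̄_l` (`none` stands for `⊥`): the pair
`(st, act)`, the features `row` of the state `st`, and the estimate. -/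
structure Item (S A : Type*) (d : ℕ) where
  st : S
  row : Row A d
  act : A
  est : Option ℝ

section Linear

variable {S A : Type*} {d : ℕ}

/-- The feature vector of the stored pair. -/
def Item.feat (it : Item S A d) : Fin d → ℝ := (it.row it.act).ofLp

/-- `V(C) = λ 𝕀 + ∑ φ_i φ_iᵀ`. -/
noncomputable def designMatrix (lam : ℝ) (C : List (Item S A d)) : Matrix (Fin d) (Fin d) ℝ :=
  lam • (1 : Matrix (Fin d) (Fin d) ℝ) +
    (C.map (fun it => Matrix.vecMulVec it.feat it.feat)).sum

/-- `‖x‖_M = √(xᵀ M x)`. -/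
noncomputable def wnorm (M : Matrix (Fin d) (Fin d) ℝ) (x : Fin d → ℝ) : ℝ :=
  Real.sqrt (x ⬝ᵥ (M.mulVec x))

/-- `(s, a) ∈ ActionCover(C)` for a state `s` with features `x`. -/
def ActionCovered (lam : ℝ) (C : List (Item S A d)) (x : Row A d) (a : A) : Prop :=
  wnorm (designMatrix lam C)⁻¹ (x a).ofLp ≤ 1

/-- `Cover(C)`, as a set of features of states. -/
def Cover (lam : ℝ) (C : List (Item S A d)) : Set (Row A d) :=
  {x | ∀ a, ActionCovered lam C x a}

/-- The regularized least-squares estimator `LSE_{C, q̄}`. -/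
noncomputable def lse (lam : ℝ) (C : List (Item S A d)) (x : Row A d) (a : A) : ℝ :=
  (x a).ofLp ⬝ᵥ ((designMatrix lam C)⁻¹.mulVec
    (C.map (fun it => (it.est.getD 0) • it.feat)).sum)

end Linear

section Update

variable {A : Type*} [Fintype A] [LinearOrder A] [Nonempty A] {X : Type*}

/-- The first action `𝒜_1`. -/
def firstAction (A : Type*) [Fintype A] [LinearOrder A] [Nonempty A] : A :=
  Finset.univ.min' Finset.univ_nonempty

theorem maximizers_nonempty {A : Type*} [Fintype A] [Nonempty A] (f : A → ℝ) :
    (Finset.univ.filter (fun a => ∀ b, f b ≤ f a)).Nonempty := by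
  obtain ⟨a, ha⟩ := Finite.exists_max f
  exact ⟨a, by simpa using ha⟩

/-- The first maximizer of `f`. -/
noncomputable def argmaxFirst (f : A → ℝ) : A :=
  (Finset.univ.filter (fun a => ∀ b, f b ≤ f a)).min' (maximizers_nonempty f)

open Classical in
/-- Confident policy update: greedy with respect to `q` where `x ∉ fix` and
`q(x, π x) + w < max_a q(x, a) - w`, and `π` elsewhere. -/
noncomputable def capiUpdate (w : ℝ) (q : X → A → ℝ) (π : X → A) (fix : Set X) (x : X) : A :=
  if x ∉ fix ∧ q x (π x) + w < Finset.univ.sup' Finset.univ_nonempty (q x) - w then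
    argmaxFirst (q x)
  else π x

end Update

/-- Result of a rollout or of `measure`. -/
inductive Outcome (S A : Type*) (d : ℕ) where
  | discover : S → Row A d → Outcome S A d
  | success : ℝ → Outcome S A d

section Measure

variable {S A : Type*} {d : ℕ}

open Classical in
/-- The last `m` steps of an episode, at step `h`, in the state `s` with features `x`, with discounted
reward `acc` collected so far. -/
noncomputable def rollout (γ : ℝ) (π : Row A d → A) (cov : Set (Row A d)) :
    ℕ → ℕ → S → Row A d → ℝ → Prog S A (Row A d) (Outcome S A d)
  | 0, _, _, _, acc => .ret (.success acc)
  | m + 1, h, s, x, acc =>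
      if x ∉ cov then .ret (.discover s x)
      else .query s (π x) (fun s' x' r => rollout γ π cov m (h + 1) s' x' (acc + γ ^ h * r))

/-- One episode of `H` steps that starts with the action `a` in the state `s`. -/
noncomputable def episode (P : Params) (s : S) (a : A) (π : Row A d → A) (cov : Set (Row A d)) :
    Prog S A (Row A d) (Outcome S A d) :=
  .query s a (fun s' x' r => rollout P.γ π cov (P.H - 1) 1 s' x' r)

/-- The last `m` of `n` episodes, with total discounted reward `tot` so far. -/
noncomputable def measureLoop (P : Params) (s : S) (a : A) (π : Row A d → A)
    (cov : Set (Row A d)) (n : ℕ) : ℕ → ℝ → Prog S A (Row A d) (Outcome S A d)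
  | 0, tot => .ret (.success (tot / n))
  | m + 1, tot => (episode P s a π cov).bind (fun o =>
      match o with
      | .discover s' x' => .ret (.discover s' x')
      | .success g => measureLoop P s a π cov n m (tot + g))

/-- The subroutine Measure with failure probability `ζ`. -/
noncomputable def measure (P : Params) (s : S) (a : A) (π : Row A d → A) (cov : Set (Row A d))
    (ζ : ℝ) : Prog S A (Row A d) (Outcome S A d) :=
  measureLoop P s a π cov (P.rollouts ζ) (P.rollouts ζ) 0

end Measure

/-- Variables of the planner: for each level `l`, the core set `C_l` with `q̄_l`, and the policy `π_l`.
The policies see a state only through its features. -/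
structure PlanState (S A : Type*) (d : ℕ) where
  core : ℕ → List (Item S A d)
  pol : ℕ → Row A d → A

/-- The choices that the planner leaves open: some action out of a nonempty set, and the index of some
element of a core set whose estimate is still missing. -/
structure Selector (S A : Type*) (d : ℕ) where
  action : PlanState S A d → Set A → A
  action_mem : ∀ st U, U.Nonempty → action st U ∈ U
  index : PlanState S A d → List (Item S A d) → ℕ
  index_spec : ∀ st C, (∃ it ∈ C, it.est = none) →
    ∃ it, C[index st C]? = some it ∧ it.est = none

section Plan

variable {S A : Type*} {d : ℕ}

/-- Smallest level with a missing estimate, `H` if there is none. -/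
noncomputable def PlanState.level (st : PlanState S A d) (H : ℕ) : ℕ :=
  sInf {l | l = H ∨ ∃ it ∈ st.core l, it.est = none}

/-- Append `(s, a)` to `C_0` and `⊥` to `q̄_0`, for a selected `a` with `(s, a) ∉ ActionCover(C_0)`. -/
noncomputable def PlanState.discover (P : Params) (sel : Selector S A d) (st : PlanState S A d)
    (s : S) (x : Row A d) : PlanState S A d :=
  { st with core := Function.update st.core 0 (st.core 0 ++
      [⟨s, x, sel.action st {a | ¬ ActionCovered P.lam (st.core 0) x a}, none⟩]) }

open Classical in
/-- Policy improvement at level `l + 1` and propagation of `C_l` to `C_{l+1}`. -/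
noncomputable def PlanState.improve [Fintype A] [LinearOrder A] [Nonempty A] (P : Params)
    (st : PlanState S A d) (l : ℕ) : PlanState S A d where
  pol := Function.update st.pol (l + 1) (fun x =>
    if x ∈ Cover P.lam (st.core (l + 1)) then st.pol (l + 1) x
    else capiUpdate (P.width d) (lse P.lam (st.core l)) (st.pol l) (Cover P.lam (st.core l))ᶜ x)
  core := Function.update st.core (l + 1) (st.core (l + 1) ++
    ((st.core l).filter (fun it =>
        decide (∀ jt ∈ st.core (l + 1), (jt.st, jt.act) ≠ (it.st, it.act)))).map
      (fun it => { it with est := none }))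

open Classical in
/-- Store the estimate `q` of the `m`-th element `it` of `C_l`; if no estimate is missing at level `l`
any more, improve the next level. -/
noncomputable def PlanState.record [Fintype A] [LinearOrder A] [Nonempty A] (P : Params)
    (st : PlanState S A d) (l m : ℕ) (it : Item S A d) (q : ℝ) : PlanState S A d :=
  let st' : PlanState S A d :=
    { st with core := Function.update st.core l ((st.core l).set m { it with est := some q }) }
  if ∃ jt ∈ st'.core l, jt.est = none then st' else st'.improve P l

open Classical in
/-- The main loop, cut off (with result `none`) after a given number of iterations. -/
noncomputable def planLoop [Fintype A] [LinearOrder A] [Nonempty A] (P : Params)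
    (sel : Selector S A d) (s₀ : S) (x₀ : Row A d) :
    ℕ → PlanState S A d → Prog S A (Row A d) (Option (Row A d → A))
  | 0, _ => .ret none
  | N + 1, st =>
      if ∃ a, ¬ ActionCovered P.lam (st.core 0) x₀ a then
        planLoop P sel s₀ x₀ N (st.discover P sel s₀ x₀)
      else
        let l := st.level P.H
        if l = P.H then .ret (some (st.pol P.H))
        else
          let m := sel.index st (st.core l)
          match (st.core l)[m]? with
          | none => .ret none
          | some it =>
              (measure P it.st it.act (st.pol l) (Cover P.lam (st.core l))
                  (P.δ / (P.dTilde d * P.H))).bind (fun o =>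
                match o with
                | .discover s x => planLoop P sel s₀ x₀ N (st.discover P sel s x)
                | .success q => planLoop P sel s₀ x₀ N (st.record P l m it q))

/-- The planner, started in the state `s₀` with features `x₀` and cut off after `N` iterations of its
main loop: all core sets are empty and all policies choose the first action at the start. -/
noncomputable def capiQpiPlan [Fintype A] [LinearOrder A] [Nonempty A] (P : Params)
    (sel : Selector S A d) (s₀ : S) (x₀ : Row A d) (N : ℕ) :
    Prog S A (Row A d) (Option (Row A d → A)) :=
  planLoop P sel s₀ x₀ N ⟨fun _ => [], fun _ _ => firstAction A⟩

end Plan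

end Capi

set_option linter.unusedSectionVars false

/-! The planner is approximate policy iteration on `H` levels. Three facts carry the proof: the core
sets stay small, a completed measurement is accurate for many policies at once, and the returned
policy can be compared with a comparator that differs from it on uncovered states.

Core sets. A pair is appended to `C_0` only if its feature vector has weighted norm above 1, so each
append more than doubles the determinant of the Gram matrix, while the trace bounds that
determinant. Hence there are at most `D = ⌊d̃/2⌋` elements (`Spread.length_le`). Every iteration
that does not return adds an element to `C_0` or fills one estimate below level `H`, so at most `D +
H D` such iterations occur; `safe_planLoop` turns this into the query bound, and `Prog.Safe` tracks
the known states for local access.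

Measurements. A rollout that leaves the covered states ends in a discovery. Giving discoveries
terminal reward 0, respectively `1/(1-γ)`, brackets the action value of every policy that agrees
with `π_l` on `Cover(C_l)`. A Chernoff argument on both sides makes a completed estimate
`ω/2`-accurate for all these policies simultaneously (`prob_measure_accurate`). Covers only grow and
policies are frozen on covered states, so stored estimates remain valid (`Accurate`). With `√λ B =
ω`, least squares then has error at most the confidence width on covered states
(`abs_lse_sub_detQ_le`), and the confident update never loses value and is greedy up to four widths.

Comparison. At termination the levels up to `H` have the same cover. For a comparator `g`, let the
spliced policy follow `π_l` on the cover and `g` elsewhere. Splicing makes the update monotone and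
nearly greedy against `g` at every state, so the gap to `g` contracts by `γ` per level
(`detValue_le_splice`). At the covered state `s_0` the same least-squares value approximates the
action values of both `π_{H-1}` and its splice, which transfers the bound to the returned policy
(`detValue_sub_le`). Value iteration supplies nearly optimal deterministic comparators
(`exists_detValue_ge`), so randomized policies need no separate treatment.

Probability. All estimates on `Prog.prob` are lower bounds proved by recursion on the program. They
use only inequalities for lower integrals that hold without measurability of the integrand, so
nothing has to be known about how the continuation depends on the answers. Each measurement costs at
most `δ/(d̃ H)` of the failure budget. -/

namespace MDP

/-! ### Trajectory laws, action values and the Bellman equation -/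

section Bellman

variable {S A : Type*} [MeasurableSpace S] [MeasurableSpace A]

/-- The trajectory law started from `z`, with an arbitrary content of the dummy reward slot. -/
noncomputable def trajFrom (Q : Kernel (S × A) (S × I)) [IsMarkovKernel Q]
    (π : Kernel S A) [IsMarkovKernel π] (z : (S × A) × I) : Measure (ℕ → (S × A) × I) :=
  Kernel.traj (X := fun _ : ℕ => (S × A) × I) (histKernel Q π) 0 (fun _ => z)

instance (Q : Kernel (S × A) (S × I)) [IsMarkovKernel Q] (π : Kernel S A) [IsMarkovKernel π]
    (z : (S × A) × I) : IsProbabilityMeasure (trajFrom Q π z) := by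
  unfold trajFrom; infer_instance

theorem lintegral_trajFrom_zero (Q : Kernel (S × A) (S × I)) [IsMarkovKernel Q]
    (π : Kernel S A) [IsMarkovKernel π] (z : (S × A) × I) {f : (S × A) × I → ℝ≥0∞}
    (hf : Measurable f) : ∫⁻ x, f (x 0) ∂(trajFrom Q π z) = f z := by
  have h := Kernel.traj_map_frestrictLe_apply (X := fun _ : ℕ => (S × A) × I)
    (κ := histKernel Q π) 0 0 (fun _ => z)
  rw [Kernel.partialTraj_self, Kernel.id_apply] at h
  have h2 : ∫⁻ x, f (x 0) ∂(trajFrom Q π z) =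
      ∫⁻ x, f (x ⟨0, by simp⟩) ∂((trajFrom Q π z).map
        (Preorder.frestrictLe (π := fun _ : ℕ => (S × A) × I) 0)) := by
    rw [lintegral_map (by fun_prop) (by fun_prop)]
    rfl
  rw [h2, trajFrom, h, lintegral_dirac' _ (by fun_prop)]

/-- The marginals factor through finite partial trajectories, and extending one by a step applies
`histKernel`, which reads only the last entry. -/
theorem lintegral_trajFrom_succ (Q : Kernel (S × A) (S × I)) [IsMarkovKernel Q]
    (π : Kernel S A) [IsMarkovKernel π] (z : (S × A) × I) {f : (S × A) × I → ℝ≥0∞}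
    (hf : Measurable f) (n : ℕ) :
    ∫⁻ x, f (x (n + 1)) ∂(trajFrom Q π z) =
      ∫⁻ x, ∫⁻ w, f w ∂(stepKernel Q π (x n)) ∂(trajFrom Q π z) := by
  have key : ∀ (m : ℕ) (g : (S × A) × I → ℝ≥0∞), Measurable g →
      ∫⁻ x, g (x m) ∂(trajFrom Q π z) =
        ∫⁻ x, g (x ⟨m, by simp⟩) ∂(Kernel.partialTraj (X := fun _ : ℕ => (S × A) × I)
          (histKernel Q π) 0 m (fun _ => z)) := by
    intro m g hg
    rw [← Kernel.traj_map_frestrictLe_apply, lintegral_map (by fun_prop) (by fun_prop)]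
    rfl
  rw [key _ f hf, key n (fun x => ∫⁻ w, f w ∂(stepKernel Q π x)) hf.lintegral_kernel,
    Kernel.partialTraj_succ_eq_comp (Nat.zero_le n), Kernel.lintegral_comp _ _ _ (by fun_prop)]
  refine lintegral_congr fun x => ?_
  have h := congrArg (fun κ => κ x) (Kernel.map_partialTraj_succ_self
    (X := fun _ : ℕ => (S × A) × I) (κ := histKernel Q π) n)
  rw [Kernel.map_apply _ (by fun_prop)] at h
  have h3 : stepKernel Q π (x ⟨n, by simp⟩) = histKernel Q π n x := rfl
  rw [h3, ← h, lintegral_map hf (by fun_prop)]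

theorem lintegral_trajFrom_iterate (Q : Kernel (S × A) (S × I)) [IsMarkovKernel Q]
    (π : Kernel S A) [IsMarkovKernel π] (z : (S × A) × I) (n : ℕ) :
    ∀ {f : (S × A) × I → ℝ≥0∞}, Measurable f →
    ∫⁻ x, f (x n) ∂(trajFrom Q π z) =
      ((fun (g : (S × A) × I → ℝ≥0∞) w => ∫⁻ v, g v ∂(stepKernel Q π w))^[n]) f z := by
  induction n with
  | zero => intro f hf; simpa using lintegral_trajFrom_zero Q π z hf
  | succ n ih =>
    intro f hf
    rw [lintegral_trajFrom_succ Q π z hf, Function.iterate_succ_apply, ← ih hf.lintegral_kernel]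

theorem lintegral_stepKernel (Q : Kernel (S × A) (S × I)) [IsMarkovKernel Q]
    (π : Kernel S A) [IsMarkovKernel π] (z : (S × A) × I) {f : (S × A) × I → ℝ≥0∞}
    (hf : Measurable f) :
    ∫⁻ w, f w ∂(stepKernel Q π z) = ∫⁻ y, ∫⁻ a, f ((y.1, a), y.2) ∂(π y.1) ∂(Q z.1) := by
  rw [stepKernel, Kernel.comap_apply, Kernel.map_apply _ (by fun_prop),
    lintegral_map hf (by fun_prop), Kernel.lintegral_compProd _ _ _ (by fun_prop)]
  rfl

theorem measurable_discountedReturn (γ : ℝ) :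
    Measurable (discountedReturn γ : (ℕ → (S × A) × I) → ℝ) := by
  unfold discountedReturn
  apply Measurable.tsum
  intro t
  fun_prop

theorem summable_discounted {γ : ℝ} (h0 : 0 ≤ γ) (h1 : γ < 1) (r : ℕ → I) :
    Summable (fun t => γ ^ t * (r t : ℝ)) :=
  Summable.of_nonneg_of_le (fun t => mul_nonneg (pow_nonneg h0 t) (r t).2.1)
    (fun t => mul_le_of_le_one_right (pow_nonneg h0 t) (r t).2.2)
    (summable_geometric_of_lt_one h0 h1)

theorem discountedReturn_nonneg {S A : Type*} {γ : ℝ} (h0 : 0 ≤ γ) (z : ℕ → (S × A) × I) :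
    0 ≤ discountedReturn γ z :=
  tsum_nonneg fun t => mul_nonneg (pow_nonneg h0 t) (z (t + 1)).2.2.1

theorem discountedReturn_le {S A : Type*} {γ : ℝ} (h0 : 0 ≤ γ) (h1 : γ < 1) (z : ℕ → (S × A) × I) :
    discountedReturn γ z ≤ (1 - γ)⁻¹ := by
  rw [← tsum_geometric_of_lt_one h0 h1]
  exact (summable_discounted h0 h1 fun t => (z (t + 1)).2).tsum_le_tsum
    (fun t => mul_le_of_le_one_right (pow_nonneg h0 t) (z (t + 1)).2.2.2)
    (summable_geometric_of_lt_one h0 h1)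

/-- Action values in `[0,∞]`. -/
noncomputable def qLower (Q : Kernel (S × A) (S × I)) [IsMarkovKernel Q] (γ : ℝ)
    (π : Kernel S A) [IsMarkovKernel π] (z : (S × A) × I) : ℝ≥0∞ :=
  ∫⁻ x, ENNReal.ofReal (discountedReturn γ x) ∂(trajFrom Q π z)

/-- Tonelli exchanges the series with the trajectory integral, and each marginal is an iterate of
the one-step kernel. Measurability in the starting point and the Bellman equation both come from
this form. -/
theorem qLower_eq_tsum (Q : Kernel (S × A) (S × I)) [IsMarkovKernel Q] {γ : ℝ}
    (h0 : 0 ≤ γ) (h1 : γ < 1) (π : Kernel S A) [IsMarkovKernel π] (z : (S × A) × I) :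
    qLower Q γ π z = ∑' t : ℕ, ENNReal.ofReal γ ^ t *
      ((fun (g : (S × A) × I → ℝ≥0∞) w => ∫⁻ v, g v ∂(stepKernel Q π w))^[t + 1])
        (fun v => ENNReal.ofReal (v.2 : ℝ)) z := by
  have hm : Measurable (fun v : (S × A) × I => ENNReal.ofReal (v.2 : ℝ)) := by fun_prop
  have h : ∀ x : ℕ → (S × A) × I, ENNReal.ofReal (discountedReturn γ x) =
      ∑' t : ℕ, ENNReal.ofReal γ ^ t * ENNReal.ofReal ((x (t + 1)).2 : ℝ) := by
    intro x
    rw [discountedReturn, ENNReal.ofReal_tsum_of_nonneg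
      (fun t => mul_nonneg (pow_nonneg h0 t) (x (t + 1)).2.2.1)
      (summable_discounted h0 h1 fun t => (x (t + 1)).2)]
    refine tsum_congr fun t => ?_
    rw [ENNReal.ofReal_mul (pow_nonneg h0 t), ENNReal.ofReal_pow h0]
  simp only [qLower, h]
  have hm' : ∀ t : ℕ, Measurable (fun x : ℕ → (S × A) × I =>
      ENNReal.ofReal ((x (t + 1)).2 : ℝ)) := fun t => hm.comp (measurable_pi_apply (t + 1))
  rw [lintegral_tsum (fun t => ((hm' t).const_mul _).aemeasurable)]
  refine tsum_congr fun t => ?_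
  rw [lintegral_const_mul _ (hm' t)]
  rw [← lintegral_trajFrom_iterate Q π z (t + 1) hm]

theorem measurable_iterate_stepKernel (Q : Kernel (S × A) (S × I)) [IsMarkovKernel Q]
    (π : Kernel S A) [IsMarkovKernel π] {f : (S × A) × I → ℝ≥0∞} (hf : Measurable f) (n : ℕ) :
    Measurable (((fun (g : (S × A) × I → ℝ≥0∞) w => ∫⁻ v, g v ∂(stepKernel Q π w))^[n]) f) := by
  induction n with
  | zero => simpa
  | succ n ih =>
    rw [Function.iterate_succ']
    exact ih.lintegral_kernel

theorem measurable_qLower (Q : Kernel (S × A) (S × I)) [IsMarkovKernel Q] {γ : ℝ}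
    (h0 : 0 ≤ γ) (h1 : γ < 1) (π : Kernel S A) [IsMarkovKernel π] :
    Measurable (qLower Q γ π) := by
  have : qLower Q γ π = fun z => _ := funext fun z => qLower_eq_tsum Q h0 h1 π z
  rw [this]
  refine Measurable.tsum fun t => ?_
  exact (measurable_iterate_stepKernel Q π (by fun_prop) (t + 1)).const_mul _

/-- Splitting off the first term of the series leaves the same series one step later; in `[0,∞]` no
summability has to be checked. -/
theorem qLower_bellman (Q : Kernel (S × A) (S × I)) [IsMarkovKernel Q] {γ : ℝ}
    (h0 : 0 ≤ γ) (h1 : γ < 1) (π : Kernel S A) [IsMarkovKernel π] (z : (S × A) × I) :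
    qLower Q γ π z = ∫⁻ w, (ENNReal.ofReal (w.2 : ℝ) + ENNReal.ofReal γ * qLower Q γ π w)
      ∂(stepKernel Q π z) := by
  have hm : Measurable (fun v : (S × A) × I => ENNReal.ofReal (v.2 : ℝ)) := by fun_prop
  rw [lintegral_add_left hm, lintegral_const_mul _ (measurable_qLower Q h0 h1 π)]
  simp only [qLower_eq_tsum Q h0 h1 π]
  rw [lintegral_tsum (fun t =>
    ((measurable_iterate_stepKernel Q π hm (t + 1)).const_mul _).aemeasurable)]
  rw [tsum_eq_zero_add' ENNReal.summable]
  simp only [pow_zero, one_mul, zero_add, Function.iterate_one, ← ENNReal.tsum_mul_left]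
  congr 1
  refine tsum_congr fun t => ?_
  rw [lintegral_const_mul _ (measurable_iterate_stepKernel Q π hm (t + 1)),
    Function.iterate_succ_apply', pow_succ']
  ring

theorem qLower_le (Q : Kernel (S × A) (S × I)) [IsMarkovKernel Q] {γ : ℝ}
    (h0 : 0 ≤ γ) (h1 : γ < 1) (π : Kernel S A) [IsMarkovKernel π] (z : (S × A) × I) :
    qLower Q γ π z ≤ ENNReal.ofReal (1 - γ)⁻¹ := by
  calc qLower Q γ π z ≤ ∫⁻ _, ENNReal.ofReal (1 - γ)⁻¹ ∂(trajFrom Q π z) :=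
        lintegral_mono fun x => ENNReal.ofReal_le_ofReal (discountedReturn_le h0 h1 x)
    _ = _ := by simp

/-- `stepKernel` ignores the reward slot of its argument, so the two Bellman right-hand sides
coincide definitionally. -/
theorem qLower_eq_of_fst_eq (Q : Kernel (S × A) (S × I)) [IsMarkovKernel Q] {γ : ℝ}
    (h0 : 0 ≤ γ) (h1 : γ < 1) (π : Kernel S A) [IsMarkovKernel π] (x : S × A) (r : I) :
    qLower Q γ π (x, r) = qLower Q γ π (x, 0) := by
  rw [qLower_bellman Q h0 h1 π (x, r), qLower_bellman Q h0 h1 π (x, 0)]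
  rfl

theorem qValue_eq_toReal (Q : Kernel (S × A) (S × I)) [IsMarkovKernel Q] {γ : ℝ}
    (h0 : 0 ≤ γ) (π : Kernel S A) [IsMarkovKernel π] (s : S) (a : A) :
    qValue Q γ π s a = (qLower Q γ π ((s, a), 0)).toReal :=
  integral_eq_lintegral_of_nonneg_ae (ae_of_all _ fun x => discountedReturn_nonneg h0 x)
    (measurable_discountedReturn γ).aestronglyMeasurable


theorem qValue_nonneg (Q : Kernel (S × A) (S × I)) [IsMarkovKernel Q] {γ : ℝ} (h0 : 0 ≤ γ)
    (π : Kernel S A) [IsMarkovKernel π] (s : S) (a : A) : 0 ≤ qValue Q γ π s a := by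
  rw [qValue_eq_toReal Q h0]; exact ENNReal.toReal_nonneg

theorem qValue_le (Q : Kernel (S × A) (S × I)) [IsMarkovKernel Q] {γ : ℝ} (h0 : 0 ≤ γ)
    (h1 : γ < 1) (π : Kernel S A) [IsMarkovKernel π]
    (s : S) (a : A) : qValue Q γ π s a ≤ (1 - γ)⁻¹ := by
  rw [qValue_eq_toReal Q h0]
  exact ENNReal.toReal_le_of_le_ofReal (by rw [inv_nonneg]; linarith) (qLower_le Q h0 h1 π _)

theorem measurable_qValue (Q : Kernel (S × A) (S × I)) [IsMarkovKernel Q] {γ : ℝ} (h0 : 0 ≤ γ)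
    (h1 : γ < 1) (π : Kernel S A) [IsMarkovKernel π]
    : Measurable (fun x : S × A => qValue Q γ π x.1 x.2) := by
  simp only [qValue_eq_toReal Q h0]
  exact ((measurable_qLower Q h0 h1 π).comp (by fun_prop)).ennreal_toReal

theorem ofReal_qValue (Q : Kernel (S × A) (S × I)) [IsMarkovKernel Q] {γ : ℝ} (h0 : 0 ≤ γ)
    (h1 : γ < 1) (π : Kernel S A) [IsMarkovKernel π]
    (x : S × A) (r : I) :
    qLower Q γ π (x, r) = ENNReal.ofReal (qValue Q γ π x.1 x.2) := by
  rw [qValue_eq_toReal Q h0, ENNReal.ofReal_toReal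
    (ne_top_of_le_ne_top ENNReal.ofReal_ne_top (qLower_le Q h0 h1 π _)),
    qLower_eq_of_fst_eq Q h0 h1]

theorem integrable_qValue (Q : Kernel (S × A) (S × I)) [IsMarkovKernel Q] {γ : ℝ} (h0 : 0 ≤ γ)
    (h1 : γ < 1) (π : Kernel S A) [IsMarkovKernel π]
    (s : S) : Integrable (qValue Q γ π s) (π s) := by
  refine Integrable.of_mem_Icc 0 (1 - γ)⁻¹ ?_ (ae_of_all _ fun a =>
    ⟨qValue_nonneg Q h0 π s a, qValue_le Q h0 h1 π s a⟩)
  exact ((measurable_qValue Q h0 h1 π).comp measurable_prodMk_left).aemeasurable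

theorem value_eq_integral (Q : Kernel (S × A) (S × I)) [IsMarkovKernel Q] {γ : ℝ} (h0 : 0 ≤ γ)
    (h1 : γ < 1) (π : Kernel S A) [IsMarkovKernel π]
    [DiscreteMeasurableSpace A] (s : S) :
    value Q γ π s = ∫ a, qValue Q γ π s a ∂(π s) := by
  have hm : AEMeasurable (fun a => trajSA Q π s a) (π s) := (Measurable.of_discrete).aemeasurable
  rw [value, trajS, integral_eq_lintegral_of_nonneg_ae
    (ae_of_all _ fun x => discountedReturn_nonneg h0 x)
    (measurable_discountedReturn γ).aestronglyMeasurable,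
    Measure.lintegral_bind hm (measurable_discountedReturn γ).ennreal_ofReal.aemeasurable,
    integral_eq_lintegral_of_nonneg_ae (ae_of_all _ fun a => qValue_nonneg Q h0 π s a)
      (integrable_qValue Q h0 h1 π s).aestronglyMeasurable]
  congr 1
  exact lintegral_congr fun a => ofReal_qValue Q h0 h1 π (s, a) 0

theorem value_nonneg (Q : Kernel (S × A) (S × I)) [IsMarkovKernel Q] {γ : ℝ} (h0 : 0 ≤ γ)
    (h1 : γ < 1) (π : Kernel S A) [IsMarkovKernel π]
    [DiscreteMeasurableSpace A] (s : S) : 0 ≤ value Q γ π s := by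
  rw [value_eq_integral Q h0 h1]
  exact integral_nonneg fun a => qValue_nonneg Q h0 π s a

theorem value_le (Q : Kernel (S × A) (S × I)) [IsMarkovKernel Q] {γ : ℝ} (h0 : 0 ≤ γ)
    (h1 : γ < 1) (π : Kernel S A) [IsMarkovKernel π]
    [DiscreteMeasurableSpace A] (s : S) : value Q γ π s ≤ (1 - γ)⁻¹ := by
  rw [value_eq_integral Q h0 h1]
  calc _ ≤ ∫ _, (1 - γ)⁻¹ ∂(π s) :=
        integral_mono (integrable_qValue Q h0 h1 π s) (integrable_const _)
          (fun a => qValue_le Q h0 h1 π s a)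
    _ = _ := by simp

theorem ofReal_value (Q : Kernel (S × A) (S × I)) [IsMarkovKernel Q] {γ : ℝ} (h0 : 0 ≤ γ)
    (h1 : γ < 1) (π : Kernel S A) [IsMarkovKernel π]
    [DiscreteMeasurableSpace A] (s : S) :
    ENNReal.ofReal (value Q γ π s) = ∫⁻ a, ENNReal.ofReal (qValue Q γ π s a) ∂(π s) := by
  rw [value_eq_integral Q h0 h1, ofReal_integral_eq_lintegral_ofReal
    (integrable_qValue Q h0 h1 π s) (ae_of_all _ fun a => qValue_nonneg Q h0 π s a)]

theorem measurable_value (Q : Kernel (S × A) (S × I)) [IsMarkovKernel Q] {γ : ℝ} (h0 : 0 ≤ γ)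
    (h1 : γ < 1) (π : Kernel S A) [IsMarkovKernel π]
    [DiscreteMeasurableSpace A] : Measurable (value Q γ π) := by
  have h : value Q γ π = fun s => (∫⁻ a, ENNReal.ofReal (qValue Q γ π s a) ∂(π s)).toReal := by
    funext s
    rw [← ofReal_value Q h0 h1, ENNReal.toReal_ofReal (value_nonneg Q h0 h1 π s)]
  rw [h]
  exact ((measurable_qValue Q h0 h1 π).ennreal_ofReal.lintegral_kernel_prod_right').ennreal_toReal

theorem lintegral_qLower [DiscreteMeasurableSpace A] (Q : Kernel (S × A) (S × I))
    [IsMarkovKernel Q] {γ : ℝ} (h0 : 0 ≤ γ) (h1 : γ < 1) (π : Kernel S A) [IsMarkovKernel π]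
    (y : S × I) :
    ∫⁻ a, (ENNReal.ofReal (y.2 : ℝ) + ENNReal.ofReal γ * qLower Q γ π ((y.1, a), y.2)) ∂(π y.1) =
      ENNReal.ofReal ((y.2 : ℝ) + γ * value Q γ π y.1) := by
  rw [ENNReal.ofReal_add y.2.2.1 (mul_nonneg h0 (value_nonneg Q h0 h1 π y.1)),
    ENNReal.ofReal_mul h0, ofReal_value Q h0 h1, lintegral_add_left measurable_const,
    lintegral_const_mul' _ _ ENNReal.ofReal_ne_top, lintegral_const, measure_univ, mul_one]
  congr 2
  exact lintegral_congr fun a => ofReal_qValue Q h0 h1 π (y.1, a) y.2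

theorem qValue_bellman [DiscreteMeasurableSpace A] (Q : Kernel (S × A) (S × I))
    [IsMarkovKernel Q] {γ : ℝ} (h0 : 0 ≤ γ) (h1 : γ < 1) (π : Kernel S A) [IsMarkovKernel π]
    (s : S) (a : A) :
    qValue Q γ π s a = ∫ y, ((y.2 : ℝ) + γ * value Q γ π y.1) ∂(Q (s, a)) := by
  have hv := measurable_value Q h0 h1 π
  have hq := measurable_qLower Q h0 h1 π
  have hm : Measurable (fun v : (S × A) × I => ENNReal.ofReal (v.2 : ℝ)) := by fun_prop
  have hw : Measurable (fun w : (S × A) × I => ENNReal.ofReal (w.2 : ℝ) +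
      ENNReal.ofReal γ * qLower Q γ π w) := hm.add (hq.const_mul _)
  have hi : Measurable (fun y : S × I => (y.2 : ℝ) + γ * value Q γ π y.1) :=
    (measurable_subtype_coe.comp measurable_snd).add ((hv.comp measurable_fst).const_mul _)
  have hn : ∀ y : S × I, 0 ≤ (y.2 : ℝ) + γ * value Q γ π y.1 := fun y => add_nonneg y.2.2.1
      (mul_nonneg h0 (value_nonneg Q h0 h1 π y.1))
  have e1 := integral_eq_lintegral_of_nonneg_ae (μ := Q (s, a)) (ae_of_all _ hn)
    hi.aestronglyMeasurable
  have e2 := lintegral_stepKernel Q π ((s, a), 0) hw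
  rw [e1, qValue_eq_toReal Q h0, qLower_bellman Q h0 h1, e2]
  exact congrArg _ (lintegral_congr fun y => lintegral_qLower Q h0 h1 π y)

end Bellman

end MDP

/-! ### First maximizers and their measurability -/

namespace Capi

theorem argmaxFirst_eq_iff {A : Type*} [Fintype A] [LinearOrder A] [Nonempty A] (f : A → ℝ)
    (a : A) : argmaxFirst f = a ↔
      (∀ b, f b ≤ f a) ∧ ∀ a', (∀ b, f b ≤ f a') → a ≤ a' := by
  have h := Finset.min'_mem _ (maximizers_nonempty f)
  have h' := fun a' => Finset.min'_le (Finset.univ.filter (fun a => ∀ b, f b ≤ f a)) a'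
  simp only [Finset.mem_filter, Finset.mem_univ, true_and] at h h'
  constructor
  · rintro rfl
    exact ⟨h, h'⟩
  · rintro ⟨h1, h2⟩
    exact le_antisymm (h' a h1) (h2 _ h)

theorem le_argmaxFirst {A : Type*} [Fintype A] [LinearOrder A] [Nonempty A] (f : A → ℝ) (b : A) :
    f b ≤ f (argmaxFirst f) :=
  ((argmaxFirst_eq_iff f _).1 rfl).1 b

theorem measurable_argmaxFirst {S A : Type*} [MeasurableSpace S] [Fintype A] [LinearOrder A]
    [Nonempty A] [MeasurableSpace A] [DiscreteMeasurableSpace A] {f : S → A → ℝ}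
    (hf : ∀ a, Measurable (fun s => f s a)) : Measurable (fun s => argmaxFirst (f s)) := by
  refine measurable_to_countable' fun a => ?_
  have : (fun s => argmaxFirst (f s)) ⁻¹' {a} = {s | ∀ b, f s b ≤ f s a} ∩
      ⋂ a', {s | (∀ b, f s b ≤ f s a') → a ≤ a'} := by
    ext s
    simpa using argmaxFirst_eq_iff (f s) a
  rw [this]
  have h1 : ∀ a, MeasurableSet {s | ∀ b, f s b ≤ f s a} := fun a => by
    rw [Set.ofPred_forall]
    exact MeasurableSet.iInter fun b => measurableSet_le (hf b) (hf a)
  exact (h1 a).inter (MeasurableSet.iInter fun a' => (h1 a').imp (MeasurableSet.const _))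

end Capi

namespace MDP

/-! ### Backups, contraction, and nearly optimal deterministic policies -/

section Backup

variable {S A : Type*} [MeasurableSpace S] [MeasurableSpace A]

/-- Measurable functions with values in `[0, 1/(1-γ)]`, the range of value functions. -/
def IsVal (γ : ℝ) (w : S → ℝ) : Prop :=
  Measurable w ∧ ∀ s, 0 ≤ w s ∧ w s ≤ (1 - γ)⁻¹

/-- One-step backup of `w`. -/
noncomputable def backup (Q : Kernel (S × A) (S × I)) (γ : ℝ) (w : S → ℝ) (s : S) (a : A) : ℝ :=
  ∫ y, ((y.2 : ℝ) + γ * w y.1) ∂(Q (s, a))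

theorem one_add_mul_inv {γ : ℝ} (h1 : γ < 1) : 1 + γ * (1 - γ)⁻¹ = (1 - γ)⁻¹ := by
  have : (1 - γ) ≠ 0 := by linarith
  field_simp
  ring

theorem IsVal.integrand_measurable {γ : ℝ} {w : S → ℝ} (hw : IsVal γ w) :
    Measurable (fun y : S × I => (y.2 : ℝ) + γ * w y.1) :=
  (measurable_subtype_coe.comp measurable_snd).add ((hw.1.comp measurable_fst).const_mul _)

theorem IsVal.integrand_mem {γ : ℝ} (h0 : 0 ≤ γ) (h1 : γ < 1) {w : S → ℝ} (hw : IsVal γ w)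
    (y : S × I) : (y.2 : ℝ) + γ * w y.1 ∈ Set.Icc 0 (1 - γ)⁻¹ := by
  constructor
  · exact add_nonneg y.2.2.1 (mul_nonneg h0 (hw.2 _).1)
  · rw [← one_add_mul_inv h1]
    exact add_le_add y.2.2.2 (mul_le_mul_of_nonneg_left (hw.2 _).2 h0)

theorem IsVal.integrable {γ : ℝ} (h0 : 0 ≤ γ) (h1 : γ < 1) {w : S → ℝ} (hw : IsVal γ w)
    (μ : Measure (S × I)) [IsFiniteMeasure μ] :
    Integrable (fun y : S × I => (y.2 : ℝ) + γ * w y.1) μ :=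
  Integrable.of_mem_Icc 0 (1 - γ)⁻¹ hw.integrand_measurable.aemeasurable
    (ae_of_all _ fun y => hw.integrand_mem h0 h1 y)

variable (Q : Kernel (S × A) (S × I)) [IsMarkovKernel Q]

theorem backup_nonneg {γ : ℝ} (h0 : 0 ≤ γ) {w : S → ℝ} (hw : ∀ s, 0 ≤ w s) (s : S) (a : A) :
    0 ≤ backup Q γ w s a :=
  integral_nonneg fun y => add_nonneg y.2.2.1 (mul_nonneg h0 (hw _))

theorem backup_le {γ : ℝ} (h0 : 0 ≤ γ) (h1 : γ < 1) {w : S → ℝ} (hw : IsVal γ w) (s : S) (a : A) :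
    backup Q γ w s a ≤ (1 - γ)⁻¹ := by
  calc backup Q γ w s a ≤ ∫ _, (1 - γ)⁻¹ ∂(Q (s, a)) :=
        integral_mono (hw.integrable h0 h1 _) (integrable_const _)
          (fun y => (hw.integrand_mem h0 h1 y).2)
    _ = _ := by simp

theorem backup_le_backup_add {γ : ℝ} (h0 : 0 ≤ γ) (h1 : γ < 1) {w w' : S → ℝ} (hw : IsVal γ w)
    (hw' : IsVal γ w') {c : ℝ} (h : ∀ s, w s ≤ w' s + c) (s : S) (a : A) :
    backup Q γ w s a ≤ backup Q γ w' s a + γ * c := by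
  have e : backup Q γ w' s a + γ * c = ∫ y, (((y.2 : ℝ) + γ * w' y.1) + γ * c) ∂(Q (s, a)) := by
    rw [integral_add (hw'.integrable h0 h1 _) (integrable_const _)]
    simp [backup]
  rw [e]
  refine integral_mono (hw.integrable h0 h1 _)
    ((hw'.integrable h0 h1 _).add (integrable_const _)) fun y => ?_
  have := mul_le_mul_of_nonneg_left (h y.1) h0
  linarith

theorem backup_mono {γ : ℝ} (h0 : 0 ≤ γ) (h1 : γ < 1) {w w' : S → ℝ} (hw : IsVal γ w)
    (hw' : IsVal γ w') (h : ∀ s, w s ≤ w' s) (s : S) (a : A) :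
    backup Q γ w s a ≤ backup Q γ w' s a := by
  simpa using backup_le_backup_add Q h0 h1 hw hw' (c := 0) (by simpa using h) s a

theorem measurable_backup {γ : ℝ} {w : S → ℝ} (hw : IsVal γ w) :
    Measurable (fun x : S × A => backup Q γ w x.1 x.2) :=
  (StronglyMeasurable.integral_kernel (κ := Q)
    hw.integrand_measurable.stronglyMeasurable).measurable

theorem isVal_backup {γ : ℝ} (h0 : 0 ≤ γ) (h1 : γ < 1) {w : S → ℝ} (hw : IsVal γ w) {g : S → A}
    (hg : Measurable g) : IsVal γ (fun s => backup Q γ w s (g s)) :=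
  ⟨(measurable_backup Q hw).comp (measurable_id.prodMk hg), fun s =>
    ⟨backup_nonneg Q h0 (fun s => (hw.2 s).1) s _, backup_le Q h0 h1 hw s _⟩⟩

variable [DiscreteMeasurableSpace A]

theorem isVal_value {γ : ℝ} (h0 : 0 ≤ γ) (h1 : γ < 1) (π : Kernel S A) [IsMarkovKernel π] :
    IsVal γ (value Q γ π) :=
  ⟨measurable_value Q h0 h1 π, fun s => ⟨value_nonneg Q h0 h1 π s, value_le Q h0 h1 π s⟩⟩

theorem qValue_eq_backup {γ : ℝ} (h0 : 0 ≤ γ) (h1 : γ < 1) (π : Kernel S A) [IsMarkovKernel π]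
    (s : S) (a : A) : qValue Q γ π s a = backup Q γ (value Q γ π) s a :=
  qValue_bellman Q h0 h1 π s a

/-- Value function of a deterministic policy. -/
noncomputable def detValue (γ : ℝ) (g : {g : S → A // Measurable g}) : S → ℝ :=
  value Q γ (Kernel.deterministic g.1 g.2)

theorem isVal_detValue {γ : ℝ} (h0 : 0 ≤ γ) (h1 : γ < 1) (g : {g : S → A // Measurable g}) :
    IsVal γ (detValue Q γ g) :=
  isVal_value Q h0 h1 _

/-- Action values of a deterministic policy. -/
noncomputable def detQ (γ : ℝ) (g : {g : S → A // Measurable g}) : S → A → ℝ :=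
  qValue Q γ (Kernel.deterministic g.1 g.2)

theorem detQ_eq_backup {γ : ℝ} (h0 : 0 ≤ γ) (h1 : γ < 1) (g : {g : S → A // Measurable g})
    (s : S) (a : A) : detQ Q γ g s a = backup Q γ (detValue Q γ g) s a :=
  qValue_eq_backup Q h0 h1 _ s a

theorem detValue_eq_detQ {γ : ℝ} (h0 : 0 ≤ γ) (h1 : γ < 1) (g : {g : S → A // Measurable g})
    (s : S) : detValue Q γ g s = detQ Q γ g s (g.1 s) := by
  rw [detValue, value_eq_integral Q h0 h1, Kernel.deterministic_apply, integral_dirac]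
  rfl

theorem detValue_eq_backup {γ : ℝ} (h0 : 0 ≤ γ) (h1 : γ < 1) (g : {g : S → A // Measurable g})
    (s : S) : detValue Q γ g s = backup Q γ (detValue Q γ g) s (g.1 s) := by
  rw [detValue_eq_detQ Q h0 h1, detQ_eq_backup Q h0 h1]

/-- If a bounded difference satisfies a contraction inequality, it is bounded by its fixed point. -/
theorem le_of_contraction {X : Type*} {γ c : ℝ} (h1 : γ < 1) {f : X → ℝ} {b : ℝ}
    (hb : ∀ x, f x ≤ b)
    (h : ∀ C, (∀ x, f x ≤ C) → ∀ x, f x ≤ γ * C + c) (x : X) : f x ≤ c * (1 - γ)⁻¹ := by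
  have hbd : BddAbove (Set.range f) := ⟨b, by rintro _ ⟨x, rfl⟩; exact hb x⟩
  have hle : ∀ x, f x ≤ ⨆ x, f x := fun x => le_ciSup hbd x
  have : Nonempty X := ⟨x⟩
  have h2 : ⨆ x, f x ≤ γ * (⨆ x, f x) + c := ciSup_le (h _ hle)
  refine (hle x).trans ?_
  rw [← div_eq_mul_inv, le_div_iff₀ (by linarith)]
  linarith

/-- The difference `w - v^g` satisfies the contraction inequality. With `c = 0` this is the policy
improvement theorem. -/
theorem le_detValue_of_le_backup {γ : ℝ} (h0 : 0 ≤ γ) (h1 : γ < 1) {w : S → ℝ} (hw : IsVal γ w)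
    (g : {g : S → A // Measurable g}) {c : ℝ} (h : ∀ s, w s ≤ backup Q γ w s (g.1 s) + c) (s : S) :
    w s ≤ detValue Q γ g s + c * (1 - γ)⁻¹ := by
  have hv := isVal_detValue Q h0 h1 g
  have := le_of_contraction (γ := γ) (c := c) (f := fun s => w s - detValue Q γ g s)
    (b := (1 - γ)⁻¹) h1 (fun s => by linarith [(hw.2 s).2, (hv.2 s).1]) (fun C hC s => by
      have h2 := backup_le_backup_add Q h0 h1 hw hv (c := C) (fun s => by linarith [hC s]) s (g.1 s)
      have h3 := detValue_eq_backup Q h0 h1 g s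
      linarith [h s]) s
  linarith

variable [Fintype A]

/-- The converse comparison, needed for randomized policies: averaging over actions preserves a
bound that is uniform in the action. -/
theorem value_le_of_backup_le {γ : ℝ} (h0 : 0 ≤ γ) (h1 : γ < 1) {w : S → ℝ} (hw : IsVal γ w)
    (ρ : Kernel S A) [IsMarkovKernel ρ] {c : ℝ} (h : ∀ s a, backup Q γ w s a ≤ w s + c) (s : S) :
    value Q γ ρ s ≤ w s + c * (1 - γ)⁻¹ := by
  have hv := isVal_value Q h0 h1 ρ
  have := le_of_contraction (γ := γ) (c := c) (f := fun s => value Q γ ρ s - w s)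
    (b := (1 - γ)⁻¹) h1 (fun s => by linarith [(hv.2 s).2, (hw.2 s).1]) (fun C hC s => by
      have h2 : ∀ a, qValue Q γ ρ s a ≤ w s + c + γ * C := fun a => by
        rw [qValue_eq_backup Q h0 h1]
        have h2 := backup_le_backup_add Q h0 h1 hv hw (c := C) (fun s => by linarith [hC s]) s a
        linarith [h s a]
      have h3 : value Q γ ρ s ≤ w s + c + γ * C := by
        rw [value_eq_integral Q h0 h1]
        calc _ ≤ ∫ _, (w s + c + γ * C) ∂(ρ s) :=
              integral_mono (integrable_qValue Q h0 h1 ρ s) (integrable_const _) h2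
          _ = _ := by simp
      linarith) s
  linarith

variable [LinearOrder A] [Nonempty A]

/-- Value iteration. -/
noncomputable def valueIter (γ : ℝ) : ℕ → S → ℝ
  | 0 => fun _ => 0
  | n + 1 => fun s => backup Q γ (valueIter γ n) s
      (Capi.argmaxFirst (backup Q γ (valueIter γ n) s))

theorem valueIter_succ (γ : ℝ) (n : ℕ) (s : S) : valueIter Q γ (n + 1) s =
    backup Q γ (valueIter Q γ n) s (Capi.argmaxFirst (backup Q γ (valueIter Q γ n) s)) := rfl

theorem measurable_greedy {γ : ℝ} {w : S → ℝ} (hw : IsVal γ w) :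
    Measurable (fun s => Capi.argmaxFirst (backup Q γ w s)) :=
  Capi.measurable_argmaxFirst fun _ => (measurable_backup Q hw).comp measurable_prodMk_right

theorem isVal_valueIter {γ : ℝ} (h0 : 0 ≤ γ) (h1 : γ < 1) (n : ℕ) :
    IsVal γ (valueIter Q γ n) := by
  induction n with
  | zero => exact ⟨measurable_const, fun s => ⟨le_rfl, by
      simp only [valueIter, inv_nonneg]; linarith⟩⟩
  | succ n ih => exact isVal_backup Q h0 h1 ih (measurable_greedy Q ih)

/-- Iterates from 0 increase because backups are monotone, and each increment is at most `γ` times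
the bound on the previous one. -/
theorem valueIter_succ_le {γ : ℝ} (h0 : 0 ≤ γ) (h1 : γ < 1) (n : ℕ) (s : S) :
    valueIter Q γ n s ≤ valueIter Q γ (n + 1) s ∧
      valueIter Q γ (n + 1) s ≤ valueIter Q γ n s + γ ^ n * (1 - γ)⁻¹ := by
  induction n generalizing s with
  | zero =>
    have := (isVal_valueIter Q h0 h1 1).2 s
    simp only [zero_add, pow_zero, one_mul]
    exact ⟨this.1, by simpa [valueIter] using this.2⟩
  | succ n ih =>
    have hn := isVal_valueIter Q h0 h1 n
    have hn1 := isVal_valueIter Q h0 h1 (n + 1)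
    constructor
    · rw [valueIter_succ Q γ n, valueIter_succ Q γ (n + 1)]
      exact (backup_mono Q h0 h1 hn hn1 (fun s => (ih s).1) s _).trans (Capi.le_argmaxFirst _ _)
    · rw [valueIter_succ Q γ (n + 1), valueIter_succ Q γ n]
      refine (backup_le_backup_add Q h0 h1 hn1 hn (fun s => (ih s).2) s _).trans ?_
      rw [pow_succ', mul_assoc]
      exact add_le_add_left (Capi.le_argmaxFirst (backup Q γ (valueIter Q γ n) s) _) _

/-- Some deterministic policy is almost optimal, uniformly in the state. -/
theorem exists_detValue_ge {γ : ℝ} (h0 : 0 ≤ γ) (h1 : γ < 1) {η : ℝ} (hη : 0 < η) :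
    ∃ g : {g : S → A // Measurable g}, ∀ (ρ : Kernel S A) [IsMarkovKernel ρ] (s : S),
      value Q γ ρ s ≤ detValue Q γ g s + η := by
  have hpos : 0 < (1 - γ)⁻¹ := inv_pos.2 (by linarith)
  obtain ⟨n, hn⟩ := exists_pow_lt_of_lt_one
    (show 0 < η * (1 - γ) * (1 - γ) by have : 0 < 1 - γ := by linarith
                                       positivity) h1
  have hw := isVal_valueIter Q h0 h1 n
  have hc : γ ^ n * (1 - γ)⁻¹ * (1 - γ)⁻¹ ≤ η := by
    rw [← div_eq_mul_inv, ← div_eq_mul_inv, div_le_iff₀ (by linarith), div_le_iff₀ (by linarith)]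
    exact hn.le
  refine ⟨⟨_, measurable_greedy Q hw⟩, fun ρ _ s => ?_⟩
  have h2 := value_le_of_backup_le Q h0 h1 hw ρ (c := γ ^ n * (1 - γ)⁻¹) (fun s a =>
    (Capi.le_argmaxFirst (backup Q γ (valueIter Q γ n) s) a).trans
      (valueIter_succ_le Q h0 h1 n s).2) s
  have h3 := le_detValue_of_le_backup Q h0 h1 hw ⟨_, measurable_greedy Q hw⟩ (c := 0) (fun s => by
    rw [add_zero]
    exact (valueIter_succ_le Q h0 h1 n s).1) s
  linarith

/-- Realizability concerns deterministic policies only, so the supremum over all policies has to be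
reduced to them. -/
theorem optValue_le {γ : ℝ} (h0 : 0 ≤ γ) (h1 : γ < 1) (s : S) {b : ℝ}
    (h : ∀ g : {g : S → A // Measurable g}, detValue Q γ g s ≤ b) : optValue Q γ s ≤ b := by
  have : Nonempty {π : Kernel S A // IsMarkovKernel π} :=
    ⟨⟨Kernel.deterministic (fun _ => Classical.arbitrary A) measurable_const, inferInstance⟩⟩
  refine ciSup_le fun π => ?_
  have := π.2
  refine le_of_forall_pos_le_add fun η hη => ?_
  obtain ⟨g, hg⟩ := exists_detValue_ge Q h0 h1 hη
  exact (hg π.1 s).trans (add_le_add_left (h g) η)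

end Backup

end MDP

namespace Capi

/-! ### Gram matrices and the elliptical potential bound -/

section Gram

open Matrix

variable {d : ℕ}

/-- The regularized Gram matrix `λ 𝕀 + ∑ v vᵀ` of a list of vectors. -/
noncomputable def gram (lam : ℝ) (F : List (Fin d → ℝ)) : Matrix (Fin d) (Fin d) ℝ :=
  lam • (1 : Matrix (Fin d) (Fin d) ℝ) + (F.map (fun v => vecMulVec v v)).sum

theorem designMatrix_eq_gram {S A : Type*} (lam : ℝ) (C : List (Item S A d)) :
    designMatrix lam C = gram lam (C.map Item.feat) := by
  simp [designMatrix, gram, List.map_map, Function.comp_def]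

theorem gram_append_singleton (lam : ℝ) (F : List (Fin d → ℝ)) (v : Fin d → ℝ) :
    gram lam (F ++ [v]) = gram lam F + vecMulVec v v := by
  simp [gram, add_assoc]

theorem gram_nil (lam : ℝ) : gram lam ([] : List (Fin d → ℝ)) = lam • 1 := by
  simp [gram]

theorem dotProduct_gram (lam : ℝ) (F : List (Fin d → ℝ)) (x y : Fin d → ℝ) :
    x ⬝ᵥ (gram lam F *ᵥ y) = lam * (x ⬝ᵥ y) + (F.map (fun v => (v ⬝ᵥ x) * (v ⬝ᵥ y))).sum := by
  induction F using List.reverseRecOn with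
  | nil => simp [gram_nil, smul_mulVec]
  | append_singleton F v ih =>
    rw [gram_append_singleton, add_mulVec, dotProduct_add, ih]
    simp only [List.map_append, List.sum_append, List.map_cons, List.map_nil, List.sum_cons,
      List.sum_nil, add_zero, vecMulVec_mulVec]
    rw [← add_assoc]
    congr 1
    simp [dotProduct_smul, dotProduct_comm x v, mul_comm]

theorem gram_isHermitian (lam : ℝ) (F : List (Fin d → ℝ)) : (gram lam F).IsHermitian := by
  induction F using List.reverseRecOn with
  | nil =>
    rw [gram_nil, IsHermitian, conjTranspose_smul]
    simp
  | append_singleton F v ih =>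
    rw [gram_append_singleton]
    refine ih.add ?_
    rw [IsHermitian, conjTranspose_vecMulVec]
    simp

theorem gram_posDef {lam : ℝ} (hl : 0 < lam) (F : List (Fin d → ℝ)) : (gram lam F).PosDef := by
  refine PosDef.of_dotProduct_mulVec_pos (gram_isHermitian lam F) fun x hx => ?_
  rw [star_trivial, dotProduct_gram]
  have h1 : 0 < x ⬝ᵥ x := by
    have := dotProduct_star_self_pos_iff.2 hx
    rwa [star_trivial] at this
  have h2 : 0 ≤ (F.map (fun v => (v ⬝ᵥ x) * (v ⬝ᵥ x))).sum :=
    List.sum_nonneg (by simp only [List.mem_map]; rintro _ ⟨v, -, rfl⟩; exact mul_self_nonneg _)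
  positivity

theorem PosDef.mulVec_inv_mulVec {M : Matrix (Fin d) (Fin d) ℝ} (hM : M.PosDef) (x : Fin d → ℝ) :
    M *ᵥ (M⁻¹ *ᵥ x) = x := by
  rw [mulVec_mulVec, mul_nonsing_inv _ hM.det_pos.ne'.isUnit, one_mulVec]

theorem dotProduct_mulVec_symm {M : Matrix (Fin d) (Fin d) ℝ} (hM : M.IsHermitian)
    (x y : Fin d → ℝ) : x ⬝ᵥ (M *ᵥ y) = y ⬝ᵥ (M *ᵥ x) := by
  have h : Mᵀ = M := by simpa [IsHermitian, conjTranspose_eq_transpose_of_trivial] using hM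
  rw [dotProduct_mulVec, ← mulVec_transpose, h, dotProduct_comm]

/-- Cauchy-Schwarz for a positive definite matrix and its inverse. -/
theorem sq_dotProduct_le {M : Matrix (Fin d) (Fin d) ℝ} (hM : M.PosDef) (x u : Fin d → ℝ) :
    (x ⬝ᵥ u) ^ 2 ≤ (x ⬝ᵥ (M⁻¹ *ᵥ x)) * (u ⬝ᵥ (M *ᵥ u)) := by
  -- The quadratic form of `M` at `M⁻¹ x - t u`, expanded in `t`; its nonnegativity forces the
  -- discriminant to be nonpositive.
  have key : ∀ t : ℝ, 0 ≤ (u ⬝ᵥ (M *ᵥ u)) * (t * t) + (-2 * (x ⬝ᵥ u)) * t + x ⬝ᵥ (M⁻¹ *ᵥ x) := by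
    intro t
    have h := hM.posSemidef.dotProduct_mulVec_nonneg (M⁻¹ *ᵥ x - t • u)
    rw [star_trivial, mulVec_sub, PosDef.mulVec_inv_mulVec hM, mulVec_smul, sub_dotProduct,
      dotProduct_sub, dotProduct_sub, dotProduct_smul, smul_dotProduct, smul_dotProduct,
      dotProduct_smul, dotProduct_mulVec_symm hM.isHermitian (M⁻¹ *ᵥ x) u,
      PosDef.mulVec_inv_mulVec hM, dotProduct_comm (M⁻¹ *ᵥ x) x, dotProduct_comm u x] at h
    simp only [smul_eq_mul] at h
    linarith
  have h := discrim_le_zero key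
  rw [discrim] at h
  nlinarith

theorem inv_dotProduct_nonneg {M : Matrix (Fin d) (Fin d) ℝ} (hM : M.PosDef) (x : Fin d → ℝ) :
    0 ≤ x ⬝ᵥ (M⁻¹ *ᵥ x) := by
  simpa using hM.inv.posSemidef.dotProduct_mulVec_nonneg x

theorem inv_dotProduct_eq {M : Matrix (Fin d) (Fin d) ℝ} (hM : M.PosDef) (x : Fin d → ℝ) :
    (M⁻¹ *ᵥ x) ⬝ᵥ (M *ᵥ (M⁻¹ *ᵥ x)) = x ⬝ᵥ (M⁻¹ *ᵥ x) := by
  rw [PosDef.mulVec_inv_mulVec hM, dotProduct_comm]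

theorem le_of_sq_le_mul {a b : ℝ} (hb : 0 ≤ b) (ha : 0 ≤ a) (h : b ^ 2 ≤ a * b) : b ≤ a := by
  rcases hb.eq_or_lt with h0 | h0
  · rwa [← h0]
  · exact le_of_mul_le_mul_right (by rwa [sq] at h) h0

/-- Cauchy-Schwarz with `u = M'⁻¹ x`: the form of `M` at `u` is at most that of `M'`, which is the
left-hand side itself, and one factor cancels. -/
theorem inv_dotProduct_antitone {M M' : Matrix (Fin d) (Fin d) ℝ} (hM : M.PosDef)
    (hM' : M'.PosDef) (h : ∀ u, u ⬝ᵥ (M *ᵥ u) ≤ u ⬝ᵥ (M' *ᵥ u)) (x : Fin d → ℝ) :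
    x ⬝ᵥ (M'⁻¹ *ᵥ x) ≤ x ⬝ᵥ (M⁻¹ *ᵥ x) := by
  refine le_of_sq_le_mul (inv_dotProduct_nonneg hM' x) (inv_dotProduct_nonneg hM x) ?_
  refine (sq_dotProduct_le hM x (M'⁻¹ *ᵥ x)).trans ?_
  refine mul_le_mul_of_nonneg_left ?_ (inv_dotProduct_nonneg hM x)
  rw [← inv_dotProduct_eq hM' x]
  exact h _

theorem gram_dotProduct_mono (lam : ℝ) {F F' : List (Fin d → ℝ)} (h : F <+: F')
    (u : Fin d → ℝ) : u ⬝ᵥ (gram lam F *ᵥ u) ≤ u ⬝ᵥ (gram lam F' *ᵥ u) := by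
  obtain ⟨G, rfl⟩ := h
  rw [dotProduct_gram, dotProduct_gram, List.map_append, List.sum_append]
  have h2 : 0 ≤ (G.map (fun v => (v ⬝ᵥ u) * (v ⬝ᵥ u))).sum :=
    List.sum_nonneg (by simp only [List.mem_map]; rintro _ ⟨v, -, rfl⟩; exact mul_self_nonneg _)
  linarith

/-- With `w` the left-hand side and `u = V⁻¹ v`, the number `w²` is one of the nonnegative summands
of `uᵀ V u = w`; hence `w² ≤ w`. -/
theorem inv_gram_le_one {lam : ℝ} (hl : 0 < lam) {F : List (Fin d → ℝ)} {v : Fin d → ℝ}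
    (hv : v ∈ F) : v ⬝ᵥ ((gram lam F)⁻¹ *ᵥ v) ≤ 1 := by
  have hM := gram_posDef hl F
  refine le_of_sq_le_mul (inv_dotProduct_nonneg hM v) zero_le_one ?_
  rw [one_mul]
  nth_rewrite 2 [← inv_dotProduct_eq hM v]
  rw [dotProduct_gram]
  set u := (gram lam F)⁻¹ *ᵥ v
  have h1 : (v ⬝ᵥ u) * (v ⬝ᵥ u) ≤ (F.map (fun v => (v ⬝ᵥ u) * (v ⬝ᵥ u))).sum :=
    List.single_le_sum (by simp only [List.mem_map]; rintro _ ⟨v, -, rfl⟩; exact mul_self_nonneg _)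
      _ (List.mem_map.2 ⟨v, hv, rfl⟩)
  have h2 : 0 ≤ u ⬝ᵥ u := by simpa using dotProduct_star_self_nonneg u
  nlinarith [mul_nonneg hl.le h2]

/-- The matrix determinant lemma for a rank-one update. -/
theorem det_gram_append {lam : ℝ} (hl : 0 < lam) (F : List (Fin d → ℝ)) (v : Fin d → ℝ) :
    (gram lam (F ++ [v])).det = (gram lam F).det * (1 + v ⬝ᵥ ((gram lam F)⁻¹ *ᵥ v)) := by
  have hM := gram_posDef hl F
  rw [gram_append_singleton, vecMulVec_eq Unit,
    det_add_replicateCol_mul_replicateRow hM.det_pos.ne'.isUnit]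
  congr 1
  rw [det_unique, Matrix.add_apply, one_apply_eq, Matrix.mul_assoc]
  simp [Matrix.mul_apply, dotProduct, mulVec]

theorem trace_gram (lam : ℝ) (F : List (Fin d → ℝ)) :
    (gram lam F).trace = d * lam + (F.map (fun v => v ⬝ᵥ v)).sum := by
  induction F using List.reverseRecOn with
  | nil => simp [gram_nil, mul_comm]
  | append_singleton F v ih =>
    rw [gram_append_singleton, trace_add, ih, trace_vecMulVec]
    simp [add_assoc]

/-- The tangent of the logarithm at `m`, applied to each eigenvalue: a form of the AM-GM inequality
that needs no division by `d`. -/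
theorem log_det_le {M : Matrix (Fin d) (Fin d) ℝ} (hM : M.PosDef) {m : ℝ} (hm : 0 < m) :
    Real.log M.det ≤ d * Real.log m + (M.trace / m - d) := by
  rw [hM.isHermitian.det_eq_prod_eigenvalues, hM.isHermitian.trace_eq_sum_eigenvalues]
  simp only [RCLike.ofReal_real_eq_id, id]
  rw [Real.log_prod (fun i _ => (hM.eigenvalues_pos i).ne'), Finset.sum_div]
  have : (d : ℝ) * Real.log m + (∑ i, hM.isHermitian.eigenvalues i / m - d) =
      ∑ i : Fin d, (Real.log m + (hM.isHermitian.eigenvalues i / m - 1)) := by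
    simp [Finset.sum_add_distrib, Finset.sum_sub_distrib]
  rw [this]
  refine Finset.sum_le_sum fun i _ => ?_
  have hp := hM.eigenvalues_pos i
  have := Real.log_le_sub_one_of_pos (div_pos hp hm)
  rw [Real.log_div hp.ne' hm.ne'] at this
  linarith

/-- Every vector of the list is far from its predecessors. -/
def Spread (lam : ℝ) (F : List (Fin d → ℝ)) : Prop :=
  ∀ G v, G ++ [v] <+: F → 1 < v ⬝ᵥ ((gram lam G)⁻¹ *ᵥ v)

/-- Each appended vector multiplies the determinant by more than 2. -/
theorem log_det_gram_ge {lam : ℝ} (hl : 0 < lam) (F : List (Fin d → ℝ)) (hF : Spread lam F) :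
    F.length * Real.log 2 + d * Real.log lam ≤ Real.log (gram lam F).det := by
  induction F using List.reverseRecOn with
  | nil => simp [gram_nil, Real.log_pow]
  | append_singleton F v ih =>
    have h1 := ih fun G w hG => hF G w (hG.trans (List.prefix_append _ _))
    have h2 := hF F v (List.prefix_refl _)
    rw [det_gram_append hl, Real.log_mul (gram_posDef hl F).det_pos.ne' (by linarith)]
    have h3 : Real.log 2 ≤ Real.log (1 + v ⬝ᵥ ((gram lam F)⁻¹ *ᵥ v)) :=
      Real.log_le_log (by norm_num) (by linarith)
    rw [List.length_append, List.length_singleton]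
    push_cast
    linarith

/-- A number `x` with `x log 2 ≤ log (1 + x a)` is at most `2 log (1 + 4 a)`. -/
theorem le_of_mul_log_two_le {a x : ℝ} (ha : 0 ≤ a) (hx : 0 ≤ x)
    (h : x * Real.log 2 ≤ Real.log (1 + x * a)) : x ≤ 2 * Real.log (1 + 4 * a) := by
  have hlog2 := Real.log_two_gt_d9
  have hnn : 0 ≤ Real.log (1 + 4 * a) := Real.log_nonneg (by linarith)
  rcases le_total x 4 with h4 | h4
  -- For `x ≤ 4` monotonicity suffices, since `2 log 2 > 1`. For `x ≥ 4` the factor `x/4` is split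
  -- off; the tangent bound on `log (x/8)` costs only `x/8`, and `log 2 - 1/8` still exceeds `1/2`.
  · have h1 : Real.log (1 + x * a) ≤ Real.log (1 + 4 * a) :=
      Real.log_le_log (by positivity) (by nlinarith)
    nlinarith
  · have h1 : Real.log (1 + x * a) ≤ Real.log ((1 + 4 * a) * (x / 4)) :=
      Real.log_le_log (by positivity) (by nlinarith)
    rw [Real.log_mul (by positivity) (by positivity)] at h1
    have h2 := Real.log_le_sub_one_of_pos (show 0 < x / 8 by linarith)
    have h3 : Real.log (x / 4) = Real.log (x / 8) + Real.log 2 := by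
      rw [← Real.log_mul (by positivity) (by norm_num)]
      congr 1
      ring
    nlinarith

/-- Compares the exponential growth of the determinant in the length with the polynomial growth
allowed by the trace. The result is half of `d̃`; the spare factor 2 is used in the union bound. -/
theorem Spread.length_le {lam L : ℝ} (hl : 0 < lam) (hd : 0 < d) {F : List (Fin d → ℝ)}
    (hF : Spread lam F) (hL : ∀ v ∈ F, v ⬝ᵥ v ≤ L ^ 2) :
    (F.length : ℝ) ≤ 2 * d * Real.log (1 + 4 * L ^ 2 / lam) := by
  have hd' : (0 : ℝ) < d := by exact_mod_cast hd
  -- An upper bound on the mean eigenvalue.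
  set m : ℝ := lam + F.length * L ^ 2 / d with hm
  have hmpos : 0 < m := by positivity
  have htr : (gram lam F).trace ≤ d * m := by
    rw [trace_gram, hm, mul_add, mul_div_cancel₀ _ hd'.ne']
    have := List.sum_le_card_nsmul (F.map (fun v => v ⬝ᵥ v)) (L ^ 2) (by simpa using hL)
    simp only [List.length_map, nsmul_eq_mul] at this
    linarith
  have h1 := log_det_le (gram_posDef hl F) hmpos
  have h2 := log_det_gram_ge hl F hF
  have h3 : (gram lam F).trace / m ≤ d := (div_le_iff₀ hmpos).2 htr
  have h4 : Real.log m = Real.log lam + Real.log (1 + F.length / d * (L ^ 2 / lam)) := by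
    rw [← Real.log_mul hl.ne' (by positivity), hm]
    congr 1
    field_simp
  have h5 : (F.length / d : ℝ) * Real.log 2 ≤ Real.log (1 + F.length / d * (L ^ 2 / lam)) := by
    rw [div_mul_eq_mul_div, div_le_iff₀ hd']
    rw [h4] at h1
    linarith
  have h6 := le_of_mul_log_two_le (by positivity) (by positivity) h5
  rw [div_le_iff₀ hd', ← mul_div_assoc] at h6
  linarith

end Gram

/-! ### Covers and the error of regularized least squares -/

section Cover

open Matrix

variable {S A : Type*} {d : ℕ}

theorem actionCovered_iff (lam : ℝ) (C : List (Item S A d)) (x : Row A d) (a : A) :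
    ActionCovered lam C x a ↔
      (x a).ofLp ⬝ᵥ ((gram lam (C.map Item.feat))⁻¹ *ᵥ (x a).ofLp) ≤ 1 := by
  rw [ActionCovered, wnorm, designMatrix_eq_gram, Real.sqrt_le_one]

theorem ActionCovered.mono {lam : ℝ} (hl : 0 < lam) {C C' : List (Item S A d)}
    (h : C.map Item.feat <+: C'.map Item.feat) {x : Row A d} {a : A}
    (hx : ActionCovered lam C x a) : ActionCovered lam C' x a := by
  rw [actionCovered_iff] at *
  exact (inv_dotProduct_antitone (gram_posDef hl _) (gram_posDef hl _)
    (gram_dotProduct_mono lam h) _).trans hx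

theorem Cover_mono {lam : ℝ} (hl : 0 < lam) {C C' : List (Item S A d)}
    (h : C.map Item.feat <+: C'.map Item.feat) : Cover lam C ⊆ Cover lam C' :=
  fun _ hx a => (hx a).mono hl h

/-- Summed form of `2|a| ≤ c a² + 1/c`; taking `c` to be the square root of the length yields
Cauchy-Schwarz against the all-ones vector. -/
theorem sum_abs_le (l : List ℝ) {c : ℝ} (hc : 0 < c) :
    2 * (l.map (fun a => |a|)).sum ≤ c * (l.map (fun a => a * a)).sum + l.length / c := by
  induction l with
  | nil => simp
  | cons a l ih =>
    simp only [List.map_cons, List.sum_cons, List.length_cons]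
    have h : 2 * |a| ≤ c * (a * a) + 1 / c := by
      rw [← abs_mul_abs_self a, ← sub_nonneg]
      have : c * (|a| * |a|) + 1 / c - 2 * |a| = (c * |a| - 1) ^ 2 / c := by
        field_simp
        ring
      rw [this]
      positivity
    push_cast
    rw [add_div]
    linarith

theorem sum_abs_le_sqrt_length (l : List ℝ) (h : (l.map (fun a => a * a)).sum ≤ 1) :
    (l.map (fun a => |a|)).sum ≤ Real.sqrt l.length := by
  rcases l.eq_nil_or_concat with rfl | ⟨_, _, hl⟩
  · simp
  · have hpos : (0 : ℝ) < l.length := by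
      rw [hl]
      simp
      positivity
    have hs : 0 < Real.sqrt l.length := Real.sqrt_pos.2 hpos
    have h2 := sum_abs_le l hs
    rw [Real.div_sqrt] at h2
    have := mul_le_mul_of_nonneg_left h hs.le
    linarith

/-- Error of the regularized least-squares estimate at a covered pair. -/
theorem abs_lse_sub_le {lam : ℝ} (hl : 0 < lam) (C : List (Item S A d)) {x : Row A d} {a : A}
    (hx : ActionCovered lam C x a) (θ : EuclideanSpace ℝ (Fin d)) {e : ℝ} (he : 0 ≤ e)
    (h : ∀ it ∈ C, |it.est.getD 0 - inner ℝ (it.row it.act) θ| ≤ e) :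
    |lse lam C x a - inner ℝ (x a) θ| ≤ e * Real.sqrt C.length + Real.sqrt lam * ‖θ‖ := by
  rw [actionCovered_iff] at hx
  have hM := gram_posDef hl (C.map Item.feat)
  set u := (gram lam (C.map Item.feat))⁻¹ *ᵥ (x a).ofLp with hu
  have hinner : ∀ v : EuclideanSpace ℝ (Fin d), inner ℝ v θ = v.ofLp ⬝ᵥ θ.ofLp := fun v => by
    rw [EuclideanSpace.inner_eq_star_dotProduct, star_trivial, dotProduct_comm]
  have hVu : gram lam (C.map Item.feat) *ᵥ u = (x a).ofLp := PosDef.mulVec_inv_mulVec hM _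
  have hb := inv_dotProduct_eq hM (x a).ofLp
  rw [← hu, dotProduct_gram] at hb
  have hls : lse lam C x a = (C.map (fun it => it.est.getD 0 * (it.feat ⬝ᵥ u))).sum := by
    rw [lse, designMatrix_eq_gram, dotProduct_mulVec_symm hM.inv.isHermitian, ← hu]
    have : ∀ l : List (Item S A d), (l.map (fun it => it.est.getD 0 • it.feat)).sum ⬝ᵥ u =
        (l.map (fun it => it.est.getD 0 * (it.feat ⬝ᵥ u))).sum := fun l => by
      induction l with
      | nil => simp
      | cons it l ih => simp [add_dotProduct, ih]
    exact this C
  have hth : (x a).ofLp ⬝ᵥ θ.ofLp = lam * (u ⬝ᵥ θ.ofLp) +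
      (C.map (fun it => (it.feat ⬝ᵥ θ.ofLp) * (it.feat ⬝ᵥ u))).sum := by
    rw [← hVu, dotProduct_comm, dotProduct_gram, List.map_map, dotProduct_comm u]
    rfl
  -- With `u = V⁻¹ φ(s,a)` the error separates into residuals weighted by `⟨φ_i, u⟩` and a
  -- regularization bias.
  have hdiff : lse lam C x a - inner ℝ (x a) θ =
      (C.map (fun it => (it.est.getD 0 - it.feat ⬝ᵥ θ.ofLp) * (it.feat ⬝ᵥ u))).sum -
        lam * (u ⬝ᵥ θ.ofLp) := by
    rw [hinner, hls, hth]
    have : ∀ l : List (Item S A d),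
        (l.map (fun it => (it.est.getD 0 - it.feat ⬝ᵥ θ.ofLp) * (it.feat ⬝ᵥ u))).sum =
        (l.map (fun it => it.est.getD 0 * (it.feat ⬝ᵥ u))).sum -
        (l.map (fun it => (it.feat ⬝ᵥ θ.ofLp) * (it.feat ⬝ᵥ u))).sum := fun l => by
      induction l with
      | nil => simp
      | cons it l ih =>
        simp only [List.map_cons, List.sum_cons, ih]
        ring
    rw [this]
    ring
  have hsum : |(C.map (fun it => (it.est.getD 0 - it.feat ⬝ᵥ θ.ofLp) * (it.feat ⬝ᵥ u))).sum| ≤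
      e * (C.map (fun it => |it.feat ⬝ᵥ u|)).sum := by
    have : ∀ l : List (Item S A d), (∀ it ∈ l, |it.est.getD 0 - it.feat ⬝ᵥ θ.ofLp| ≤ e) →
        |(l.map (fun it => (it.est.getD 0 - it.feat ⬝ᵥ θ.ofLp) * (it.feat ⬝ᵥ u))).sum| ≤
        e * (l.map (fun it => |it.feat ⬝ᵥ u|)).sum := fun l hl => by
      induction l with
      | nil => simp
      | cons it l ih =>
        simp only [List.map_cons, List.sum_cons, mul_add]
        refine (abs_add_le _ _).trans (add_le_add ?_ (ih fun jt hj => hl jt (by simp [hj])))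
        rw [abs_mul]
        exact mul_le_mul_of_nonneg_right (hl it (by simp)) (abs_nonneg _)
    refine this C fun it hit => ?_
    have := h it hit
    rwa [hinner] at this
  have huu : 0 ≤ u ⬝ᵥ u := by simpa using dotProduct_star_self_nonneg u
  have hsq0 : 0 ≤ ((C.map (fun it => it.feat ⬝ᵥ u)).map (fun a => a * a)).sum :=
    List.sum_nonneg (by
      simp only [List.mem_map]
      rintro _ ⟨v, -, rfl⟩
      exact mul_self_nonneg _)
  -- Coverage says exactly that `uᵀ V u ≤ 1`. This one inequality controls both the weights `⟨φ_i,
  -- u⟩` and the bias.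
  have hsqe : lam * (u ⬝ᵥ u) + ((C.map (fun it => it.feat ⬝ᵥ u)).map (fun a => a * a)).sum ≤ 1 := by
    rw [List.map_map]
    rw [List.map_map] at hb
    exact hb.le.trans hx
  have hsq : (C.map (fun it => |it.feat ⬝ᵥ u|)).sum ≤ Real.sqrt C.length := by
    have := sum_abs_le_sqrt_length (C.map (fun it => it.feat ⬝ᵥ u))
      (by nlinarith [mul_nonneg hl.le huu])
    simpa [List.map_map, Function.comp_def] using this
  have hreg : |lam * (u ⬝ᵥ θ.ofLp)| ≤ Real.sqrt lam * ‖θ‖ := by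
    have h1 : u ⬝ᵥ θ.ofLp = inner ℝ (WithLp.toLp 2 u) θ := by rw [hinner]
    have h2 : ‖WithLp.toLp 2 u‖ ^ 2 = u ⬝ᵥ u := by
      rw [← real_inner_self_eq_norm_sq, EuclideanSpace.inner_eq_star_dotProduct, star_trivial]
    have h3 : Real.sqrt lam * ‖WithLp.toLp 2 u‖ ≤ 1 := by
      refine abs_le_of_sq_le_sq' ?_ zero_le_one |>.2
      rw [mul_pow, h2, Real.sq_sqrt hl.le]
      linarith
    rw [abs_mul, abs_of_pos hl, h1]
    calc lam * |inner ℝ (WithLp.toLp 2 u) θ| ≤ lam * (‖WithLp.toLp 2 u‖ * ‖θ‖) :=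
          mul_le_mul_of_nonneg_left (abs_real_inner_le_norm _ _) hl.le
      _ = (Real.sqrt lam * ‖WithLp.toLp 2 u‖) * (Real.sqrt lam * ‖θ‖) := by
          nth_rewrite 1 [← Real.mul_self_sqrt hl.le]
          ring
      _ ≤ 1 * (Real.sqrt lam * ‖θ‖) := mul_le_mul_of_nonneg_right h3 (by positivity)
      _ = _ := one_mul _
  rw [hdiff]
  refine (abs_sub _ _).trans (add_le_add (hsum.trans ?_) hreg)
  exact mul_le_mul_of_nonneg_left hsq he

end Cover

end Capi

/-! ### Query accounting and success probabilities of composed programs -/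

namespace Prog

variable {S A F R T : Type*}

/-- `Safe φ p K n post`: when the states in `K` are known at the start, the program `p` queries only
known states, at most `n` times, and it ends with a set of known states and a result
that satisfy `post`. -/
def Safe (φ : S → F) : Prog S A F R → Set S → ℕ → (Set S → R → Prop) → Prop
  | ret r, K, _, post => post K r
  | query s _ k, K, n, post => s ∈ K ∧ ∃ m, n = m + 1 ∧
      ∀ y : S × I, Safe φ (k y.1 (φ y.1) (y.2 : ℝ)) (insert y.1 K) m post

theorem Safe.mono {φ : S → F} {p : Prog S A F R} {K : Set S} {n m : ℕ}
    {post post' : Set S → R → Prop} (h : p.Safe φ K n post) (hnm : n ≤ m)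
    (hpost : ∀ K' r, K ⊆ K' → post K' r → post' K' r) : p.Safe φ K m post' := by
  induction p generalizing K n m with
  | ret r => exact hpost K r subset_rfl h
  | query s a k ih =>
    obtain ⟨hs, n', rfl, h⟩ := h
    obtain ⟨m', rfl⟩ : ∃ m', m = m' + 1 := ⟨m - 1, by omega⟩
    exact ⟨hs, m', rfl, fun y => ih _ _ _ (h y) (by omega)
      fun K' r hK => hpost K' r ((Set.subset_insert _ _).trans hK)⟩

theorem Safe.bind {φ : S → F} {p : Prog S A F R} {f : R → Prog S A F T} {K : Set S} {n m : ℕ}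
    {post : Set S → R → Prop} {post' : Set S → T → Prop} (h : p.Safe φ K n post)
    (hf : ∀ K' r, K ⊆ K' → post K' r → (f r).Safe φ K' m post') :
    (p.bind f).Safe φ K (n + m) post' := by
  induction p generalizing K n with
  | ret r => exact (hf K r subset_rfl h).mono (by omega) fun _ _ _ h => h
  | query s a k ih =>
    obtain ⟨hs, n', rfl, h⟩ := h
    exact ⟨hs, n' + m, by omega, fun y => ih _ _ _ (h y)
      fun K' r hK => hf K' r ((Set.subset_insert _ _).trans hK)⟩

theorem Safe.run {φ : S → F} {p : Prog S A F R} {K : Set S} {n : ℕ}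
    {post : Set S → R → Prop} (h : p.Safe φ K n post) (y : ℕ → S × I) :
    (p.run φ y).1.length ≤ n ∧ (∃ K', post K' (p.run φ y).2) ∧
      ∀ (i : ℕ) (q : S × A), (p.run φ y).1[i]? = some q → q.1 ∈ K ∨ ∃ j < i, q.1 = (y j).1 := by
  induction p generalizing K n y with
  | ret r => exact ⟨by simp [Prog.run], ⟨K, h⟩, by simp [Prog.run]⟩
  | query s a k ih =>
    obtain ⟨hs, n', rfl, h⟩ := h
    obtain ⟨h1, h2, h3⟩ := ih _ _ _ (h (y 0)) (fun n => y (n + 1))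
    refine ⟨by simpa [Prog.run] using h1, by simpa [Prog.run] using h2, ?_⟩
    rintro (_ | i) q hq
    · simp only [Prog.run, List.getElem?_cons_zero, Option.some.injEq] at hq
      exact Or.inl (hq ▸ hs)
    · simp only [Prog.run, List.getElem?_cons_succ] at hq
      rcases h3 i q hq with h4 | ⟨j, hj, h4⟩
      · rcases h4 with h4 | h4
        · exact Or.inr ⟨0, by omega, h4⟩
        · exact Or.inl h4
      · exact Or.inr ⟨j + 1, by omega, h4⟩

/-- The direction of the inequality matters: pulling a constant out of a lower integral and
monotonicity are valid in this direction for arbitrary integrands. -/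
theorem prob_bind_ge [MeasurableSpace S] [MeasurableSpace A] (Q : Kernel (S × A) (S × I))
    (φ : S → F) (p : Prog S A F R) (f : R → Prog S A F T) (G : Set R) (E : Set T) {c : ℝ≥0∞}
    (h : ∀ r ∈ G, c ≤ (f r).prob Q φ E) : c * p.prob Q φ G ≤ (p.bind f).prob Q φ E := by
  induction p with
  | ret r =>
    by_cases hr : r ∈ G
    · simpa [prob, bind, hr] using h r hr
    · simp [prob, hr]
  | query s a k ih =>
    refine (lintegral_const_mul_le _ _).trans ?_
    exact lintegral_mono fun y => ih _ _ _

end Prog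

/-! ### Integral and exponential inequalities for Hoeffding's bound -/

theorem ofReal_integral_le_lintegral {α : Type*} [MeasurableSpace α] {μ : Measure α} {f : α → ℝ}
    (hf : Integrable f μ) : ENNReal.ofReal (∫ x, f x ∂μ) ≤ ∫⁻ x, ENNReal.ofReal (f x) ∂μ := by
  rw [integral_eq_lintegral_pos_part_sub_lintegral_neg_part hf]
  refine (ENNReal.ofReal_le_ofReal (sub_le_self _ ENNReal.toReal_nonneg)).trans ?_
  exact ENNReal.ofReal_toReal_le

/-- Hoeffding's inequality for a two-point distribution. -/
theorem two_point_hoeffding {p : ℝ} (h0 : 0 ≤ p) (h1 : p ≤ 1) (u : ℝ) :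
    1 - p + p * Real.exp u ≤ Real.exp (p * u + u ^ 2 / 8) := by
  -- The Bernoulli law with parameter `p`, to which the sub-Gaussian bound for variables in `[0,1]`
  -- applies.
  let μ : Measure ℝ := ENNReal.ofReal (1 - p) • Measure.dirac 0 + ENNReal.ofReal p • Measure.dirac 1
  have hμ : IsProbabilityMeasure μ := ⟨by
    simp only [μ, Measure.coe_add, Measure.coe_smul, Pi.add_apply, Pi.smul_apply, measure_univ,
      smul_eq_mul, mul_one]
    rw [← ENNReal.ofReal_add (by linarith) h0]
    simp⟩
  have hint : ∀ f : ℝ → ℝ, ∫ x, f x ∂μ = (1 - p) * f 0 + p * f 1 := fun f => by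
    rw [integral_add_measure ((integrable_dirac (by simp)).smul_measure ENNReal.ofReal_ne_top)
      ((integrable_dirac (by simp)).smul_measure ENNReal.ofReal_ne_top),
      integral_smul_measure, integral_smul_measure, integral_dirac, integral_dirac,
      ENNReal.toReal_ofReal (by linarith), ENNReal.toReal_ofReal h0, smul_eq_mul, smul_eq_mul]
  have hmem : ∀ᵐ x ∂μ, (fun x : ℝ => x) x ∈ Set.Icc (0 : ℝ) 1 := by
    have hs : MeasurableSet {x : ℝ | x ∈ Set.Icc (0 : ℝ) 1} := measurableSet_Icc
    rw [ae_add_measure_iff]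
    exact ⟨Measure.ae_smul_measure ((ae_dirac_iff hs).2 (by simp)) _,
      Measure.ae_smul_measure ((ae_dirac_iff hs).2 (by simp)) _⟩
  have h := (hasSubgaussianMGF_of_mem_Icc (μ := μ) measurable_id'.aemeasurable hmem).mgf_le u
  rw [mgf, hint, hint] at h
  simp only [mul_zero, mul_one, zero_add, zero_sub, sub_zero, nnnorm_one] at h
  have e : (((1 / 2 : NNReal) ^ 2 : NNReal) : ℝ) * u ^ 2 / 2 = u ^ 2 / 8 := by
    push_cast
    ring
  rw [e] at h
  have h2 := mul_le_mul_of_nonneg_left h (Real.exp_pos (p * u)).le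
  rw [← Real.exp_add] at h2
  refine le_trans (le_of_eq ?_) h2
  have e1 : Real.exp (p * u) * Real.exp (u * -p) = 1 := by
    rw [← Real.exp_add]; simp [mul_comm]
  have e2 : Real.exp (p * u) * Real.exp (u * (1 - p)) = Real.exp u := by
    rw [← Real.exp_add]; congr 1; ring
  linear_combination (p - 1) * e1 - p * e2

/-- The exponential lies below its chord over `[0, R]`. -/
theorem exp_le_chord {R g : ℝ} (hR : 0 < R) (h0 : 0 ≤ g) (h1 : g ≤ R) (l : ℝ) :
    Real.exp (l * g) ≤ 1 - g / R + g / R * Real.exp (l * R) := by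
  have hp : 0 ≤ g / R := by positivity
  have hp1 : g / R ≤ 1 := (div_le_one hR).2 h1
  have := convexOn_exp.2 (Set.mem_univ 0) (Set.mem_univ (l * R)) (sub_nonneg.2 hp1) hp (by ring)
  simp only [smul_eq_mul, mul_zero, zero_add, Real.exp_zero, mul_one] at this
  refine le_trans (le_of_eq ?_) this
  congr 1
  field_simp

namespace Capi

/-! ### Safety of measurements and values stopped outside the cover -/

section Measure

variable {S A : Type*} {d : ℕ}

theorem safe_rollout {φ : S → Row A d} (γ : ℝ) (π : Row A d → A) (cov : Set (Row A d)) (m h : ℕ)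
    (s : S) (acc : ℝ) {K : Set S} (hs : s ∈ K) :
    (rollout γ π cov m h s (φ s) acc).Safe φ K m (fun K' o => match o with
      | .discover s' x' => s' ∈ K' ∧ x' = φ s' ∧ x' ∉ cov
      | .success _ => True) := by
  induction m generalizing h s acc K with
  | zero => simp [rollout, Prog.Safe]
  | succ m ih =>
    rw [rollout]
    by_cases hx : φ s ∈ cov
    · rw [if_neg (not_not.2 hx)]
      exact ⟨hs, m, rfl, fun y => ih _ _ _ (Set.mem_insert _ _)⟩
    · rw [if_pos hx]
      exact ⟨hs, rfl, hx⟩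

theorem safe_episode {φ : S → Row A d} (P : Params) (hH : P.H ≠ 0) (π : Row A d → A)
    (cov : Set (Row A d)) (s : S) (a : A) {K : Set S} (hs : s ∈ K) :
    (episode P s a π cov).Safe φ K P.H (fun K' o => match o with
      | .discover s' x' => s' ∈ K' ∧ x' = φ s' ∧ x' ∉ cov
      | .success _ => True) :=
  ⟨hs, P.H - 1, by omega, fun _ => safe_rollout _ _ _ _ _ _ _ (Set.mem_insert _ _)⟩

theorem safe_measureLoop {φ : S → Row A d} (P : Params) (hH : P.H ≠ 0) (π : Row A d → A)
    (cov : Set (Row A d)) (s : S) (a : A) (n m : ℕ) (tot : ℝ) {K : Set S} (hs : s ∈ K) :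
    (measureLoop P s a π cov n m tot).Safe φ K (m * P.H) (fun K' o => match o with
      | .discover s' x' => s' ∈ K' ∧ x' = φ s' ∧ x' ∉ cov
      | .success _ => True) := by
  induction m generalizing tot K with
  | zero => simp [measureLoop, Prog.Safe]
  | succ m ih =>
    rw [measureLoop, Nat.succ_mul, add_comm]
    refine (safe_episode P hH π cov s a hs).bind fun K' o hK ho => ?_
    cases o with
    | discover s' x' => exact ho
    | success g => exact ih _ (hK hs)

theorem safe_measure {φ : S → Row A d} (P : Params) (hH : P.H ≠ 0) (π : Row A d → A)
    (cov : Set (Row A d)) (s : S) (a : A) (ζ : ℝ) {K : Set S} (hs : s ∈ K) :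
    (measure P s a π cov ζ).Safe φ K (P.rollouts ζ * P.H) (fun K' o => match o with
      | .discover s' x' => s' ∈ K' ∧ x' = φ s' ∧ x' ∉ cov
      | .success _ => True) :=
  safe_measureLoop P hH π cov s a _ _ _ hs

variable [MeasurableSpace S] [MeasurableSpace A]

open Classical in
/-- Value of `m` steps of the policy `π`, when the process is stopped outside `cov` with the terminal
reward `b`. -/
noncomputable def stoppedValue (Q : Kernel (S × A) (S × I)) (γ : ℝ) (φ : S → Row A d)
    (π : Row A d → A) (cov : Set (Row A d)) (b : ℝ) : ℕ → S → ℝ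
  | 0 => fun _ => 0
  | m + 1 => fun s => if φ s ∈ cov then
      MDP.backup Q γ (stoppedValue Q γ φ π cov b m) s (π (φ s)) else b

theorem isVal_stoppedValue (Q : Kernel (S × A) (S × I)) [IsMarkovKernel Q] {γ : ℝ} (h0 : 0 ≤ γ)
    (h1 : γ < 1) (φ : S → Row A d) {π : Row A d → A} (hπ : Measurable (fun s => π (φ s)))
    {cov : Set (Row A d)} (hcov : MeasurableSet {s | φ s ∈ cov})
    {b : ℝ} (hb0 : 0 ≤ b) (hb1 : b ≤ (1 - γ)⁻¹) (m : ℕ) :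
    MDP.IsVal γ (stoppedValue Q γ φ π cov b m) := by
  induction m with
  | zero => exact ⟨measurable_const, fun s => ⟨le_rfl, hb0.trans hb1⟩⟩
  | succ m ih =>
    have h := MDP.isVal_backup Q h0 h1 ih hπ
    refine ⟨Measurable.ite hcov h.1 measurable_const, fun s => ?_⟩
    simp only [stoppedValue]
    split_ifs
    · exact h.2 s
    · exact ⟨hb0, hb1⟩

/-- Truncating at 0 only increases the integral, so an affine lower bound may be integrated before
truncation. This lets affine bounds pass backwards through a query. -/
theorem lintegral_ofReal_affine_ge {γ : ℝ} (h0 : 0 ≤ γ) (h1 : γ < 1)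
    (μ : Measure (S × I)) [IsProbabilityMeasure μ] {w w' : S → ℝ}
    (hw : MDP.IsVal γ w) (hw' : MDP.IsVal γ w') (c e e' : ℝ) :
    ENNReal.ofReal (c + e * (∫ y, ((y.2 : ℝ) + γ * w y.1) ∂μ) +
        e' * (∫ y, ((y.2 : ℝ) + γ * w' y.1) ∂μ)) ≤
      ∫⁻ y, ENNReal.ofReal (c + e * ((y.2 : ℝ) + γ * w y.1) + e' * ((y.2 : ℝ) + γ * w' y.1)) ∂μ := by
  have i1 := (hw.integrable h0 h1 μ).const_mul e
  have i2 := (hw'.integrable h0 h1 μ).const_mul e'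
  have i0 : Integrable (fun _ : S × I => c) μ := integrable_const c
  have := ofReal_integral_le_lintegral ((i0.add i1).add i2)
  simp only [Pi.add_apply] at this
  refine le_trans (le_of_eq ?_) this
  have e1 := integral_add (i0.add i1) i2
  have e2 := integral_add i0 i1
  simp only [Pi.add_apply] at e1
  rw [e1, e2, integral_const_mul, integral_const_mul]
  simp

/-- The two affine functions of the return `g` bound the failure probabilities of the upper and the
lower tail after a success. Affine bounds depend on the return only through its mean, so backward
induction replaces `g` by a stopped value. A discovery counts as no failure, so its terminal reward
may be any value in the range where the affine functions are nonnegative: 0 serves the upper tail,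
the maximal value the lower tail. The bound on `acc` keeps the total return in that range. -/
theorem prob_rollout_bind_ge (Q : Kernel (S × A) (S × I)) [IsMarkovKernel Q] {γ : ℝ} (h0 : 0 ≤ γ)
    (h1 : γ < 1) (φ : S → Row A d) {π : Row A d → A} (hπ : Measurable (fun s => π (φ s)))
    {cov : Set (Row A d)} (hcov : MeasurableSet {s | φ s ∈ cov})
    {T : Type*} (rest : Outcome S A d → Prog S A (Row A d) T) (E : Set T) {α β α' β' : ℝ}
    (hsucc : ∀ g, 0 ≤ g → g ≤ (1 - γ)⁻¹ →
      ENNReal.ofReal (1 - ((α + β * g) + (α' + β' * g))) ≤ (rest (.success g)).prob Q φ E)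
    (hdisc : ∀ s, φ s ∉ cov → 1 ≤ (rest (.discover s (φ s))).prob Q φ E)
    (hpos : ∀ g, 0 ≤ g → g ≤ (1 - γ)⁻¹ → 0 ≤ α + β * g)
    (hpos' : ∀ g, 0 ≤ g → g ≤ (1 - γ)⁻¹ → 0 ≤ α' + β' * g)
    (m h : ℕ) (s : S) (acc : ℝ) (ha0 : 0 ≤ acc)
    (ha1 : acc ≤ (1 - γ ^ h) * (1 - γ)⁻¹) :
    ENNReal.ofReal (1 - ((α + β * (acc + γ ^ h * stoppedValue Q γ φ π cov 0 m s)) +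
        (α' + β' * (acc + γ ^ h * stoppedValue Q γ φ π cov (1 - γ)⁻¹ m s)))) ≤
      ((rollout γ π cov m h s (φ s) acc).bind rest).prob Q φ E := by
  have hR : 0 ≤ (1 - γ)⁻¹ := inv_nonneg.2 (by linarith)
  have hval0 := isVal_stoppedValue Q h0 h1 φ hπ hcov le_rfl hR
  have hvalR := isVal_stoppedValue Q h0 h1 φ hπ hcov hR le_rfl
  have hrange : ∀ w, 0 ≤ w → w ≤ (1 - γ)⁻¹ → 0 ≤ acc + γ ^ h * w ∧ acc + γ ^ h * w ≤ (1 - γ)⁻¹ := by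
    intro w hw0 hw1
    have hp := pow_nonneg h0 h
    constructor
    · positivity
    · have := mul_le_mul_of_nonneg_left hw1 hp
      linarith
  induction m generalizing h s acc with
  | zero =>
    simp only [stoppedValue, mul_zero, add_zero, rollout, Prog.bind]
    have := hrange 0 le_rfl hR
    simp only [mul_zero, add_zero] at this
    exact hsucc acc this.1 this.2
  | succ m ih =>
    by_cases hx : φ s ∈ cov
    · have e : ∀ b, stoppedValue Q γ φ π cov b (m + 1) s =
          MDP.backup Q γ (stoppedValue Q γ φ π cov b m) s (π (φ s)) := fun b => by
        simp [stoppedValue, hx]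
      rw [rollout, if_neg (not_not.2 hx), e, e]
      refine le_trans (le_of_eq ?_) ((lintegral_ofReal_affine_ge h0 h1
        (Q (s, π (φ s))) (hval0 m) (hvalR m)
        (1 - (α + β * acc + (α' + β' * acc))) (-(β * γ ^ h)) (-(β' * γ ^ h))).trans
        (lintegral_mono fun y => ?_))
      · congr 1
        simp only [MDP.backup]
        ring
      · have hacc : 0 ≤ acc + γ ^ h * (y.2 : ℝ) :=
          add_nonneg ha0 (mul_nonneg (pow_nonneg h0 h) y.2.2.1)
        have hacc1 : acc + γ ^ h * (y.2 : ℝ) ≤ (1 - γ ^ (h + 1)) * (1 - γ)⁻¹ := by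
          have h3 := mul_le_mul_of_nonneg_left y.2.2.2 (pow_nonneg h0 h)
          have h4 : (1 - γ ^ (h + 1)) * (1 - γ)⁻¹ = (1 - γ ^ h) * (1 - γ)⁻¹ + γ ^ h := by
            have : (1 - γ) ≠ 0 := by linarith
            field_simp
            ring
          rw [h4]
          linarith
        refine le_trans (le_of_eq ?_) (ih (h + 1) y.1 _ hacc hacc1 fun w hw0 hw1 => ?_)
        · congr 1
          ring
        · refine ⟨add_nonneg hacc (mul_nonneg (pow_nonneg h0 _) hw0), ?_⟩
          have := mul_le_mul_of_nonneg_left hw1 (pow_nonneg h0 (h + 1))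
          linarith
    · have h3 := hrange _ ((hval0 (m + 1)).2 s).1 ((hval0 (m + 1)).2 s).2
      have h4 := hrange _ ((hvalR (m + 1)).2 s).1 ((hvalR (m + 1)).2 s).2
      rw [rollout, if_pos hx]
      refine le_trans ?_ (hdisc s hx)
      rw [← ENNReal.ofReal_one]
      exact ENNReal.ofReal_le_ofReal (by linarith [hpos _ h3.1 h3.2, hpos' _ h4.1 h4.2])

end Measure

end Capi

namespace Capi

/-! ### Concentration of measurements -/

section MeasureProb

variable {S A : Type*} {d : ℕ}

/-- A result of `measure` that is a valid discovery or an estimate in `[lo, hi]`. -/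
def GoodOutcome (φ : S → Row A d) (cov : Set (Row A d)) (lo hi : ℝ) : Set (Outcome S A d) :=
  {o | match o with
    | .discover s x => x = φ s ∧ x ∉ cov
    | .success q => lo ≤ q ∧ q ≤ hi}

variable [MeasurableSpace S] [MeasurableSpace A]

theorem prob_episode_bind_ge (Q : Kernel (S × A) (S × I)) [IsMarkovKernel Q] (P : Params)
    (h0 : 0 ≤ P.γ) (h1 : P.γ < 1) (φ : S → Row A d) {π : Row A d → A}
    (hπ : Measurable (fun s => π (φ s))) {cov : Set (Row A d)}
    (hcov : MeasurableSet {s | φ s ∈ cov}) {T : Type*}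
    (rest : Outcome S A d → Prog S A (Row A d) T) (E : Set T) {α β α' β' : ℝ}
    (hsucc : ∀ g, 0 ≤ g → g ≤ (1 - P.γ)⁻¹ →
      ENNReal.ofReal (1 - ((α + β * g) + (α' + β' * g))) ≤ (rest (.success g)).prob Q φ E)
    (hdisc : ∀ s, φ s ∉ cov → 1 ≤ (rest (.discover s (φ s))).prob Q φ E)
    (hpos : ∀ g, 0 ≤ g → g ≤ (1 - P.γ)⁻¹ → 0 ≤ α + β * g)
    (hpos' : ∀ g, 0 ≤ g → g ≤ (1 - P.γ)⁻¹ → 0 ≤ α' + β' * g) (s : S) (a : A) :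
    ENNReal.ofReal (1 -
        ((α + β * MDP.backup Q P.γ (stoppedValue Q P.γ φ π cov 0 (P.H - 1)) s a) +
        (α' + β' * MDP.backup Q P.γ
          (stoppedValue Q P.γ φ π cov (1 - P.γ)⁻¹ (P.H - 1)) s a))) ≤
      ((episode P s a π cov).bind rest).prob Q φ E := by
  have hR : 0 ≤ (1 - P.γ)⁻¹ := inv_nonneg.2 (by linarith)
  have hval0 := isVal_stoppedValue Q h0 h1 φ hπ hcov le_rfl hR
  have hvalR := isVal_stoppedValue Q h0 h1 φ hπ hcov hR le_rfl
  refine le_trans (le_of_eq ?_) ((lintegral_ofReal_affine_ge h0 h1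
    (Q (s, a)) (hval0 (P.H - 1)) (hvalR (P.H - 1)) (1 - (α + α')) (-β) (-β')).trans
    (lintegral_mono fun y => ?_))
  · congr 1
    simp only [MDP.backup]
    ring
  · refine le_trans (le_of_eq ?_) (prob_rollout_bind_ge Q h0 h1 φ hπ hcov rest E hsucc hdisc hpos
      hpos' (P.H - 1) 1 y.1 y.2 y.2.2.1 ?_)
    · congr 1
      ring
    · rw [pow_one, mul_inv_cancel₀ (by linarith)]
      exact y.2.2.2

/-- The two exponentials are the Chernoff potentials of the tails with `m` episodes left. An
exponential is not affine in the return of an episode, but its chord over `[0, 1/(1-γ)]` is; the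
two-point Hoeffding bound turns the averaged chord back into an exponential. After the last episode
an estimate outside the interval makes one of them at least 1. -/
theorem prob_measureLoop_ge (Q : Kernel (S × A) (S × I)) [IsMarkovKernel Q] (P : Params)
    (h0 : 0 ≤ P.γ) (h1 : P.γ < 1) (φ : S → Row A d) {π : Row A d → A}
    (hπ : Measurable (fun s => π (φ s))) {cov : Set (Row A d)}
    (hcov : MeasurableSet {s | φ s ∈ cov}) (s : S) (a : A) {n : ℕ} (hn : 0 < n) {l : ℝ}
    (hl : 0 ≤ l) (t : ℝ) {μ μ' : ℝ}
    (hμ : μ = MDP.backup Q P.γ (stoppedValue Q P.γ φ π cov 0 (P.H - 1)) s a)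
    (hμ' : μ' = MDP.backup Q P.γ (stoppedValue Q P.γ φ π cov (1 - P.γ)⁻¹ (P.H - 1)) s a)
    (m : ℕ) (tot : ℝ) :
    ENNReal.ofReal (1 -
        (Real.exp (l * (tot - n * (μ + t)) + m * (l * μ + l ^ 2 * (1 - P.γ)⁻¹ ^ 2 / 8)) +
        Real.exp (-l * (tot - n * (μ' - t)) + m * (-l * μ' + l ^ 2 * (1 - P.γ)⁻¹ ^ 2 / 8)))) ≤
      (measureLoop P s a π cov n m tot).prob Q φ (GoodOutcome φ cov (μ' - t) (μ + t)) := by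
  set R : ℝ := (1 - P.γ)⁻¹ with hRdef
  have hR : 0 < R := inv_pos.2 (by linarith)
  have hn' : (0 : ℝ) < n := by exact_mod_cast hn
  have hval0 := isVal_stoppedValue Q h0 h1 φ hπ hcov le_rfl hR.le
  have hvalR := isVal_stoppedValue Q h0 h1 φ hπ hcov hR.le le_rfl
  induction m generalizing tot with
  | zero =>
    rw [measureLoop, Prog.prob]
    split_ifs with hg
    · rw [← ENNReal.ofReal_one]
      refine ENNReal.ofReal_le_ofReal ?_
      linarith [Real.exp_pos (l * (tot - n * (μ + t)) + (0 : ℕ) * (l * μ + l ^ 2 * R ^ 2 / 8)),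
        Real.exp_pos (-l * (tot - n * (μ' - t)) + (0 : ℕ) * (-l * μ' + l ^ 2 * R ^ 2 / 8))]
    · rw [nonpos_iff_eq_zero, ENNReal.ofReal_eq_zero]
      have hg' : ¬ (μ' - t ≤ tot / n ∧ tot / n ≤ μ + t) := hg
      have hp1 := Real.exp_pos (l * (tot - n * (μ + t)) + (0 : ℕ) * (l * μ + l ^ 2 * R ^ 2 / 8))
      have hp2 := Real.exp_pos
        (-l * (tot - n * (μ' - t)) + (0 : ℕ) * (-l * μ' + l ^ 2 * R ^ 2 / 8))
      by_cases hc : μ' - t ≤ tot / n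
      · have hc2 : μ + t < tot / n := not_le.1 fun h => hg' ⟨hc, h⟩
        rw [lt_div_iff₀ hn'] at hc2
        have := Real.one_le_exp (x := l * (tot - n * (μ + t)) +
          (0 : ℕ) * (l * μ + l ^ 2 * R ^ 2 / 8)) (by
            have := mul_nonneg hl (show 0 ≤ tot - n * (μ + t) by linarith)
            simpa using this)
        linarith
      · have hc2 := not_le.1 hc
        rw [div_lt_iff₀ hn'] at hc2
        have := Real.one_le_exp (x := -l * (tot - n * (μ' - t)) +
          (0 : ℕ) * (-l * μ' + l ^ 2 * R ^ 2 / 8)) (by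
            have := mul_nonneg hl (show 0 ≤ -(tot - n * (μ' - t)) by linarith)
            simp only [CharP.cast_eq_zero, zero_mul, add_zero]
            linarith)
        linarith
  | succ m ih =>
    rw [measureLoop]
    set Z := Real.exp (l * (tot - n * (μ + t)) + m * (l * μ + l ^ 2 * R ^ 2 / 8)) with hZ
    set Z' := Real.exp (-l * (tot - n * (μ' - t)) + m * (-l * μ' + l ^ 2 * R ^ 2 / 8)) with hZ'
    have hZ0 : 0 < Z := Real.exp_pos _
    have hZ0' : 0 < Z' := Real.exp_pos _
    have chord : ∀ (z u g : ℝ), z + z * (Real.exp u - 1) / R * g =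
        z * (1 - g / R + g / R * Real.exp u) := fun z u g => by
      field_simp
      ring
    have hnn : ∀ (u g : ℝ), 0 ≤ g → g ≤ R → 0 ≤ 1 - g / R + g / R * Real.exp u := by
      intro u g hg0 hg1
      have h2 : g / R ≤ 1 := (div_le_one hR).2 hg1
      have h3 : 0 ≤ g / R * Real.exp u := by positivity
      linarith
    refine le_trans ?_ (prob_episode_bind_ge Q P h0 h1 φ hπ hcov _ _
      (α := Z) (β := Z * (Real.exp (l * R) - 1) / R)
      (α' := Z') (β' := Z' * (Real.exp (-l * R) - 1) / R) ?_ ?_ ?_ ?_ s a)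
    · rw [← hμ, ← hμ', chord, chord]
      refine ENNReal.ofReal_le_ofReal (sub_le_sub_left (add_le_add ?_ ?_) _)
      · have hm0 : 0 ≤ μ := hμ ▸ MDP.backup_nonneg Q h0 (fun s => ((hval0 _).2 s).1) s a
        have hm1 : μ ≤ R := hμ ▸ MDP.backup_le Q h0 h1 (hval0 _) s a
        have := two_point_hoeffding (p := μ / R) (by positivity) ((div_le_one hR).2 hm1) (l * R)
        refine (mul_le_mul_of_nonneg_left this hZ0.le).trans (le_of_eq ?_)
        rw [hZ, ← Real.exp_add]
        congr 1
        push_cast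
        field_simp
        ring
      · have hm0 : 0 ≤ μ' := hμ' ▸ MDP.backup_nonneg Q h0 (fun s => ((hvalR _).2 s).1) s a
        have hm1 : μ' ≤ R := hμ' ▸ MDP.backup_le Q h0 h1 (hvalR _) s a
        have := two_point_hoeffding (p := μ' / R) (by positivity) ((div_le_one hR).2 hm1) (-l * R)
        refine (mul_le_mul_of_nonneg_left this hZ0'.le).trans (le_of_eq ?_)
        rw [hZ', ← Real.exp_add]
        congr 1
        push_cast
        field_simp
        ring
    · intro g hg0 hg1
      rw [chord, chord]
      refine le_trans (ENNReal.ofReal_le_ofReal (sub_le_sub_left (add_le_add ?_ ?_) _))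
        (ih (tot + g))
      · refine le_trans (le_of_eq ?_)
          (mul_le_mul_of_nonneg_left (exp_le_chord hR hg0 hg1 l) hZ0.le)
        rw [hZ, ← Real.exp_add]
        congr 1
        ring
      · refine le_trans (le_of_eq ?_)
          (mul_le_mul_of_nonneg_left (exp_le_chord hR hg0 hg1 (-l)) hZ0'.le)
        rw [hZ', ← Real.exp_add]
        congr 1
        ring
    · intro s' hs'
      have : Outcome.discover s' (φ s') ∈ GoodOutcome (A := A) φ cov (μ' - t) (μ + t) :=
        ⟨rfl, hs'⟩
      simp [Prog.prob, this]
    · intro g hg0 hg1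
      rw [chord]
      exact mul_nonneg hZ0.le (hnn _ _ hg0 hg1)
    · intro g hg0 hg1
      rw [chord]
      exact mul_nonneg hZ0'.le (hnn _ _ hg0 hg1)

theorem prob_measure_ge (Q : Kernel (S × A) (S × I)) [IsMarkovKernel Q] (P : Params)
    (h0 : 0 ≤ P.γ) (h1 : P.γ < 1) (hω : 0 < P.ω) (φ : S → Row A d) {π : Row A d → A}
    (hπ : Measurable (fun s => π (φ s))) {cov : Set (Row A d)}
    (hcov : MeasurableSet {s | φ s ∈ cov}) (s : S) (a : A) {ζ : ℝ} (hζ0 : 0 < ζ) (hζ : ζ < 2) :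
    ENNReal.ofReal (1 - ζ) ≤ (measure P s a π cov ζ).prob Q φ (GoodOutcome φ cov
      (MDP.backup Q P.γ (stoppedValue Q P.γ φ π cov (1 - P.γ)⁻¹ (P.H - 1)) s a - P.ω / 4)
      (MDP.backup Q P.γ (stoppedValue Q P.γ φ π cov 0 (P.H - 1)) s a + P.ω / 4)) := by
  have hγ : 0 < 1 - P.γ := by linarith
  have hlog : 0 < Real.log (2 / ζ) := Real.log_pos ((lt_div_iff₀ hζ0).2 (by linarith))
  have hx : 0 < ((P.ω / 4) ^ 2)⁻¹ * ((1 - P.γ) ^ 2)⁻¹ * Real.log (2 / ζ) / 2 := by positivity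
  have hn : 0 < P.rollouts ζ := Nat.ceil_pos.2 hx
  have hle : ((P.ω / 4) ^ 2)⁻¹ * ((1 - P.γ) ^ 2)⁻¹ * Real.log (2 / ζ) / 2 ≤ P.rollouts ζ :=
    Nat.le_ceil _
  have hle2 : Real.log (2 / ζ) ≤ 2 * P.rollouts ζ * ((P.ω / 4) ^ 2 * (1 - P.γ) ^ 2) := by
    rw [← mul_inv, div_le_iff₀ (by norm_num), inv_mul_le_iff₀ (by positivity)] at hle
    linarith
  -- This `l` minimizes `-l t + l² R² / 8` for `t = ω/4` and `R = 1/(1-γ)`; each tail becomes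
  -- `exp(-2 n t²/R²) ≤ ζ/2` by the choice of the number of rollouts.
  refine le_trans (ENNReal.ofReal_le_ofReal ?_) (prob_measureLoop_ge Q P h0 h1 φ hπ hcov s a hn
    (l := 4 * (P.ω / 4) * (1 - P.γ) ^ 2) (by positivity) (P.ω / 4) rfl rfl (P.rollouts ζ) 0)
  set μ := MDP.backup Q P.γ (stoppedValue Q P.γ φ π cov 0 (P.H - 1)) s a
  set μ' := MDP.backup Q P.γ (stoppedValue Q P.γ φ π cov (1 - P.γ)⁻¹ (P.H - 1)) s a
  set n : ℝ := (P.rollouts ζ : ℝ)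
  set t := P.ω / 4
  have e1 : 4 * t * (1 - P.γ) ^ 2 * (0 - n * (μ + t)) +
      n * (4 * t * (1 - P.γ) ^ 2 * μ + (4 * t * (1 - P.γ) ^ 2) ^ 2 * (1 - P.γ)⁻¹ ^ 2 / 8) =
      -(2 * n * (t ^ 2 * (1 - P.γ) ^ 2)) := by
    field_simp
    ring
  have e2 : -(4 * t * (1 - P.γ) ^ 2) * (0 - n * (μ' - t)) +
      n * (-(4 * t * (1 - P.γ) ^ 2) * μ' + (4 * t * (1 - P.γ) ^ 2) ^ 2 * (1 - P.γ)⁻¹ ^ 2 / 8) =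
      -(2 * n * (t ^ 2 * (1 - P.γ) ^ 2)) := by
    field_simp
    ring
  have h3 : Real.exp (-(2 * n * (t ^ 2 * (1 - P.γ) ^ 2))) ≤ ζ / 2 := by
    rw [Real.exp_neg, inv_le_comm₀ (Real.exp_pos _) (by positivity), inv_div]
    rw [← Real.log_le_iff_le_exp (by positivity)]
    exact hle2
  rw [e1, e2]
  linarith

/-- The horizon is chosen for this bound on the truncated tail. It also holds when the ceiling is 0.
-/
theorem pow_H_le (P : Params) (h0 : 0 < P.γ) (h1 : P.γ < 1) (hω : 0 < P.ω) :
    P.γ ^ P.H * (1 - P.γ)⁻¹ ≤ P.ω / 4 := by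
  have hγ : 0 < 1 - P.γ := by linarith
  have hle : Real.log ((P.ω / 4) * (1 - P.γ)) / Real.log P.γ ≤ P.H := Nat.le_ceil _
  rw [div_le_iff_of_neg (Real.log_neg h0 h1)] at hle
  rw [← div_eq_mul_inv, div_le_iff₀ hγ, ← Real.log_le_log_iff (by positivity) (by positivity),
    Real.log_pow]
  exact hle

variable [DiscreteMeasurableSpace A]

theorem stoppedValue_le_detValue (Q : Kernel (S × A) (S × I)) [IsMarkovKernel Q] {γ : ℝ}
    (h0 : 0 ≤ γ) (h1 : γ < 1) (φ : S → Row A d) {π : Row A d → A}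
    (hπ : Measurable (fun s => π (φ s))) {cov : Set (Row A d)}
    (hcov : MeasurableSet {s | φ s ∈ cov}) (g : {g : S → A // Measurable g})
    (hg : ∀ s, φ s ∈ cov → g.1 s = π (φ s)) (m : ℕ) (s : S) :
    stoppedValue Q γ φ π cov 0 m s ≤ MDP.detValue Q γ g s := by
  have hR : 0 ≤ (1 - γ)⁻¹ := inv_nonneg.2 (by linarith)
  have hv := MDP.isVal_detValue Q h0 h1 g
  have hval0 := isVal_stoppedValue Q h0 h1 φ hπ hcov le_rfl hR
  induction m generalizing s with
  | zero => exact (hv.2 s).1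
  | succ m ih =>
    simp only [stoppedValue]
    split_ifs with hs
    · rw [MDP.detValue_eq_backup Q h0 h1, hg s hs]
      exact MDP.backup_mono Q h0 h1 (hval0 m) hv ih s _
    · exact (hv.2 s).1

/-- On the cover `g` and `π` act alike; off the cover the terminal reward dominates any value. Only
the truncation after `m` steps is lost. -/
theorem detValue_le_stoppedValue (Q : Kernel (S × A) (S × I)) [IsMarkovKernel Q] {γ : ℝ}
    (h0 : 0 ≤ γ) (h1 : γ < 1) (φ : S → Row A d) {π : Row A d → A}
    (hπ : Measurable (fun s => π (φ s))) {cov : Set (Row A d)}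
    (hcov : MeasurableSet {s | φ s ∈ cov}) (g : {g : S → A // Measurable g})
    (hg : ∀ s, φ s ∈ cov → g.1 s = π (φ s)) (m : ℕ) (s : S) :
    MDP.detValue Q γ g s ≤ stoppedValue Q γ φ π cov (1 - γ)⁻¹ m s + γ ^ m * (1 - γ)⁻¹ := by
  have hR : 0 ≤ (1 - γ)⁻¹ := inv_nonneg.2 (by linarith)
  have hv := MDP.isVal_detValue Q h0 h1 g
  have hvalR := isVal_stoppedValue Q h0 h1 φ hπ hcov hR le_rfl
  induction m generalizing s with
  | zero => simpa [stoppedValue] using (hv.2 s).2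
  | succ m ih =>
    simp only [stoppedValue]
    split_ifs with hs
    · rw [MDP.detValue_eq_backup Q h0 h1, hg s hs, pow_succ', mul_assoc]
      exact MDP.backup_le_backup_add Q h0 h1 hv (hvalR m) ih s _
    · have := (hv.2 s).2
      have := mul_nonneg (pow_nonneg h0 (m + 1)) hR
      linarith

/-- With high probability, `measure` discovers an uncovered state or returns an estimate that is
accurate for all policies that agree with `π` on the covered states. -/
theorem prob_measure_accurate (Q : Kernel (S × A) (S × I)) [IsMarkovKernel Q] (P : Params)
    (h0 : 0 < P.γ) (h1 : P.γ < 1) (hω : 0 < P.ω) (hH : P.H ≠ 0) (φ : S → Row A d)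
    {π : Row A d → A} (hπ : Measurable (fun s => π (φ s))) {cov : Set (Row A d)}
    (hcov : MeasurableSet {s | φ s ∈ cov}) (s : S) (a : A) {ζ : ℝ} (hζ0 : 0 < ζ) (hζ : ζ < 2) :
    ∃ lo hi : ℝ, ENNReal.ofReal (1 - ζ) ≤
        (measure P s a π cov ζ).prob Q φ (GoodOutcome φ cov lo hi) ∧
      ∀ q, lo ≤ q → q ≤ hi → ∀ g : {g : S → A // Measurable g},
        (∀ s, φ s ∈ cov → g.1 s = π (φ s)) → |q - MDP.detQ Q P.γ g s a| ≤ P.ω / 2 := by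
  have hR : 0 ≤ (1 - P.γ)⁻¹ := inv_nonneg.2 (by linarith)
  refine ⟨_, _, prob_measure_ge Q P h0.le h1 hω φ hπ hcov s a hζ0 hζ, fun q hlo hhi g hg => ?_⟩
  have hv := MDP.isVal_detValue Q h0.le h1 g
  have hval0 := isVal_stoppedValue Q h0.le h1 φ hπ hcov le_rfl hR (P.H - 1)
  have hvalR := isVal_stoppedValue Q h0.le h1 φ hπ hcov hR le_rfl (P.H - 1)
  have e1 := MDP.backup_mono Q h0.le h1 hval0 hv
    (stoppedValue_le_detValue Q h0.le h1 φ hπ hcov g hg _) s a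
  have e2 := MDP.backup_le_backup_add Q h0.le h1 hv hvalR
    (detValue_le_stoppedValue Q h0.le h1 φ hπ hcov g hg _) s a
  have e3 := pow_H_le P h0 h1 hω
  -- The first query is not part of the `H - 1` stopped steps; its factor `γ` completes the power `γ
  -- ^ H`.
  rw [← mul_assoc, ← pow_succ', Nat.sub_add_cancel (Nat.one_le_iff_ne_zero.2 hH)] at e2
  rw [MDP.detQ_eq_backup Q h0.le h1, abs_le]
  constructor <;> linarith

end MeasureProb

end Capi

namespace Capi

/-! ### Structural invariants of the core sets -/

section Structure

variable {S A : Type*} {d : ℕ}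

/-- A vector already present has weighted norm at most 1, so it cannot be appended again. -/
theorem Spread.nodup {lam : ℝ} (hl : 0 < lam) {F : List (Fin d → ℝ)} (h : Spread lam F) :
    F.Nodup := by
  induction F using List.reverseRecOn with
  | nil => simp
  | append_singleton F v ih =>
    have h1 := ih fun G w hG => h G w (hG.trans (List.prefix_append _ _))
    have h2 := h F v (List.prefix_refl _)
    refine List.nodup_append.2 ⟨h1, by simp, ?_⟩
    rintro a ha b hb rfl
    rw [List.mem_singleton] at hb
    subst hb
    exact absurd (inv_gram_le_one hl ha) (not_le.2 h2)

theorem Spread.append {lam : ℝ} {F : List (Fin d → ℝ)} {v : Fin d → ℝ} (h : Spread lam F)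
    (hv : 1 < v ⬝ᵥ ((gram lam F)⁻¹.mulVec v)) : Spread lam (F ++ [v]) := by
  intro G w hG
  rcases List.prefix_concat_iff.1 hG with h1 | h1
  · obtain ⟨rfl, h2⟩ := List.append_inj' h1 rfl
    simp only [List.cons.injEq, and_true] at h2
    exact h2 ▸ hv
  · exact h G w h1

/-- An item without its estimate. -/
def Item.key (it : Item S A d) : S × Row A d × A := (it.st, it.row, it.act)

theorem map_feat_eq (C : List (Item S A d)) :
    C.map Item.feat = (C.map Item.key).map (fun k => (k.2.1 k.2.2).ofLp) := by
  rw [List.map_map]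
  rfl

theorem feat_prefix {C C' : List (Item S A d)} (h : C.map Item.key <+: C'.map Item.key) :
    C.map Item.feat <+: C'.map Item.feat := by
  rw [map_feat_eq, map_feat_eq]
  exact h.map _

theorem cover_eq_of_feat_eq (lam : ℝ) {C C' : List (Item S A d)}
    (h : C.map Item.feat = C'.map Item.feat) : Cover lam C = Cover lam C' := by
  ext x
  simp only [Cover, Set.mem_ofPred_eq, actionCovered_iff, h]

theorem cover_eq_of_key_eq (lam : ℝ) {C C' : List (Item S A d)}
    (h : C.map Item.key = C'.map Item.key) : Cover lam C = Cover lam C' :=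
  cover_eq_of_feat_eq lam (by rw [map_feat_eq, h, ← map_feat_eq])

/-- Structural invariants of the planner, apart from the synchronization of the levels. -/
structure Coherent (P : Params) (φ : S → Row A d) (st : PlanState S A d) : Prop where
  row : ∀ l, ∀ it ∈ st.core l, it.row = φ it.st
  spread : Spread P.lam ((st.core 0).map Item.feat)
  pre : ∀ l, (st.core (l + 1)).map Item.key <+: (st.core l).map Item.key

/-- When no estimate is missing at level `l`, level `l + 1` has the same core set. -/
def SyncAt (st : PlanState S A d) (l : ℕ) : Prop :=
  (∀ it ∈ st.core l, it.est ≠ none) → (st.core (l + 1)).map Item.key = (st.core l).map Item.key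

theorem Coherent.prefix_zero {P : Params} {φ : S → Row A d} {st : PlanState S A d}
    (h : Coherent P φ st) (l : ℕ) : (st.core l).map Item.key <+: (st.core 0).map Item.key := by
  induction l with
  | zero => exact List.prefix_refl _
  | succ l ih => exact (h.pre l).trans ih

theorem Coherent.length_le {P : Params} {φ : S → Row A d} {st : PlanState S A d}
    (h : Coherent P φ st) (l : ℕ) : (st.core l).length ≤ (st.core 0).length := by
  simpa using (h.prefix_zero l).length_le

theorem nodup_pairs {lam : ℝ} (hl : 0 < lam) {φ : S → Row A d} {C : List (Item S A d)}
    (hrow : ∀ it ∈ C, it.row = φ it.st) (hs : Spread lam (C.map Item.feat)) :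
    (C.map (fun it => (it.st, it.act))).Nodup := by
  refine List.Nodup.of_map (fun p : S × A => (φ p.1 p.2).ofLp) ?_
  have : (C.map (fun it => (it.st, it.act))).map (fun p : S × A => (φ p.1 p.2).ofLp) =
      C.map Item.feat := by
    rw [List.map_map]
    refine List.map_congr_left fun it hit => ?_
    simp [Item.feat, hrow it hit]
  rw [this]
  exact hs.nodup hl

theorem Coherent.nodup {P : Params} (hl : 0 < P.lam) {φ : S → Row A d} {st : PlanState S A d}
    (h : Coherent P φ st) (l : ℕ) : ((st.core l).map (fun it => (it.st, it.act))).Nodup := by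
  refine nodup_pairs hl (h.row l) fun G v hG => h.spread G v ?_
  exact hG.trans (feat_prefix (h.prefix_zero l))

theorem Coherent.length_le_dTilde {P : Params} (hl : 0 < P.lam) (hd : 0 < d) {φ : S → Row A d}
    (hφ : ∀ s a, ‖φ s a‖ ≤ P.L) {st : PlanState S A d} (h : Coherent P φ st) :
    (st.core 0).length ≤ ⌊P.dTilde d / 2⌋₊ := by
  refine Nat.le_floor ?_
  have := h.spread.length_le (L := P.L) hl hd (by
    intro v hv
    obtain ⟨it, hit, rfl⟩ := List.mem_map.1 hv
    have h1 : it.feat ⬝ᵥ it.feat = ‖it.row it.act‖ ^ 2 := by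
      rw [← real_inner_self_eq_norm_sq, EuclideanSpace.inner_eq_star_dotProduct, star_trivial]
      rfl
    rw [h1, h.row 0 it hit]
    exact pow_le_pow_left₀ (norm_nonneg _) (hφ _ _) 2)
  rw [List.length_map] at this
  refine this.trans (le_of_eq ?_)
  rw [Params.dTilde]
  ring

/-- Since `C'` is a prefix of `C` up to estimates and `C` has no repeated pairs, the pairs of `C`
absent from `C'` are exactly the remaining suffix, in order. -/
theorem keys_append_missing {C C' : List (Item S A d)}
    (hpre : C'.map Item.key <+: C.map Item.key)
    (hnd : (C.map (fun it => (it.st, it.act))).Nodup) {p : Item S A d → Bool}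
    (hp : ∀ it, p it = true ↔ ∀ jt ∈ C', (jt.st, jt.act) ≠ (it.st, it.act)) :
    (C' ++ (C.filter p).map (fun it : Item S A d => { it with est := none })).map Item.key =
      C.map Item.key := by
  obtain ⟨C₁, ⟨C₂, rfl⟩, hC₁⟩ := List.prefix_map_iff.1 hpre
  have hpair : C'.map (fun it => (it.st, it.act)) = C₁.map (fun it => (it.st, it.act)) := by
    have := congrArg (List.map (fun k : S × Row A d × A => (k.1, k.2.2))) hC₁
    simpa [List.map_map, Function.comp_def, Item.key] using this
  have hmem : ∀ p, (∃ jt ∈ C', (jt.st, jt.act) = p) ↔ ∃ jt ∈ C₁, (jt.st, jt.act) = p := fun p => by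
    rw [← List.mem_map, ← List.mem_map, hpair]
  have h1 : C₁.filter p = [] := by
    rw [List.filter_eq_nil_iff]
    intro it hit hpit
    obtain ⟨jt, hj, he⟩ := (hmem (it.st, it.act)).2 ⟨it, hit, rfl⟩
    exact (hp it).1 hpit jt hj he
  have h2 : C₂.filter p = C₂ := by
    rw [List.filter_eq_self]
    intro it hit
    rw [hp]
    intro jt hj he
    obtain ⟨kt, hk, he'⟩ := (hmem _).1 ⟨jt, hj, he⟩
    rw [List.map_append] at hnd
    exact (List.nodup_append.1 hnd).2.2 _ (List.mem_map.2 ⟨kt, hk, rfl⟩) _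
      (List.mem_map.2 ⟨it, hit, rfl⟩) he'
  rw [List.filter_append, h1, h2, List.nil_append, List.map_append, List.map_append, hC₁,
    List.map_map]
  rfl

/-- Store the estimate `q`. -/
def PlanState.store (st : PlanState S A d) (l m : ℕ) (it : Item S A d) (q : ℝ) :
    PlanState S A d :=
  { st with core := Function.update st.core l ((st.core l).set m { it with est := some q }) }

theorem store_keys (st : PlanState S A d) {l m : ℕ} {it : Item S A d}
    (hit : (st.core l)[m]? = some it) (q : ℝ) (k : ℕ) :
    ((st.store l m it q).core k).map Item.key = (st.core k).map Item.key := by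
  rcases eq_or_ne k l with rfl | hk
  · simp only [PlanState.store, Function.update_self, List.map_set]
    obtain ⟨hm, he⟩ := List.getElem?_eq_some_iff.1 hit
    have h : Item.key { it with est := some q } =
        ((st.core k).map Item.key)[m]'(by simpa using hm) := by
      rw [List.getElem_map, he]
      rfl
    rw [h, List.set_getElem_self]
  · simp [PlanState.store, hk]

theorem mem_store {st : PlanState S A d} {l m : ℕ} {it : Item S A d} {q : ℝ} {k : ℕ}
    {jt : Item S A d} (h : jt ∈ (st.store l m it q).core k) :
    jt ∈ st.core k ∨ k = l ∧ jt = { it with est := some q } := by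
  rcases eq_or_ne k l with rfl | hk
  · simp only [PlanState.store, Function.update_self] at h
    exact (List.mem_or_eq_of_mem_set h).imp_right fun h => ⟨rfl, h⟩
  · left
    simpa [PlanState.store, hk] using h

theorem spread_of_keys_eq {lam : ℝ} {C C' : List (Item S A d)}
    (h : C'.map Item.key = C.map Item.key) (hs : Spread lam (C.map Item.feat)) :
    Spread lam (C'.map Item.feat) := by
  rwa [map_feat_eq, h, ← map_feat_eq]

theorem Coherent.store {P : Params} {φ : S → Row A d} {st : PlanState S A d}
    (h : Coherent P φ st) {l m : ℕ} {it : Item S A d} (hit : (st.core l)[m]? = some it) (q : ℝ) :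
    Coherent P φ (st.store l m it q) where
  row := by
    intro k jt hj
    rcases mem_store hj with hj | ⟨rfl, rfl⟩
    · exact h.row k jt hj
    · exact h.row k it (List.mem_of_getElem? hit)
  spread := spread_of_keys_eq (store_keys st hit q 0) h.spread
  pre := by
    intro k
    rw [store_keys st hit, store_keys st hit]
    exact h.pre k

theorem SyncAt.store {st : PlanState S A d} {k : ℕ} (h : SyncAt st k) {l m : ℕ} {it : Item S A d}
    (hit : (st.core l)[m]? = some it) (q : ℝ) (hk : k ≠ l) : SyncAt (st.store l m it q) k := by
  intro h2
  rw [store_keys st hit, store_keys st hit]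
  refine h fun jt hj => h2 jt ?_
  simpa [PlanState.store, hk] using hj

section Improve

variable [Fintype A] [LinearOrder A] [Nonempty A]

theorem improve_core_of_ne (P : Params) (st : PlanState S A d) {l k : ℕ} (hk : k ≠ l + 1) :
    (st.improve P l).core k = st.core k := by
  simp [PlanState.improve, hk]

theorem improve_keys {P : Params} (hl : 0 < P.lam) {φ : S → Row A d} {st : PlanState S A d}
    (h : Coherent P φ st) (l : ℕ) :
    ((st.improve P l).core (l + 1)).map Item.key = (st.core l).map Item.key := by
  simp only [PlanState.improve, Function.update_self]
  exact keys_append_missing (h.pre l) (h.nodup hl l) fun _ =>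
    @decide_eq_true_iff _ (Classical.propDecidable _)

theorem mem_improve {P : Params} {st : PlanState S A d} {l k : ℕ} {jt : Item S A d}
    (h : jt ∈ (st.improve P l).core k) : jt ∈ st.core k ∨ k = l + 1 ∧ jt.est = none ∧
      ∃ it ∈ st.core l, jt = { it with est := none } := by
  rcases eq_or_ne k (l + 1) with rfl | hk
  · simp only [PlanState.improve, Function.update_self, List.mem_append, List.mem_map,
      List.mem_filter] at h
    rcases h with h | ⟨it, ⟨hit, -⟩, rfl⟩
    · exact Or.inl h
    · exact Or.inr ⟨rfl, rfl, it, hit, rfl⟩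
  · rw [improve_core_of_ne P st hk] at h
    exact Or.inl h

theorem improve_prefix {P : Params} (st : PlanState S A d) (l k : ℕ) :
    st.core k <+: (st.improve P l).core k := by
  rcases eq_or_ne k (l + 1) with rfl | hk
  · simp only [PlanState.improve, Function.update_self]
    exact List.prefix_append _ _
  · rw [improve_core_of_ne P st hk]

theorem Coherent.improve {P : Params} (hl : 0 < P.lam) {φ : S → Row A d} {st : PlanState S A d}
    (h : Coherent P φ st) (l : ℕ) : Coherent P φ (st.improve P l) where
  row := by
    intro k jt hj
    rcases mem_improve hj with hj | ⟨rfl, -, it, hit, rfl⟩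
    · exact h.row k jt hj
    · exact h.row l it hit
  spread := by
    rw [improve_core_of_ne P st (by omega)]
    exact h.spread
  pre := by
    intro k
    rcases eq_or_ne k l with rfl | hk
    · rw [improve_keys hl h, improve_core_of_ne P st (by omega)]
    · rw [improve_core_of_ne P st (k := k + 1) (by omega)]
      exact (h.pre k).trans ((improve_prefix st l k).map _)

/-- Level `l` is synchronized by the copying itself. Level `l + 1` may have grown ahead of level `l
+ 2`, but then it contains missing estimates and nothing is claimed. -/
theorem SyncAt.improve {P : Params} (hl : 0 < P.lam) {φ : S → Row A d} {st : PlanState S A d}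
    (h : Coherent P φ st) (l : ℕ) (hs : ∀ k, k ≠ l → SyncAt st k) (k : ℕ) :
    SyncAt (st.improve P l) k := by
  intro hk
  rcases eq_or_ne k l with rfl | hkl
  · rw [improve_keys hl h, improve_core_of_ne P st (by omega)]
  · rw [improve_core_of_ne P st (k := k + 1) (by omega)]
    have hpre := improve_prefix (P := P) st l k
    have h1 := hs k hkl fun it hit => hk it (hpre.subset hit)
    rw [h1]
    rcases eq_or_ne k (l + 1) with rfl | hk1
    · obtain ⟨G, hG⟩ := hpre
      -- Copied items carry no estimate, so a level without missing estimates received none.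
      have : G = [] := by
        refine List.eq_nil_iff_forall_not_mem.2 fun jt hj => ?_
        have hG2 := hG
        simp only [PlanState.improve, Function.update_self] at hG2
        replace hG2 := List.append_cancel_left hG2
        refine hk jt (by rw [← hG]; exact List.mem_append_right _ hj) ?_
        rw [hG2] at hj
        obtain ⟨it, -, rfl⟩ := List.mem_map.1 hj
        rfl
      rw [← hG, this, List.append_nil]
    · rw [improve_core_of_ne P st hk1]

open Classical in
theorem record_eq (P : Params) (st : PlanState S A d) (l m : ℕ) (it : Item S A d) (q : ℝ) :
    st.record P l m it q =
      if ∃ jt ∈ (st.store l m it q).core l, jt.est = none then st.store l m it q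
      else (st.store l m it q).improve P l := rfl

end Improve

/-- All structural invariants of the planner. -/
structure Inv (P : Params) (φ : S → Row A d) (st : PlanState S A d) : Prop
    extends Coherent P φ st where
  sync : ∀ l, SyncAt st l

theorem Inv.record [Fintype A] [LinearOrder A] [Nonempty A] {P : Params} (hl : 0 < P.lam)
    {φ : S → Row A d} {st : PlanState S A d} (h : Inv P φ st) {l m : ℕ} {it : Item S A d}
    (hit : (st.core l)[m]? = some it) (q : ℝ) : Inv P φ (st.record P l m it q) := by
  have hc := h.toCoherent.store hit q
  rw [record_eq]
  split_ifs with hn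
  · refine ⟨hc, fun k => ?_⟩
    rcases eq_or_ne k l with rfl | hk
    · obtain ⟨jt, hj, he⟩ := hn
      exact fun h2 => absurd he (h2 jt hj)
    · exact (h.sync k).store hit q hk
  · exact ⟨hc.improve hl l, SyncAt.improve hl hc l fun k hk => (h.sync k).store hit q hk⟩

theorem discover_core_of_ne (P : Params) (sel : Selector S A d) (st : PlanState S A d) (s : S)
    (x : Row A d) {k : ℕ} (hk : k ≠ 0) : (st.discover P sel s x).core k = st.core k := by
  simp [PlanState.discover, hk]

theorem discover_core_zero (P : Params) (sel : Selector S A d) (st : PlanState S A d) (s : S)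
    (x : Row A d) : (st.discover P sel s x).core 0 = st.core 0 ++
      [⟨s, x, sel.action st {a | ¬ ActionCovered P.lam (st.core 0) x a}, none⟩] := by
  simp [PlanState.discover]

theorem discover_prefix (P : Params) (sel : Selector S A d) (st : PlanState S A d) (s : S)
    (x : Row A d) (k : ℕ) : st.core k <+: (st.discover P sel s x).core k := by
  rcases eq_or_ne k 0 with rfl | hk
  · rw [discover_core_zero]
    exact List.prefix_append _ _
  · rw [discover_core_of_ne P sel st s x hk]

theorem mem_discover {P : Params} {sel : Selector S A d} {st : PlanState S A d} {s : S}
    {x : Row A d} {k : ℕ} {jt : Item S A d} (h : jt ∈ (st.discover P sel s x).core k) :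
    jt ∈ st.core k ∨ jt.est = none ∧ jt.st = s ∧ jt.row = x := by
  rcases eq_or_ne k 0 with rfl | hk
  · rw [discover_core_zero, List.mem_append, List.mem_singleton] at h
    rcases h with h | rfl
    · exact Or.inl h
    · exact Or.inr ⟨rfl, rfl, rfl⟩
  · rw [discover_core_of_ne P sel st s x hk] at h
    exact Or.inl h

theorem Inv.discover {P : Params} {φ : S → Row A d} {st : PlanState S A d} (h : Inv P φ st)
    (sel : Selector S A d) {s : S} (hx : ∃ a, ¬ ActionCovered P.lam (st.core 0) (φ s) a) :
    Inv P φ (st.discover P sel s (φ s)) where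
  row := by
    intro k jt hj
    rcases mem_discover hj with hj | ⟨-, h1, h2⟩
    · exact h.row k jt hj
    · rw [h1, h2]
  spread := by
    rw [discover_core_zero, List.map_append]
    refine h.spread.append ?_
    have := sel.action_mem st {a | ¬ ActionCovered P.lam (st.core 0) (φ s) a} hx
    rw [Set.mem_ofPred_eq, actionCovered_iff, not_le] at this
    exact this
  pre := by
    intro k
    rw [discover_core_of_ne P sel st s (φ s) (k := k + 1) (by omega)]
    exact (h.pre k).trans ((discover_prefix P sel st s (φ s) k).map _)
  sync := by
    intro k hk
    rcases eq_or_ne k 0 with rfl | hk0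
    · refine absurd rfl (hk ⟨s, φ s, sel.action st
        {a | ¬ ActionCovered P.lam (st.core 0) (φ s) a}, none⟩ ?_)
      rw [discover_core_zero]
      simp
    · rw [discover_core_of_ne P sel st s (φ s) (k := k + 1) (by omega)]
      rw [discover_core_of_ne P sel st s (φ s) hk0] at hk ⊢
      exact h.sync k hk

/-- The number of stored estimates below level `H`. -/
def estCount (st : PlanState S A d) (H : ℕ) : ℕ :=
  ∑ l ∈ Finset.range H, (st.core l).countP (fun it => it.est.isSome)

theorem estCount_le {P : Params} {φ : S → Row A d} {st : PlanState S A d}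
    (h : Coherent P φ st) {D : ℕ} (hD : (st.core 0).length ≤ D) (H : ℕ) :
    estCount st H ≤ H * D := by
  refine (Finset.sum_le_card_nsmul _ _ D fun l _ => ?_).trans (by simp)
  exact List.countP_le_length.trans ((h.length_le l).trans hD)

theorem estCount_discover (P : Params) (sel : Selector S A d) (st : PlanState S A d) (s : S)
    (x : Row A d) (H : ℕ) : estCount (st.discover P sel s x) H = estCount st H := by
  refine Finset.sum_congr rfl fun l _ => ?_
  rcases eq_or_ne l 0 with rfl | hl
  · simp [discover_core_zero]
  · rw [discover_core_of_ne P sel st s x hl]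

theorem estCount_improve [Fintype A] [LinearOrder A] [Nonempty A] (P : Params)
    (st : PlanState S A d) (l H : ℕ) : estCount (st.improve P l) H = estCount st H := by
  refine Finset.sum_congr rfl fun k _ => ?_
  rcases eq_or_ne k (l + 1) with rfl | hk
  · simp only [PlanState.improve, Function.update_self, List.countP_append, Nat.add_eq_left]
    rw [List.countP_eq_zero]
    intro jt hj
    obtain ⟨it, -, rfl⟩ := List.mem_map.1 hj
    simp
  · rw [improve_core_of_ne P st hk]

/-- A missing entry is filled, never an existing one overwritten, so each successful measurement is
real progress. -/
theorem estCount_store {st : PlanState S A d} {l m H : ℕ} {it : Item S A d}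
    (hit : (st.core l)[m]? = some it) (hn : it.est = none) (hl : l < H) (q : ℝ) :
    estCount (st.store l m it q) H = estCount st H + 1 := by
  obtain ⟨hm, he⟩ := List.getElem?_eq_some_iff.1 hit
  unfold estCount
  rw [← Finset.add_sum_erase _ _ (Finset.mem_range.2 hl),
    ← Finset.add_sum_erase (Finset.range H) (fun l => (st.core l).countP _)
      (Finset.mem_range.2 hl)]
  have h1 : ((st.store l m it q).core l).countP (fun it => it.est.isSome) =
      (st.core l).countP (fun it => it.est.isSome) + 1 := by
    simp [PlanState.store, List.countP_set hm, he, hn]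
  have h2 : ∑ x ∈ (Finset.range H).erase l,
      ((st.store l m it q).core x).countP (fun it => it.est.isSome) =
      ∑ x ∈ (Finset.range H).erase l, (st.core x).countP (fun it => it.est.isSome) := by
    refine Finset.sum_congr rfl fun k hk => ?_
    simp [PlanState.store, Finset.ne_of_mem_erase hk]
  rw [h1, h2]
  ring

theorem estCount_record [Fintype A] [LinearOrder A] [Nonempty A] (P : Params)
    {st : PlanState S A d} {l m H : ℕ} {it : Item S A d}
    (hit : (st.core l)[m]? = some it) (hn : it.est = none) (hl : l < H) (q : ℝ) :
    estCount (st.record P l m it q) H = estCount st H + 1 := by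
  rw [record_eq]
  split_ifs
  · exact estCount_store hit hn hl q
  · rw [estCount_improve, estCount_store hit hn hl q]

theorem length_record [Fintype A] [LinearOrder A] [Nonempty A] (P : Params)
    (st : PlanState S A d) (l m : ℕ) (it : Item S A d) (q : ℝ) :
    ((st.record P l m it q).core 0).length = (st.core 0).length := by
  have h : ((st.store l m it q).core 0).length = (st.core 0).length := by
    rcases eq_or_ne 0 l with rfl | hl
    · simp [PlanState.store]
    · simp [PlanState.store, hl]
  rw [record_eq]
  split_ifs
  · exact h
  · rw [improve_core_of_ne _ _ (by omega), h]

/-- States of the items after `record` are states of items before. -/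
theorem mem_record [Fintype A] [LinearOrder A] [Nonempty A] {P : Params}
    {st : PlanState S A d} {l m : ℕ} {it : Item S A d} (hit : (st.core l)[m]? = some it) {q : ℝ}
    {k : ℕ} {jt : Item S A d} (h : jt ∈ (st.record P l m it q).core k) :
    ∃ k', ∃ it' ∈ st.core k', jt.st = it'.st := by
  have hs : ∀ {k} {jt : Item S A d}, jt ∈ (st.store l m it q).core k →
      ∃ k', ∃ it' ∈ st.core k', jt.st = it'.st := by
    intro k jt hj
    rcases mem_store hj with hj | ⟨rfl, rfl⟩
    · exact ⟨k, jt, hj, rfl⟩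
    · exact ⟨k, it, List.mem_of_getElem? hit, rfl⟩
  rw [record_eq] at h
  split_ifs at h
  · exact hs h
  · rcases mem_improve h with hj | ⟨-, -, it', hit', rfl⟩
    · exact hs hj
    · obtain ⟨k', it'', h1, h2⟩ := hs hit'
      exact ⟨k', it'', h1, h2⟩

theorem level_spec (st : PlanState S A d) (H : ℕ) :
    st.level H = H ∨ st.level H < H ∧ ∃ it ∈ st.core (st.level H), it.est = none := by
  have hne : {l | l = H ∨ ∃ it ∈ st.core l, it.est = none}.Nonempty := ⟨H, Or.inl rfl⟩
  have hle : st.level H ≤ H := Nat.sInf_le (Or.inl rfl)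
  rcases hle.eq_or_lt with h | h
  · exact Or.inl h
  · rcases Nat.sInf_mem hne with h' | h'
    · exact Or.inl h'
    · exact Or.inr ⟨h, h'⟩

theorem est_ne_none_of_lt_level {st : PlanState S A d} {H k : ℕ} (hk : k < st.level H) :
    ∀ it ∈ st.core k, it.est ≠ none := by
  intro it hit hn
  exact Nat.notMem_of_lt_sInf hk (Or.inr ⟨it, hit, hn⟩)

/-- Below the active level nothing is missing, so synchronization chains from level 0 up to it. Thus
coverage at the active level is coverage by `C_0`. -/
theorem Inv.keys_eq_of_le_level {P : Params} {φ : S → Row A d} {st : PlanState S A d}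
    (h : Inv P φ st) {H k : ℕ} (hk : k ≤ st.level H) :
    (st.core k).map Item.key = (st.core 0).map Item.key := by
  induction k with
  | zero => rfl
  | succ k ih =>
    rw [h.sync k (est_ne_none_of_lt_level (H := H) (by omega)), ih (by omega)]

end Structure

end Capi

namespace Capi

/-! ### Measurability of covers, estimates and updated policies -/

section Measurability

variable {S A : Type*} {d : ℕ} [MeasurableSpace S] {φ : S → Row A d}

theorem measurable_quadratic (hφ : ∀ a, Measurable (fun s => φ s a))
    (M : Matrix (Fin d) (Fin d) ℝ) (a : A) :
    Measurable (fun s => wnorm M (φ s a).ofLp) := by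
  have h : Continuous (fun v : EuclideanSpace ℝ (Fin d) => wnorm M v.ofLp) := by
    unfold wnorm
    have h1 : Continuous (fun v : EuclideanSpace ℝ (Fin d) => v.ofLp) := PiLp.continuous_ofLp 2 _
    exact Real.continuous_sqrt.comp (h1.dotProduct (continuous_const.matrix_mulVec h1))
  exact h.measurable.comp (hφ a)

theorem measurableSet_cover [Finite A] (hφ : ∀ a, Measurable (fun s => φ s a)) (lam : ℝ)
    (C : List (Item S A d)) : MeasurableSet {s | φ s ∈ Cover lam C} := by
  have : {s | φ s ∈ Cover lam C} = ⋂ a, {s | wnorm (designMatrix lam C)⁻¹ (φ s a).ofLp ≤ 1} := by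
    ext s
    simp [Cover, ActionCovered]
  rw [this]
  exact MeasurableSet.iInter fun a =>
    measurableSet_le (measurable_quadratic hφ _ a) measurable_const

theorem measurable_lse (hφ : ∀ a, Measurable (fun s => φ s a)) (lam : ℝ)
    (C : List (Item S A d)) (a : A) : Measurable (fun s => lse lam C (φ s) a) := by
  have h : Continuous (fun v : EuclideanSpace ℝ (Fin d) => v.ofLp ⬝ᵥ
      ((designMatrix lam C)⁻¹.mulVec (C.map (fun it => (it.est.getD 0) • it.feat)).sum)) :=
    (PiLp.continuous_ofLp 2 _).dotProduct continuous_const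
  exact h.measurable.comp (hφ a)

theorem sup'_eq_argmaxFirst [Fintype A] [LinearOrder A] [Nonempty A] (f : A → ℝ) :
    Finset.univ.sup' Finset.univ_nonempty f = f (argmaxFirst f) :=
  le_antisymm (Finset.sup'_le _ _ fun b _ => le_argmaxFirst f b)
    (Finset.le_sup' f (Finset.mem_univ _))

theorem measurable_apply_of_discrete [Countable A] [MeasurableSpace A] [DiscreteMeasurableSpace A]
    {f : S → A → ℝ} (hf : ∀ a, Measurable (fun s => f s a)) {g : S → A} (hg : Measurable g) :
    Measurable (fun s => f s (g s)) :=
  (measurable_from_prod_countable_left (f := fun p : S × A => f p.1 p.2) hf).comp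
    (measurable_id.prodMk hg)

theorem measurable_capiUpdate [Fintype A] [LinearOrder A] [Nonempty A] [MeasurableSpace A]
    [DiscreteMeasurableSpace A] (w : ℝ) {q : Row A d → A → ℝ}
    (hq : ∀ a, Measurable (fun s => q (φ s) a)) {π : Row A d → A}
    (hπ : Measurable (fun s => π (φ s))) {fix : Set (Row A d)}
    (hfix : MeasurableSet {s | φ s ∈ fix}) :
    Measurable (fun s => capiUpdate w q π fix (φ s)) := by
  have ha := measurable_argmaxFirst hq
  have h1 := measurable_apply_of_discrete hq hπ
  have h2 := measurable_apply_of_discrete hq ha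
  have h3 : Measurable (fun s => Finset.univ.sup' Finset.univ_nonempty (q (φ s))) := by
    have e : (fun s => Finset.univ.sup' Finset.univ_nonempty (q (φ s))) =
        fun s => q (φ s) (argmaxFirst (q (φ s))) := funext fun s => sup'_eq_argmaxFirst _
    rw [e]
    exact h2
  unfold capiUpdate
  refine Measurable.ite ?_ ha hπ
  exact (hfix.compl).inter (measurableSet_lt (h1.add_const w) (h3.sub_const w))

end Measurability

/-! ### Accuracy of the estimates and of the policy updates -/

section Accuracy

variable {S A : Type*} {d : ℕ} [Fintype A] [LinearOrder A] [Nonempty A]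

/-- The confident update never decreases the action value, and it is almost greedy. -/
theorem capiUpdate_spec {X : Type*} {w : ℝ} {q : X → A → ℝ} {π : X → A} {fix : Set X} {x : X}
    (hx : x ∉ fix) {f : A → ℝ} (h : ∀ a, |q x a - f a| ≤ w) :
    f (π x) ≤ f (capiUpdate w q π fix x) ∧ ∀ a, f a ≤ f (capiUpdate w q π fix x) + 4 * w := by
  have hlo : ∀ a, q x a - w ≤ f a := fun a => by linarith [(abs_le.1 (h a)).2]
  have hhi : ∀ a, f a ≤ q x a + w := fun a => by linarith [(abs_le.1 (h a)).1]
  have hmax := le_argmaxFirst (q x)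
  have hw : 0 ≤ w := (abs_nonneg _).trans (h (π x))
  unfold capiUpdate
  rw [sup'_eq_argmaxFirst]
  split_ifs with hc
  · exact ⟨by linarith [hlo (argmaxFirst (q x)), hhi (π x), hc.2],
      fun a => by linarith [hlo (argmaxFirst (q x)), hhi a, hmax a]⟩
  -- Without an update the two estimates differ by at most `2w`, and passing to `f` costs `w` at
  -- each end: this is the case that needs `4w`.
  · have hc2 : ¬ (q x (π x) + w < q x (argmaxFirst (q x)) - w) := fun h2 => hc ⟨hx, h2⟩
    exact ⟨le_rfl, fun a => by linarith [hlo (π x), hhi a, hmax a]⟩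

variable [MeasurableSpace S] [MeasurableSpace A]

/-- `g` agrees with the policy `π` on the covered states. -/
def Agrees (φ : S → Row A d) (π : Row A d → A) (cov : Set (Row A d))
    (g : {g : S → A // Measurable g}) : Prop :=
  ∀ s, φ s ∈ cov → g.1 s = π (φ s)

variable [DiscreteMeasurableSpace A]

/-- The action values of all deterministic policies are linear in the features up to `ε`. -/
def Realizable (Q : Kernel (S × A) (S × I)) [IsMarkovKernel Q] (P : Params)
    (φ : S → Row A d) : Prop :=
  ∀ (g : {g : S → A // Measurable g}) (η : ℝ), 0 < η →
    ∃ θ : EuclideanSpace ℝ (Fin d), ‖θ‖ ≤ P.B ∧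
      ∀ s a, |MDP.detQ Q P.γ g s a - inner ℝ (φ s a) θ| ≤ P.ε + η

/-- Each residual is at most `ω/2 + ε`, from the measurement and from realizability. The bias is at
most `ω` by the choice of `λ`, and a final `ε` returns from the linear function to the action value.
-/
theorem abs_lse_sub_detQ_le (Q : Kernel (S × A) (S × I)) [IsMarkovKernel Q] {P : Params}
    {φ : S → Row A d} (hε : 0 ≤ P.ε) (hω : 0 < P.ω) (hB : 0 < P.B) (hR : Realizable Q P φ)
    (g : {g : S → A // Measurable g}) {C : List (Item S A d)}
    (hrow : ∀ it ∈ C, it.row = φ it.st) (hlen : (C.length : ℝ) ≤ P.dTilde d)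
    (hest : ∀ it ∈ C, ∃ q, it.est = some q ∧ |q - MDP.detQ Q P.γ g it.st it.act| ≤ P.ω / 2)
    {s : S} (hs : φ s ∈ Cover P.lam C) (a : A) :
    |lse P.lam C (φ s) a - MDP.detQ Q P.γ g s a| ≤ P.width d := by
  have hl : 0 < P.lam := by unfold Params.lam; positivity
  have hsq : Real.sqrt P.lam * P.B = P.ω := by
    rw [Params.lam, Real.sqrt_div (by positivity), Real.sqrt_sq hω.le, Real.sqrt_sq hB.le,
      div_mul_cancel₀ _ hB.ne']
  have hlen' : Real.sqrt C.length ≤ Real.sqrt (P.dTilde d) := Real.sqrt_le_sqrt hlen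
  set D := Real.sqrt (P.dTilde d) with hD
  have hD0 : 0 ≤ D := Real.sqrt_nonneg _
  have key : ∀ η, 0 < η → |lse P.lam C (φ s) a - MDP.detQ Q P.γ g s a| ≤
      (P.ω / 2 + (P.ε + η)) * D + P.ω + (P.ε + η) := by
    intro η hη
    obtain ⟨θ, hθ, hap⟩ := hR g η hη
    have h1 := abs_lse_sub_le hl C (hs a) θ (e := P.ω / 2 + (P.ε + η)) (by positivity) (by
      intro it hit
      obtain ⟨q, hq, hq'⟩ := hest it hit
      have h2 := hap it.st it.act
      rw [hq, hrow it hit, Option.getD_some]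
      calc |q - inner ℝ (φ it.st it.act) θ|
          = |(q - MDP.detQ Q P.γ g it.st it.act) +
            (MDP.detQ Q P.γ g it.st it.act - inner ℝ (φ it.st it.act) θ)| := by ring_nf
        _ ≤ _ := abs_add_le _ _
        _ ≤ _ := add_le_add hq' h2)
    have h2 := hap s a
    rw [abs_sub_comm] at h2
    have h3 : (P.ω / 2 + (P.ε + η)) * Real.sqrt C.length ≤ (P.ω / 2 + (P.ε + η)) * D :=
      mul_le_mul_of_nonneg_left hlen' (by positivity)
    have h4 : Real.sqrt P.lam * ‖θ‖ ≤ P.ω := by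
      rw [← hsq]
      exact mul_le_mul_of_nonneg_left hθ (Real.sqrt_nonneg _)
    calc |lse P.lam C (φ s) a - MDP.detQ Q P.γ g s a|
        = |(lse P.lam C (φ s) a - inner ℝ (φ s a) θ) +
          (inner ℝ (φ s a) θ - MDP.detQ Q P.γ g s a)| := by ring_nf
      _ ≤ _ := abs_add_le _ _
      _ ≤ _ := by linarith
  refine le_of_forall_pos_le_add fun η hη => ?_
  -- The slack `η` in `Realizable` appears with total factor `D + 1`; the rescaling turns it into a
  -- plain additive `η`.
  have h1 := key (η / (D + 1)) (by positivity)
  have h2 : η / (D + 1) * D + η / (D + 1) = η := by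
    field_simp
  rw [Params.width, ← hD]
  nlinarith [mul_nonneg hω.le hD0]

/-- Invariants of the planner that hold as long as all measurements were accurate. -/
structure Accurate (Q : Kernel (S × A) (S × I)) [IsMarkovKernel Q] (P : Params)
    (φ : S → Row A d) (st : PlanState S A d) : Prop where
  meas : ∀ l, Measurable (fun s => st.pol l (φ s))
  est : ∀ l, ∀ it ∈ st.core l, ∀ q, it.est = some q → ∀ g,
    Agrees φ (st.pol l) (Cover P.lam (st.core l)) g →
      |q - MDP.detQ Q P.γ g it.st it.act| ≤ P.ω / 2
  greedy : ∀ l s, φ s ∈ Cover P.lam (st.core (l + 1)) → ∀ g,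
    Agrees φ (st.pol l) (Cover P.lam (st.core l)) g →
      MDP.detQ Q P.γ g s (st.pol l (φ s)) ≤ MDP.detQ Q P.γ g s (st.pol (l + 1) (φ s)) ∧
      ∀ a, MDP.detQ Q P.γ g s a ≤
        MDP.detQ Q P.γ g s (st.pol (l + 1) (φ s)) + 4 * P.width d
  out : ∀ l x, x ∉ Cover P.lam (st.core l) → st.pol l x = firstAction A

theorem Agrees.mono {φ : S → Row A d} {π : Row A d → A} {cov cov' : Set (Row A d)}
    (h : cov ⊆ cov') {g : {g : S → A // Measurable g}} (hg : Agrees φ π cov' g) :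
    Agrees φ π cov g := fun s hs => hg s (h hs)

variable {Q : Kernel (S × A) (S × I)} [IsMarkovKernel Q] {P : Params} {φ : S → Row A d}
  {st : PlanState S A d}

/-- Enlarging a cover shrinks the class of policies that agree on it, so claims about that class
persist. The appended item has no estimate, and level 0 is not the successor of a level in `greedy`.
-/
theorem Accurate.discover (hl : 0 < P.lam) (h : Accurate Q P φ st) (sel : Selector S A d) (s : S)
    (x : Row A d) : Accurate Q P φ (st.discover P sel s x) := by
  have hmono : ∀ l, Cover P.lam (st.core l) ⊆ Cover P.lam ((st.discover P sel s x).core l) :=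
    fun l => Cover_mono hl ((discover_prefix P sel st s x l).map _)
  refine ⟨h.meas, fun l it hit q hq g hg => ?_, fun l s' hs' g hg => ?_, fun l y hy => ?_⟩
  · rcases mem_discover hit with hit | ⟨hn, -⟩
    · exact h.est l it hit q hq g (hg.mono (hmono l))
    · rw [hn] at hq
      exact absurd hq (by simp)
  · rw [discover_core_of_ne P sel st s x (by omega)] at hs'
    exact h.greedy l s' hs' g (hg.mono (hmono l))
  · exact h.out l y fun hy' => hy (hmono l hy')

theorem Accurate.store (h : Accurate Q P φ st) {l m : ℕ} {it : Item S A d}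
    (hit : (st.core l)[m]? = some it) {q : ℝ}
    (hq : ∀ g, Agrees φ (st.pol l) (Cover P.lam (st.core l)) g →
      |q - MDP.detQ Q P.γ g it.st it.act| ≤ P.ω / 2) : Accurate Q P φ (st.store l m it q) := by
  have hcov : ∀ k, Cover P.lam ((st.store l m it q).core k) = Cover P.lam (st.core k) :=
    fun k => cover_eq_of_key_eq _ (store_keys st hit q k)
  refine ⟨h.meas, fun k jt hj r hr g hg => ?_, fun k s' hs' g hg => ?_, fun k y hy => ?_⟩
  · rw [hcov] at hg
    rcases mem_store hj with hj | ⟨rfl, rfl⟩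
    · exact h.est k jt hj r hr g hg
    · simp only [Option.some.injEq] at hr
      subst hr
      exact hq g hg
  · rw [hcov] at hg hs'
    exact h.greedy k s' hs' g hg
  · rw [hcov] at hy
    exact h.out k y hy

theorem improve_pol_of_ne (st : PlanState S A d) {l k : ℕ} (hk : k ≠ l + 1) :
    (st.improve P l).pol k = st.pol k := by
  simp [PlanState.improve, hk]

theorem improve_pol_of_mem (st : PlanState S A d) {l : ℕ} {x : Row A d}
    (hx : x ∈ Cover P.lam (st.core (l + 1))) :
    (st.improve P l).pol (l + 1) x = st.pol (l + 1) x := by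
  simp [PlanState.improve, hx]

theorem improve_pol_of_notMem (st : PlanState S A d) {l : ℕ} {x : Row A d}
    (hx : x ∉ Cover P.lam (st.core (l + 1))) :
    (st.improve P l).pol (l + 1) x = capiUpdate (P.width d) (lse P.lam (st.core l)) (st.pol l)
      (Cover P.lam (st.core l))ᶜ x := by
  simp [PlanState.improve, hx]

/-- Old states of `Cover(C_{l+1})` keep their action, hence their greediness; newly covered ones get
the confident update from accurate least squares. After copying, `C_{l+1}` has the cover of `C_l`.
-/
theorem Accurate.improve (hφ : ∀ a, Measurable (fun s => φ s a)) (hε : 0 ≤ P.ε) (hω : 0 < P.ω)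
    (hB : 0 < P.B) (hR : Realizable Q P φ) (h : Accurate Q P φ st) (hc : Coherent P φ st)
    {l : ℕ} (hlen : ((st.core l).length : ℝ) ≤ P.dTilde d)
    (hn : ∀ it ∈ st.core l, it.est ≠ none) : Accurate Q P φ (st.improve P l) := by
  have hl : 0 < P.lam := by unfold Params.lam; positivity
  have hmono : ∀ k, Cover P.lam (st.core k) ⊆ Cover P.lam ((st.improve P l).core k) :=
    fun k => Cover_mono hl ((improve_prefix st l k).map _)
  have hcov : Cover P.lam ((st.improve P l).core (l + 1)) = Cover P.lam (st.core l) :=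
    cover_eq_of_key_eq _ (improve_keys hl hc l)
  -- Agreement after the step implies agreement before it, because policies do not change on states
  -- that were already covered.
  have hag : ∀ k g, Agrees φ ((st.improve P l).pol k) (Cover P.lam ((st.improve P l).core k)) g →
      Agrees φ (st.pol k) (Cover P.lam (st.core k)) g := by
    intro k g hg s hs
    rw [hg s (hmono k hs)]
    rcases eq_or_ne k (l + 1) with rfl | hk
    · exact improve_pol_of_mem st hs
    · rw [improve_pol_of_ne st hk]
  refine ⟨fun k => ?_, fun k jt hj r hr g hg => ?_, fun k s hs g hg => ?_, fun k x hx => ?_⟩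
  · rcases eq_or_ne k (l + 1) with rfl | hk
    · simp only [PlanState.improve, Function.update_self]
      refine Measurable.ite (measurableSet_cover hφ _ _) (h.meas _) ?_
      exact measurable_capiUpdate _ (measurable_lse hφ _ _) (h.meas _)
        (measurableSet_cover hφ _ _).compl
    · rw [improve_pol_of_ne st hk]
      exact h.meas k
  · rcases mem_improve hj with hj | ⟨-, hj, -⟩
    · exact h.est k jt hj r hr g (hag k g hg)
    · rw [hj] at hr
      exact absurd hr (by simp)
  · have hg' := hag k g hg
    rcases eq_or_ne k l with rfl | hk
    · rw [improve_pol_of_ne st (k := k) (by omega)]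
      by_cases hs' : φ s ∈ Cover P.lam (st.core (k + 1))
      · rw [improve_pol_of_mem st hs']
        exact h.greedy k s hs' g hg'
      · rw [improve_pol_of_notMem st hs']
        rw [hcov] at hs
        refine capiUpdate_spec (not_not.2 hs) fun a => ?_
        refine abs_lse_sub_detQ_le Q hε hω hB hR g (hc.row k) hlen (fun it hit => ?_) hs a
        obtain ⟨q, hq⟩ := Option.ne_none_iff_exists'.1 (hn it hit)
        exact ⟨q, hq, h.est k it hit q hq g hg'⟩
    · rw [improve_core_of_ne P st (by omega)] at hs
      rw [improve_pol_of_ne st (k := k + 1) (by omega)]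
      have hpol : (st.improve P l).pol k (φ s) = st.pol k (φ s) := by
        rcases eq_or_ne k (l + 1) with rfl | hk1
        · exact improve_pol_of_mem st (Cover_mono hl (feat_prefix (hc.pre (l + 1))) hs)
        · rw [improve_pol_of_ne st hk1]
      rw [hpol]
      exact h.greedy k s hs g hg'
  · rcases eq_or_ne k (l + 1) with rfl | hk
    · rw [improve_pol_of_notMem st fun hx' => hx (hmono _ hx')]
      rw [hcov] at hx
      -- Off `Cover(C_l)` the update copies `π_l`, which is still the first action there.
      rw [capiUpdate, if_neg (fun hcon => hcon.1 hx)]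
      exact h.out l x hx
    · rw [improve_pol_of_ne st hk]
      exact h.out k x fun hx' => hx (hmono _ hx')

theorem Accurate.record (hφ : ∀ a, Measurable (fun s => φ s a)) (hε : 0 ≤ P.ε) (hω : 0 < P.ω)
    (hB : 0 < P.B) (hR : Realizable Q P φ) (h : Accurate Q P φ st) (hc : Coherent P φ st)
    {l m : ℕ} {it : Item S A d} (hlen : ((st.core l).length : ℝ) ≤ P.dTilde d)
    (hit : (st.core l)[m]? = some it) {q : ℝ}
    (hq : ∀ g, Agrees φ (st.pol l) (Cover P.lam (st.core l)) g →
      |q - MDP.detQ Q P.γ g it.st it.act| ≤ P.ω / 2) :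
    Accurate Q P φ (st.record P l m it q) := by
  rw [record_eq]
  split_ifs with hn
  · exact h.store hit hq
  · refine (h.store hit hq).improve hφ hε hω hB hR (hc.store hit q) ?_ ?_
    · have : ((st.store l m it q).core l).length = (st.core l).length := by
        simpa using congrArg List.length (store_keys st hit q l)
      rwa [this]
    · exact fun jt hj hjn => hn ⟨jt, hj, hjn⟩

end Accuracy

end Capi

namespace Capi

/-! ### Termination, query count and success probability of the main loop -/

section Loop

variable {S A : Type*} {d : ℕ} [Fintype A] [LinearOrder A] [Nonempty A]

theorem planLoop_of_uncovered (P : Params) (sel : Selector S A d) (s₀ : S) (x₀ : Row A d) (N : ℕ)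
    {st : PlanState S A d} (h : ∃ a, ¬ ActionCovered P.lam (st.core 0) x₀ a) :
    planLoop P sel s₀ x₀ (N + 1) st = planLoop P sel s₀ x₀ N (st.discover P sel s₀ x₀) := by
  rw [planLoop, if_pos h]

theorem planLoop_of_level_eq (P : Params) (sel : Selector S A d) (s₀ : S) (x₀ : Row A d) (N : ℕ)
    {st : PlanState S A d} (h : ¬ ∃ a, ¬ ActionCovered P.lam (st.core 0) x₀ a)
    (hl : st.level P.H = P.H) :
    planLoop P sel s₀ x₀ (N + 1) st = .ret (some (st.pol P.H)) := by
  rw [planLoop, if_neg h]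
  exact if_pos hl

theorem planLoop_of_measure (P : Params) (sel : Selector S A d) (s₀ : S) (x₀ : Row A d) (N : ℕ)
    {st : PlanState S A d} (h : ¬ ∃ a, ¬ ActionCovered P.lam (st.core 0) x₀ a)
    (hl : st.level P.H ≠ P.H) {it : Item S A d}
    (hit : (st.core (st.level P.H))[sel.index st (st.core (st.level P.H))]? = some it) :
    planLoop P sel s₀ x₀ (N + 1) st =
      (measure P it.st it.act (st.pol (st.level P.H)) (Cover P.lam (st.core (st.level P.H)))
        (P.δ / (P.dTilde d * P.H))).bind (fun o => match o with
          | .discover s x => planLoop P sel s₀ x₀ N (st.discover P sel s x)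
          | .success q => planLoop P sel s₀ x₀ N
              (st.record P (st.level P.H) (sel.index st (st.core (st.level P.H))) it q)) := by
  rw [planLoop, if_neg h]
  simp only [hl, if_false, hit]

/-- A bound on the number of iterations that are left, when core sets have at most `D` elements. -/
def remaining (D H : ℕ) (st : PlanState S A d) : ℕ :=
  (D - (st.core 0).length) + (H * D - estCount st H)

theorem remaining_discover {P : Params} {φ : S → Row A d} {D : ℕ}
    (hD : ∀ st : PlanState S A d, Inv P φ st → (st.core 0).length ≤ D) {st : PlanState S A d}
    (h : Inv P φ st) (sel : Selector S A d) {s : S}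
    (hx : ∃ a, ¬ ActionCovered P.lam (st.core 0) (φ s) a) (H : ℕ) :
    remaining D H (st.discover P sel s (φ s)) + 1 = remaining D H st := by
  have h1 := hD _ (h.discover sel hx)
  rw [discover_core_zero, List.length_append, List.length_singleton] at h1
  rw [remaining, remaining, estCount_discover, discover_core_zero, List.length_append,
    List.length_singleton]
  omega

theorem remaining_record {P : Params} (hl : 0 < P.lam) {φ : S → Row A d} {D : ℕ}
    (hD : ∀ st : PlanState S A d, Inv P φ st → (st.core 0).length ≤ D) {st : PlanState S A d}
    (h : Inv P φ st) {l m H : ℕ} {it : Item S A d} (hit : (st.core l)[m]? = some it)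
    (hn : it.est = none) (hlH : l < H) (q : ℝ) :
    remaining D H (st.record P l m it q) + 1 = remaining D H st := by
  have h1 := estCount_le (h.record hl hit q).toCoherent (hD _ (h.record hl hit q)) H
  rw [estCount_record P hit hn hlH] at h1
  rw [remaining, remaining, estCount_record P hit hn hlH, length_record]
  omega

/-- A state discovered at the active level can be appended to `C_0`, since both levels have the same
cover. -/
theorem exists_uncovered_zero {P : Params} {φ : S → Row A d} {st : PlanState S A d}
    (h : Inv P φ st) {x : Row A d} (hx : x ∉ Cover P.lam (st.core (st.level P.H))) :
    ∃ a, ¬ ActionCovered P.lam (st.core 0) x a := by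
  rw [cover_eq_of_key_eq P.lam (h.keys_eq_of_le_level (H := P.H) le_rfl)] at hx
  exact not_forall.1 hx

theorem index_level_spec (sel : Selector S A d) {st : PlanState S A d} {H : ℕ}
    (hl : st.level H ≠ H) : st.level H < H ∧ ∃ it,
      (st.core (st.level H))[sel.index st (st.core (st.level H))]? = some it ∧ it.est = none := by
  rcases level_spec st H with h | ⟨h1, h2⟩
  · exact absurd h hl
  · exact ⟨h1, sel.index_spec st _ h2⟩

/-- The planner halts, respects local access, and issues a bounded number of queries. -/
theorem safe_planLoop {P : Params} (hlam : 0 < P.lam) {φ : S → Row A d} {D : ℕ}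
    (hD : ∀ st : PlanState S A d, Inv P φ st → (st.core 0).length ≤ D) (sel : Selector S A d)
    (s₀ : S) (N : ℕ) (st : PlanState S A d) (hst : Inv P φ st) {K : Set S} (hs₀ : s₀ ∈ K)
    (hK : ∀ l, ∀ it ∈ st.core l, it.st ∈ K) (hN : remaining D P.H st < N) :
    (planLoop P sel s₀ (φ s₀) N st).Safe φ K
      (remaining D P.H st * (P.rollouts (P.δ / (P.dTilde d * P.H)) * P.H))
      (fun _ o => o ≠ none) := by
  induction N generalizing st K with
  | zero => omega
  | succ N ih =>
    by_cases h1 : ∃ a, ¬ ActionCovered P.lam (st.core 0) (φ s₀) a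
    · rw [planLoop_of_uncovered P sel s₀ (φ s₀) N h1]
      have hr := remaining_discover hD hst sel h1 P.H
      refine (ih _ (hst.discover sel h1) hs₀ (fun l it hit => ?_) (by omega)).mono
        (Nat.mul_le_mul_right _ (by omega)) fun _ _ _ h => h
      rcases mem_discover hit with hit | ⟨-, h2, -⟩
      · exact hK l it hit
      · rwa [h2]
    · by_cases h2 : st.level P.H = P.H
      · rw [planLoop_of_level_eq P sel s₀ (φ s₀) N h1 h2]
        simp [Prog.Safe]
      · obtain ⟨hlt, it, hit, hn⟩ := index_level_spec sel h2
        rw [planLoop_of_measure P sel s₀ (φ s₀) N h1 h2 hit]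
        have hr := remaining_record hlam hD hst hit hn hlt 0
        have hrem : remaining D P.H st = 1 + (remaining D P.H st - 1) := by omega
        rw [hrem, add_mul, one_mul]
        refine (safe_measure P (by omega) _ _ _ _ _
          (hK _ it (List.mem_of_getElem? hit))).bind fun K' o hKK ho => ?_
        cases o with
        | discover s x =>
          obtain ⟨hs, rfl, hx⟩ := ho
          have hx' := exists_uncovered_zero hst hx
          have hr2 := remaining_discover hD hst sel hx' P.H
          refine (ih _ (hst.discover sel hx') (hKK hs₀) (fun l jt hjt => ?_) (by omega)).mono
            (Nat.mul_le_mul_right _ (by omega)) fun _ _ _ h => h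
          rcases mem_discover hjt with hjt | ⟨-, h3, -⟩
          · exact hKK (hK l jt hjt)
          · rwa [h3]
        | success q =>
          have hr2 := remaining_record hlam hD hst hit hn hlt q
          refine (ih _ (hst.record hlam hit q) (hKK hs₀) (fun l jt hjt => ?_) (by omega)).mono
            (Nat.mul_le_mul_right _ (by omega)) fun _ _ _ h => h
          obtain ⟨k', it', h3, h4⟩ := mem_record hit hjt
          rw [h4]
          exact hKK (hK k' it' h3)

variable [MeasurableSpace S] [MeasurableSpace A] [DiscreteMeasurableSpace A]

/-- The union bound in the product form produced by sequential composition; truncation at 0 covers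
large `j`. -/
theorem ofReal_one_sub_mul_le {ζ : ℝ} (hζ : 0 ≤ ζ) (j : ℕ) :
    ENNReal.ofReal (1 - ζ * ((j + 1 : ℕ) : ℝ)) ≤
      ENNReal.ofReal (1 - ζ * j) * ENNReal.ofReal (1 - ζ) := by
  have hj : (0 : ℝ) ≤ j := Nat.cast_nonneg j
  push_cast
  by_cases h : 1 - ζ * (j + 1) ≤ 0
  · rw [ENNReal.ofReal_of_nonpos h]
    exact zero_le
  · have h1 : 0 ≤ ζ * j := by positivity
    rw [← ENNReal.ofReal_mul (by nlinarith)]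
    refine ENNReal.ofReal_le_ofReal ?_
    nlinarith [mul_nonneg h1 hζ]

/-- With high probability the planner halts in a state in which all measurements were accurate. -/
theorem prob_planLoop_ge {Q : Kernel (S × A) (S × I)} [IsMarkovKernel Q] {P : Params}
    {φ : S → Row A d} (hγ0 : 0 < P.γ) (hγ1 : P.γ < 1) (hφ : ∀ a, Measurable (fun s => φ s a))
    (hε : 0 ≤ P.ε) (hω : 0 < P.ω) (hB : 0 < P.B) (hδ0 : 0 < P.δ) (hδ1 : P.δ ≤ 1)
    (hR : Realizable Q P φ)
    (hD : ∀ st : PlanState S A d, Inv P φ st → (st.core 0).length ≤ ⌊P.dTilde d / 2⌋₊)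
    (sel : Selector S A d) (s₀ : S) (E : Set (Option (Row A d → A)))
    (hE : ∀ st : PlanState S A d, Inv P φ st → Accurate Q P φ st → st.level P.H = P.H →
      φ s₀ ∈ Cover P.lam (st.core 0) → some (st.pol P.H) ∈ E)
    (N : ℕ) (st : PlanState S A d) (hst : Inv P φ st) (hacc : Accurate Q P φ st)
    (hN : remaining ⌊P.dTilde d / 2⌋₊ P.H st < N) :
    ENNReal.ofReal (1 - P.δ / (P.dTilde d * P.H) * remaining ⌊P.dTilde d / 2⌋₊ P.H st) ≤
      (planLoop P sel s₀ (φ s₀) N st).prob Q φ E := by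
  have hlam : 0 < P.lam := by unfold Params.lam; positivity
  have hdT : 0 ≤ P.dTilde d := by
    unfold Params.dTilde
    have := Real.log_nonneg (show (1 : ℝ) ≤ 1 + 4 * P.L ^ 2 / P.lam by
      have : 0 ≤ 4 * P.L ^ 2 / P.lam := by positivity
      linarith)
    positivity
  set D := ⌊P.dTilde d / 2⌋₊ with hDdef
  set ζ := P.δ / (P.dTilde d * P.H) with hζdef
  have hζ0 : 0 ≤ ζ := by positivity
  induction N generalizing st with
  | zero => omega
  | succ N ih =>
    by_cases h1 : ∃ a, ¬ ActionCovered P.lam (st.core 0) (φ s₀) a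
    · rw [planLoop_of_uncovered P sel s₀ (φ s₀) N h1]
      have hr := remaining_discover hD hst sel h1 P.H
      refine le_trans (ENNReal.ofReal_le_ofReal ?_)
        (ih _ (hst.discover sel h1) (hacc.discover hlam sel _ _) (by omega))
      refine sub_le_sub_left (mul_le_mul_of_nonneg_left ?_ hζ0) _
      exact_mod_cast (by omega)
    · by_cases h2 : st.level P.H = P.H
      · rw [planLoop_of_level_eq P sel s₀ (φ s₀) N h1 h2]
        have hmem := hE st hst hacc h2 fun a => not_not.1 fun h => h1 ⟨a, h⟩
        simp only [Prog.prob, hmem, if_true]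
        rw [← ENNReal.ofReal_one]
        exact ENNReal.ofReal_le_ofReal (sub_le_self _ (by positivity))
      · obtain ⟨hlt, it, hit, hn⟩ := index_level_spec sel h2
        rw [planLoop_of_measure P sel s₀ (φ s₀) N h1 h2 hit]
        have hr := remaining_record hlam hD hst hit hn hlt 0
        obtain ⟨j, hj⟩ : ∃ j, remaining D P.H st = j + 1 := ⟨_, hr.symm⟩
        have hmem := List.mem_of_getElem? hit
        have hlen : (st.core (st.level P.H)).length ≤ D :=
          (hst.length_le _).trans (hD st hst)
        have hDle : (D : ℝ) ≤ P.dTilde d / 2 := Nat.floor_le (by positivity)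
        -- A measurement needs a core element, which forces `D ≥ 1` and so `d̃ ≥ 2`. The confidence
        -- parameter is then positive and below 2; if `d̃ H = 0` it is 0 by the division convention,
        -- but no measurement occurs.
        have hD1 : (1 : ℝ) ≤ D := by
          exact_mod_cast (List.length_pos_of_mem hmem).trans_le hlen
        have hH1 : (1 : ℝ) ≤ P.H := by exact_mod_cast (by omega)
        have hden : 2 ≤ P.dTilde d * P.H := by nlinarith
        have hζpos : 0 < ζ := by positivity
        have hζ2 : ζ < 2 := by
          rw [hζdef, div_lt_iff₀ (by linarith)]
          linarith
        obtain ⟨lo, hi, hprob, hgood⟩ := prob_measure_accurate Q P hγ0 hγ1 hω (by omega) φ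
          (hacc.meas (st.level P.H)) (measurableSet_cover hφ P.lam (st.core (st.level P.H)))
          it.st it.act hζpos hζ2
        rw [hj]
        refine (ofReal_one_sub_mul_le hζ0 j).trans ((mul_le_mul_right hprob _).trans
          (Prog.prob_bind_ge Q φ _ _ _ E fun o ho => ?_))
        cases o with
        | discover s x =>
          obtain ⟨rfl, hx⟩ := ho
          have hx' := exists_uncovered_zero hst hx
          have hr2 := remaining_discover hD hst sel hx' P.H
          have := ih _ (hst.discover sel hx') (hacc.discover hlam sel s (φ s)) (by omega)
          rwa [show remaining D P.H (st.discover P sel s (φ s)) = j by omega] at this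
        | success q =>
          have hr2 := remaining_record hlam hD hst hit hn hlt q
          have hlen' : ((st.core (st.level P.H)).length : ℝ) ≤ P.dTilde d := by
            have : ((st.core (st.level P.H)).length : ℝ) ≤ D := by exact_mod_cast hlen
            linarith
          have := ih _ (hst.record hlam hit q) (hacc.record hφ hε hω hB hR hst.toCoherent hlen' hit
            fun g hg => hgood q ho.1 ho.2 g hg) (by omega)
          rwa [show remaining D P.H _ = j by omega] at this

end Loop

end Capi

namespace Capi

/-! ### Spliced policies and the suboptimality bound -/

section Suboptimality

variable {S A : Type*} {d : ℕ} [Fintype A] [LinearOrder A] [Nonempty A]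
  [MeasurableSpace S] [MeasurableSpace A] [DiscreteMeasurableSpace A]

open Classical in
/-- The policy that follows `π` on the covered states and `g` elsewhere. -/
noncomputable def splice {φ : S → Row A d} {π : Row A d → A}
    (hπ : Measurable (fun s => π (φ s))) {cov : Set (Row A d)}
    (hcov : MeasurableSet {s | φ s ∈ cov}) (g : {g : S → A // Measurable g}) :
    {g : S → A // Measurable g} :=
  ⟨fun s => if φ s ∈ cov then π (φ s) else g.1 s, Measurable.ite hcov hπ g.2⟩

theorem splice_of_mem {φ : S → Row A d} {π : Row A d → A}
    (hπ : Measurable (fun s => π (φ s))) {cov : Set (Row A d)}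
    (hcov : MeasurableSet {s | φ s ∈ cov}) (g : {g : S → A // Measurable g}) {s : S}
    (hs : φ s ∈ cov) : (splice hπ hcov g).1 s = π (φ s) := if_pos hs

theorem splice_of_notMem {φ : S → Row A d} {π : Row A d → A}
    (hπ : Measurable (fun s => π (φ s))) {cov : Set (Row A d)}
    (hcov : MeasurableSet {s | φ s ∈ cov}) (g : {g : S → A // Measurable g}) {s : S}
    (hs : φ s ∉ cov) : (splice hπ hcov g).1 s = g.1 s := if_neg hs

theorem width_ge {P : Params} (hε : 0 ≤ P.ε) (hω : 0 < P.ω) (d : ℕ) : P.ω ≤ P.width d := by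
  rw [Params.width]
  have : 0 ≤ Real.sqrt (P.dTilde d) := Real.sqrt_nonneg _
  nlinarith [mul_nonneg hω.le this, mul_nonneg hε this]

variable {Q : Kernel (S × A) (S × I)} [IsMarkovKernel Q] {P : Params} {φ : S → Row A d}
  {st : PlanState S A d}

theorem cover_eq_of_level_eq (hst : Inv P φ st) (hlev : st.level P.H = P.H) {l : ℕ}
    (hl : l ≤ P.H) : Cover P.lam (st.core l) = Cover P.lam (st.core 0) :=
  cover_eq_of_key_eq _ (hst.keys_eq_of_le_level (H := P.H) (by omega))

/-- Approximate policy iteration on the spliced policies contracts towards any policy `g`. -/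
theorem detValue_le_splice (hγ0 : 0 < P.γ) (hγ1 : P.γ < 1) (hε : 0 ≤ P.ε) (hω : 0 < P.ω)
    (hst : Inv P φ st) (hacc : Accurate Q P φ st) (hlev : st.level P.H = P.H)
    (hcov : MeasurableSet {s | φ s ∈ Cover P.lam (st.core 0)})
    (g : {g : S → A // Measurable g}) {l : ℕ} (hl : l ≤ P.H) (s : S) :
    MDP.detValue Q P.γ g s ≤ MDP.detValue Q P.γ (splice (hacc.meas l) hcov g) s +
      (P.γ ^ l * (1 - P.γ)⁻¹ + 4 * P.width d * (1 - P.γ)⁻¹) := by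
  have hw : 0 ≤ P.width d := hω.le.trans (width_ge hε hω d)
  have hRpos : 0 < (1 - P.γ)⁻¹ := inv_pos.2 (by linarith)
  have hV := MDP.isVal_detValue Q hγ0.le hγ1 g
  have hv : ∀ l, MDP.IsVal P.γ (MDP.detValue Q P.γ (splice (hacc.meas l) hcov g)) := fun l =>
    MDP.isVal_detValue Q hγ0.le hγ1 _
  induction l generalizing s with
  | zero =>
    rw [pow_zero, one_mul]
    have := mul_nonneg (mul_nonneg zero_le_four hw) hRpos.le
    linarith [(hV.2 s).2, ((hv 0).2 s).1]
  | succ l ih =>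
    have hag : Agrees φ (st.pol l) (Cover P.lam (st.core l)) (splice (hacc.meas l) hcov g) := by
      intro s' hs'
      rw [cover_eq_of_level_eq hst hlev (by omega)] at hs'
      exact splice_of_mem _ _ _ hs'
    have hgreedy : ∀ s', φ s' ∈ Cover P.lam (st.core 0) → _ := fun s' hs' =>
      hacc.greedy l s' (by rwa [cover_eq_of_level_eq hst hlev hl]) _ hag
    -- Policy improvement: on the cover the update does not lower the action value, and off the
    -- cover both splices follow `g`.
    have hmono : ∀ s', MDP.detValue Q P.γ (splice (hacc.meas l) hcov g) s' ≤
        MDP.detValue Q P.γ (splice (hacc.meas (l + 1)) hcov g) s' := by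
      intro s'
      have := MDP.le_detValue_of_le_backup Q hγ0.le hγ1 (hv l) (splice (hacc.meas (l + 1)) hcov g)
        (c := 0) (fun t => by
          rw [add_zero, MDP.detValue_eq_backup Q hγ0.le hγ1]
          by_cases ht : φ t ∈ Cover P.lam (st.core 0)
          · rw [splice_of_mem _ _ _ ht, splice_of_mem _ _ _ ht, ← MDP.detQ_eq_backup Q hγ0.le hγ1,
              ← MDP.detQ_eq_backup Q hγ0.le hγ1]
            exact (hgreedy t ht).1
          · rw [splice_of_notMem _ _ _ ht, splice_of_notMem _ _ _ ht]) s'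
      linarith
    -- Near-greediness against `g` holds at every state: off the cover the spliced action is that of
    -- `g`.
    have h1 : MDP.backup Q P.γ (MDP.detValue Q P.γ (splice (hacc.meas l) hcov g)) s (g.1 s) ≤
        MDP.backup Q P.γ (MDP.detValue Q P.γ (splice (hacc.meas l) hcov g)) s
          ((splice (hacc.meas (l + 1)) hcov g).1 s) + 4 * P.width d := by
      by_cases hs : φ s ∈ Cover P.lam (st.core 0)
      · rw [splice_of_mem _ _ _ hs, ← MDP.detQ_eq_backup Q hγ0.le hγ1,
          ← MDP.detQ_eq_backup Q hγ0.le hγ1]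
        exact (hgreedy s hs).2 _
      · rw [splice_of_notMem _ _ _ hs]
        linarith
    have h2 := MDP.backup_le_backup_add Q hγ0.le hγ1 hV (hv l) (fun t => ih (by omega) t) s (g.1 s)
    have h3 := MDP.backup_mono Q hγ0.le hγ1 (hv l) (hv (l + 1)) hmono s
      ((splice (hacc.meas (l + 1)) hcov g).1 s)
    rw [MDP.detValue_eq_backup Q hγ0.le hγ1 g,
      MDP.detValue_eq_backup Q hγ0.le hγ1 (splice (hacc.meas (l + 1)) hcov g)]
    have h4 : P.γ * (P.γ ^ l * (1 - P.γ)⁻¹ + 4 * P.width d * (1 - P.γ)⁻¹) + 4 * P.width d =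
        P.γ ^ (l + 1) * (1 - P.γ)⁻¹ + 4 * P.width d * (1 + P.γ * (1 - P.γ)⁻¹) := by ring
    rw [MDP.one_add_mul_inv hγ1] at h4
    linarith

/-- The policy returned after accurate measurements is almost as good as any policy `g`. -/
theorem detValue_sub_le (hγ0 : 0 < P.γ) (hγ1 : P.γ < 1)
    (hφ : ∀ a, Measurable (fun s => φ s a)) (hε : 0 ≤ P.ε) (hω : 0 < P.ω) (hB : 0 < P.B)
    (hR : Realizable Q P φ) (hst : Inv P φ st) (hacc : Accurate Q P φ st)
    (hlev : st.level P.H = P.H) (hlen : ((st.core 0).length : ℝ) ≤ P.dTilde d) {s₀ : S}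
    (hs₀ : φ s₀ ∈ Cover P.lam (st.core 0)) (g : {g : S → A // Measurable g}) :
    MDP.detValue Q P.γ g s₀ ≤
      MDP.detValue Q P.γ ⟨_, hacc.meas P.H⟩ s₀ + 11 * (P.width d * (1 - P.γ)⁻¹) := by
  have hw := width_ge hε hω d
  have hRpos : 0 < (1 - P.γ)⁻¹ := inv_pos.2 (by linarith)
  have hR1 : 1 ≤ (1 - P.γ)⁻¹ := (one_le_inv₀ (by linarith)).2 (by linarith)
  have hwR : P.width d ≤ P.width d * (1 - P.γ)⁻¹ := le_mul_of_one_le_right (by linarith) hR1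
  have hpow := pow_H_le P hγ0 hγ1 hω
  have hV := MDP.isVal_detValue Q hγ0.le hγ1 g
  have hcov := measurableSet_cover hφ P.lam (st.core 0)
  rcases Nat.eq_zero_or_eq_succ_pred P.H with hH | hH
  -- With horizon 0 the whole value range `1/(1-γ)` is at most `ω/4`.
  · rw [hH, pow_zero, one_mul] at hpow
    have := MDP.isVal_detValue Q hγ0.le hγ1 ⟨_, hacc.meas P.H⟩
    linarith [(hV.2 s₀).2, (this.2 s₀).1]
  · obtain ⟨h, hh⟩ : ∃ h, P.H = h + 1 := ⟨_, hH⟩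
    let spl := splice (hacc.meas h) hcov g
    let p : {g : S → A // Measurable g} := ⟨_, hacc.meas h⟩
    let p' : {g : S → A // Measurable g} := ⟨_, hacc.meas P.H⟩
    have hcovh : Cover P.lam (st.core h) = Cover P.lam (st.core 0) :=
      cover_eq_of_level_eq hst hlev (by omega)
    have hcovH : Cover P.lam (st.core (h + 1)) = Cover P.lam (st.core 0) :=
      cover_eq_of_level_eq hst hlev (by omega)
    have hagspl : Agrees φ (st.pol h) (Cover P.lam (st.core h)) spl := by
      intro s' hs'
      rw [hcovh] at hs'
      exact splice_of_mem _ _ _ hs'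
    have hagp : Agrees φ (st.pol h) (Cover P.lam (st.core h)) p := fun _ _ => rfl
    have hvp := MDP.isVal_detValue Q hγ0.le hγ1 p
    have hvp' := MDP.isVal_detValue Q hγ0.le hγ1 p'
    have hvspl := MDP.isVal_detValue Q hγ0.le hγ1 spl
    have hpol : p'.1 = fun s => st.pol (h + 1) (φ s) := by
      simp only [p', hh]
    -- Improvement for the unspliced policies. Off the cover it needs that both levels play the
    -- first action.
    have hmono : ∀ s, MDP.detValue Q P.γ p s ≤ MDP.detValue Q P.γ p' s := by
      intro s
      have := MDP.le_detValue_of_le_backup Q hγ0.le hγ1 hvp p' (c := 0) (fun t => by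
        rw [add_zero, MDP.detValue_eq_backup Q hγ0.le hγ1, hpol]
        by_cases ht : φ t ∈ Cover P.lam (st.core 0)
        · rw [← MDP.detQ_eq_backup Q hγ0.le hγ1, ← MDP.detQ_eq_backup Q hγ0.le hγ1]
          exact (hacc.greedy h t (by rwa [hcovH]) p hagp).1
        · have e1 := hacc.out h (φ t) (by rwa [hcovh])
          have e2 := hacc.out (h + 1) (φ t) (by rwa [hcovH])
          simp only [p, e1, e2, le_refl]) s
      linarith
    -- One least-squares value serves every agreeing policy, so at `s₀` the action values of `π_h`
    -- and of its splice differ by at most two widths.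
    have hlse : ∀ g', Agrees φ (st.pol h) (Cover P.lam (st.core h)) g' → ∀ a,
        |lse P.lam (st.core h) (φ s₀) a - MDP.detQ Q P.γ g' s₀ a| ≤ P.width d := by
      intro g' hg' a
      refine abs_lse_sub_detQ_le Q hε hω hB hR g' (hst.row h) ?_ (fun it hit => ?_)
        (by rwa [hcovh]) a
      · exact le_trans (by exact_mod_cast hst.length_le h) hlen
      · obtain ⟨q, hq⟩ := Option.ne_none_iff_exists'.1
          (est_ne_none_of_lt_level (H := P.H) (k := h) (by omega) it hit)
        exact ⟨q, hq, hacc.est h it hit q hq g' hg'⟩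
    have e1 := MDP.backup_mono Q hγ0.le hγ1 hvp hvp' hmono s₀ (p'.1 s₀)
    rw [← MDP.detValue_eq_backup Q hγ0.le hγ1, ← MDP.detQ_eq_backup Q hγ0.le hγ1] at e1
    have e2 := (abs_le.1 (hlse p hagp (p'.1 s₀))).2
    have e3 := (abs_le.1 (hlse spl hagspl (p'.1 s₀))).1
    have e4 := (hacc.greedy h s₀ (by rwa [hcovH]) spl hagspl).2 (g.1 s₀)
    have e5 := MDP.backup_le_backup_add Q hγ0.le hγ1 hV hvspl (fun t =>
      detValue_le_splice hγ0 hγ1 hε hω hst hacc hlev hcov g (l := h) (by omega) t) s₀ (g.1 s₀)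
    rw [← MDP.detValue_eq_backup Q hγ0.le hγ1, ← MDP.detQ_eq_backup Q hγ0.le hγ1] at e5
    have e6 : p'.1 s₀ = st.pol (h + 1) (φ s₀) := by rw [hpol]
    rw [← e6] at e4
    rw [hh, pow_succ'] at hpow
    -- Total loss: two widths for the transfer, four for greediness, `ω/4` for the horizon and `4 ·
    -- width/(1-γ)` from the contraction, below 11 of the last unit.
    have e7 : P.γ * (P.γ ^ h * (1 - P.γ)⁻¹ + 4 * P.width d * (1 - P.γ)⁻¹) ≤
        P.ω / 4 + 4 * (P.width d * (1 - P.γ)⁻¹) := by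
      have h5 : P.γ * (4 * (P.width d * (1 - P.γ)⁻¹)) ≤ 4 * (P.width d * (1 - P.γ)⁻¹) :=
        mul_le_of_le_one_left (by linarith) hγ1.le
      calc _ = P.γ * P.γ ^ h * (1 - P.γ)⁻¹ + P.γ * (4 * (P.width d * (1 - P.γ)⁻¹)) := by ring
        _ ≤ _ := add_le_add hpow h5
    change MDP.detValue Q P.γ g s₀ ≤ MDP.detValue Q P.γ p' s₀ + _
    linarith

theorem approxError_nonneg (Q : Kernel (S × A) (S × I)) [IsMarkovKernel Q] (γ : ℝ)
    (φ : S → Row A d) (B : ℝ) : 0 ≤ MDP.approxError Q γ φ B :=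
  Real.iSup_nonneg fun _ => Real.iInf_nonneg fun _ => Real.iSup_nonneg fun _ => abs_nonneg _

/-- Conditionally complete suprema carry information only for bounded families. The outer family is
bounded by testing `θ = 0`, the inner ones by Cauchy-Schwarz. -/
theorem realizable_of_approxError_le (hγ0 : 0 < P.γ) (hγ1 : P.γ < 1)
    (hL : ∀ s a, ‖φ s a‖ ≤ P.L) (hB : 0 < P.B)
    (h : MDP.approxError Q P.γ φ P.B ≤ P.ε) : Realizable Q P φ := by
  intro g η hη
  have hRpos : 0 < (1 - P.γ)⁻¹ := inv_pos.2 (by linarith)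
  have habs : ∀ (g : {g : S → A // Measurable g}) s a,
      |MDP.detQ Q P.γ g s a| ≤ (1 - P.γ)⁻¹ := fun g s a => by
    rw [MDP.detQ, abs_of_nonneg (MDP.qValue_nonneg Q hγ0.le _ s a)]
    exact MDP.qValue_le Q hγ0.le hγ1 _ s a
  have hbd : ∀ (g : {g : S → A // Measurable g})
      (θ : {θ : EuclideanSpace ℝ (Fin d) // ‖θ‖ ≤ P.B}),
      BddAbove (Set.range fun x : S × A => |MDP.detQ Q P.γ g x.1 x.2 - inner ℝ (φ x.1 x.2) θ.1|) := by
    intro g θ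
    refine ⟨(1 - P.γ)⁻¹ + P.L * P.B, ?_⟩
    rintro _ ⟨x, rfl⟩
    refine (abs_sub _ _).trans (add_le_add (habs g _ _) ?_)
    exact (abs_real_inner_le_norm _ _).trans (mul_le_mul (hL _ _) θ.2 (norm_nonneg _)
      ((norm_nonneg _).trans (hL x.1 x.2)))
  let zero : {θ : EuclideanSpace ℝ (Fin d) // ‖θ‖ ≤ P.B} := ⟨0, by simpa using hB.le⟩
  have : Nonempty {θ : EuclideanSpace ℝ (Fin d) // ‖θ‖ ≤ P.B} := ⟨zero⟩
  have hle : (⨅ θ : {θ : EuclideanSpace ℝ (Fin d) // ‖θ‖ ≤ P.B},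
      ⨆ x : S × A, |MDP.detQ Q P.γ g x.1 x.2 - inner ℝ (φ x.1 x.2) θ.1|) ≤ P.ε := by
    refine le_trans (le_ciSup (f := fun g : {g : S → A // Measurable g} =>
      ⨅ θ : {θ : EuclideanSpace ℝ (Fin d) // ‖θ‖ ≤ P.B},
        ⨆ x : S × A, |MDP.detQ Q P.γ g x.1 x.2 - inner ℝ (φ x.1 x.2) θ.1|) ?_ g) h
    refine ⟨(1 - P.γ)⁻¹, ?_⟩
    rintro _ ⟨g', rfl⟩
    refine (ciInf_le ⟨0, ?_⟩ zero).trans ?_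
    · rintro _ ⟨θ, rfl⟩
      exact Real.iSup_nonneg fun _ => abs_nonneg _
    · refine Real.iSup_le (fun x => ?_) hRpos.le
      simpa [zero] using habs g' x.1 x.2
  obtain ⟨θ, hθ⟩ := exists_lt_of_ciInf_lt (hle.trans_lt (lt_add_of_pos_right P.ε hη))
  exact ⟨θ.1, θ.2, fun s a => (le_ciSup (hbd g θ) (s, a)).trans hθ.le⟩

end Suboptimality

end Capi

namespace Capi

/-! ### Numerical bounds on the parameters and the number of queries -/

section Bounds

variable {P : Params}

theorem four_mul_sq_div_lam (hω : 0 < P.ω) (hB : 0 < P.B) :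
    4 * P.L ^ 2 / P.lam = 4 * (P.L * P.B / P.ω) ^ 2 := by
  rw [Params.lam]
  field_simp

theorem dTilde_nonneg (hω : 0 < P.ω) (hB : 0 < P.B) (d : ℕ) : 0 ≤ P.dTilde d := by
  rw [Params.dTilde, four_mul_sq_div_lam hω hB]
  have := Real.log_nonneg (show (1 : ℝ) ≤ 1 + 4 * (P.L * P.B / P.ω) ^ 2 by
    have : 0 ≤ 4 * (P.L * P.B / P.ω) ^ 2 := by positivity
    linarith)
  positivity

theorem dTilde_le (hω : 0 < P.ω) (hB : 0 < P.B) (hL : 0 ≤ P.L) (d : ℕ) :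
    P.dTilde d ≤ 16 * d * Real.log (2 + P.L * P.B / P.ω) := by
  have hx : 0 ≤ P.L * P.B / P.ω := by positivity
  rw [Params.dTilde, four_mul_sq_div_lam hω hB]
  set x := P.L * P.B / P.ω
  have h : Real.log (1 + 4 * x ^ 2) ≤ 4 * Real.log (2 + x) := by
    have : (4 : ℝ) * Real.log (2 + x) = Real.log ((2 + x) ^ 4) := by
      rw [Real.log_pow]
      norm_num
    rw [this]
    refine Real.log_le_log (by positivity) ?_
    nlinarith [pow_nonneg hx 3, pow_nonneg hx 4, sq_nonneg x]
  have := mul_le_mul_of_nonneg_left h (show (0 : ℝ) ≤ 4 * d by positivity)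
  linarith

/-- A smaller power of the logarithm would do for large arguments; the fourth matches the query
bound. The logarithm is at least `log 2`, so raising the power costs only a constant. -/
theorem width_le (hω : 0 < P.ω) (hB : 0 < P.B) (hL : 0 ≤ P.L) (hε : 0 ≤ P.ε) {d : ℕ}
    (hd : 0 < d) : P.width d ≤
      40 * ((P.ε + P.ω) * Real.sqrt d) * Real.log (2 + P.L * P.B / P.ω) ^ 4 := by
  have hx : 0 ≤ P.L * P.B / P.ω := by positivity
  have h1 := Real.sqrt_le_sqrt (dTilde_le hω hB hL d)
  have hlog : Real.log 2 ≤ Real.log (2 + P.L * P.B / P.ω) :=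
    Real.log_le_log (by norm_num) (by linarith)
  set y := Real.log (2 + P.L * P.B / P.ω)
  have hy : (0.69 : ℝ) ≤ y := by linarith [Real.log_two_gt_d9]
  have hsqrt : Real.sqrt (16 * d * y) = 4 * (Real.sqrt d * Real.sqrt y) := by
    rw [mul_assoc, Real.sqrt_mul (by norm_num), Real.sqrt_mul (by positivity),
      show (16 : ℝ) = 4 ^ 2 by norm_num, Real.sqrt_sq (by norm_num)]
  have hsy : Real.sqrt y ≤ 1 + y := by
    rw [Real.sqrt_le_left (by linarith)]
    nlinarith
  have hd1 : 1 ≤ Real.sqrt d := by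
    rw [Real.one_le_sqrt]
    exact_mod_cast hd
  have hy3 : (2 : ℝ) / 7 ≤ y ^ 3 := by
    have := pow_le_pow_left₀ (by norm_num) hy 3
    norm_num at this ⊢
    linarith
  have hy4 : (1 : ℝ) / 5 ≤ y ^ 4 := by
    have := pow_le_pow_left₀ (by norm_num) hy 4
    norm_num at this ⊢
    linarith
  have hyy : y ≤ 7 / 2 * y ^ 4 := by nlinarith
  rw [hsqrt] at h1
  have h2 : Real.sqrt (P.dTilde d) + 1 ≤ Real.sqrt d * (40 * y ^ 4) := by
    have h3 : Real.sqrt d * Real.sqrt y ≤ Real.sqrt d * (1 + y) :=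
      mul_le_mul_of_nonneg_left hsy (by linarith)
    have h4 : Real.sqrt d * (4 * (1 + y) + 1) ≤ Real.sqrt d * (40 * y ^ 4) :=
      mul_le_mul_of_nonneg_left (by linarith) (by linarith)
    linarith
  rw [Params.width]
  have := mul_le_mul_of_nonneg_left h2 (show 0 ≤ P.ω + P.ε by linarith)
  linarith

theorem mul_le_pow_add {T a b : ℝ} {i j : ℕ} (hT : 0 ≤ T) (hb : 0 ≤ b) (h1 : a ≤ T ^ i)
    (h2 : b ≤ T ^ j) : a * b ≤ T ^ (i + j) := by
  rw [pow_add]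
  exact mul_le_mul h1 h2 hb (pow_nonneg hT i)

/-- The quantity inside the logarithm of the query bound. -/
noncomputable def logArg (P : Params) (d : ℕ) : ℝ :=
  2 + d + P.L * P.B / P.ω + 1 / P.ω + 1 / (1 - P.γ) + 1 / P.δ

theorem logArg_bounds (hγ0 : 0 < P.γ) (hγ1 : P.γ < 1) (hω : 0 < P.ω) (hB : 0 < P.B)
    (hL : 0 ≤ P.L) (hδ0 : 0 < P.δ) (hδ1 : P.δ ≤ 1) {d : ℕ} (hd : 0 < d) :
    5 ≤ logArg P d ∧ (d : ℝ) ≤ logArg P d ∧ 2 + P.L * P.B / P.ω ≤ logArg P d ∧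
      1 / P.ω ≤ logArg P d ∧ 1 / (1 - P.γ) ≤ logArg P d ∧ 1 / P.δ ≤ logArg P d ∧
      1 ≤ Real.log (logArg P d) ∧ Real.log (logArg P d) ≤ logArg P d := by
  have hγ : 0 < 1 - P.γ := by linarith
  have hx : 0 ≤ P.L * P.B / P.ω := by positivity
  have hd1 : (1 : ℝ) ≤ d := by exact_mod_cast hd
  have hr1 : 1 ≤ 1 / (1 - P.γ) := (one_le_div hγ).2 (by linarith)
  have hδ' : 1 ≤ 1 / P.δ := (one_le_div hδ0).2 hδ1
  have hω' : 0 < 1 / P.ω := by positivity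
  have hT5 : 5 ≤ logArg P d := by
    unfold logArg
    linarith
  refine ⟨hT5, ?_, ?_, ?_, ?_, ?_, ?_, ?_⟩
  any_goals
    unfold logArg
    linarith
  · rw [Real.le_log_iff_exp_le (by linarith)]
    linarith [Real.exp_one_lt_d9]
  · linarith [Real.log_le_sub_one_of_pos (show 0 < logArg P d by linarith)]

theorem scale_lt_one_of_H_pos (hγ0 : 0 < P.γ) (hγ1 : P.γ < 1) (hω : 0 < P.ω) (hH : 0 < P.H) :
    (P.ω / 4) * (1 - P.γ) < 1 := by
  have hγ : 0 < 1 - P.γ := by linarith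
  have hlogγ : Real.log P.γ < 0 := Real.log_neg hγ0 hγ1
  have hquot : 0 < Real.log ((P.ω / 4) * (1 - P.γ)) / Real.log P.γ := Nat.ceil_pos.1 hH
  rw [← Real.log_neg_iff (by positivity)]
  by_contra hcon
  exact absurd hquot (not_lt.2 (div_nonpos_of_nonneg_of_nonpos (not_lt.1 hcon) hlogγ.le))

theorem inv_scale (hγ1 : P.γ < 1) (hω : 0 < P.ω) :
    ((P.ω / 4) * (1 - P.γ))⁻¹ = 4 * (1 / P.ω) * (1 / (1 - P.γ)) := by
  have hγ : 0 < 1 - P.γ := by linarith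
  field_simp

/-- The numerator contributes `log (4/(ω(1-γ))) ≤ 4 log T`, the denominator satisfies `-log γ ≥ 1 -
γ`, and the ceiling adds the fifth unit. -/
theorem H_le (hγ0 : 0 < P.γ) (hγ1 : P.γ < 1) (hω : 0 < P.ω) (hH : 0 < P.H) {T : ℝ} (hT5 : 5 ≤ T)
    (hTω : 1 / P.ω ≤ T) (hTγ : 1 / (1 - P.γ) ≤ T) (hy1 : 1 ≤ Real.log T) :
    (P.H : ℝ) ≤ 5 * Real.log T * (1 / (1 - P.γ)) := by
  have hγ : 0 < 1 - P.γ := by linarith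
  have hr1 : 1 ≤ 1 / (1 - P.γ) := (one_le_div hγ).2 (by linarith)
  have hω' : 0 < 1 / P.ω := by positivity
  have hquot : 0 < Real.log ((P.ω / 4) * (1 - P.γ)) / Real.log P.γ := Nat.ceil_pos.1 hH
  have hneg : -Real.log ((P.ω / 4) * (1 - P.γ)) ≤ 4 * Real.log T := by
    rw [← Real.log_inv, inv_scale hγ1 hω]
    have e : 4 * Real.log T = Real.log (T ^ 4) := by
      rw [Real.log_pow]
      norm_num
    rw [e]
    refine Real.log_le_log (by positivity) ?_
    have h1 := mul_le_pow_add (T := T) (i := 2) (j := 1) (by linarith) hω'.le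
      (show (4 : ℝ) ≤ T ^ 2 by nlinarith) (show 1 / P.ω ≤ T ^ 1 by linarith)
    exact mul_le_pow_add (i := 3) (j := 1) (by linarith) (by linarith) h1 (by linarith)
  have h1 : (P.H : ℝ) < Real.log ((P.ω / 4) * (1 - P.γ)) / Real.log P.γ + 1 :=
    Nat.ceil_lt_add_one hquot.le
  have h2 : Real.log ((P.ω / 4) * (1 - P.γ)) / Real.log P.γ ≤
      4 * Real.log T * (1 / (1 - P.γ)) := by
    rw [← neg_div_neg_eq, mul_one_div]
    refine div_le_div₀ (by positivity) hneg hγ ?_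
    linarith [Real.log_le_sub_one_of_pos hγ0]
  have h3 : 1 ≤ Real.log T * (1 / (1 - P.γ)) := one_le_mul_of_one_le_of_one_le hy1 hr1
  linarith

/-- Bounds `2/ζ = 2 d̃ H/δ` by a power of `T`, so its logarithm is of order `log T`. -/
theorem log_inv_confidence_le {T y d' r e a b : ℝ} (hT5 : 5 ≤ T) (hy1 : 1 ≤ y) (hyT : y ≤ T)
    (hd0 : 0 ≤ d') (hd : d' ≤ T) (hr0 : 0 ≤ r) (hr : r ≤ T) (he0 : 0 ≤ e) (he : e ≤ T)
    (hb0 : 0 ≤ b) (ha : a ≤ 16 * d' * y) (hb : b ≤ 5 * y * r) : 2 * (a * b) * e ≤ T ^ 9 := by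
  have hT0 : 0 ≤ T := by linarith
  refine mul_le_pow_add (i := 8) (j := 1) hT0 he0 ?_ (by linarith)
  have h2 : a * b ≤ (16 * d' * y) * (5 * y * r) := mul_le_mul ha hb hb0 (by positivity)
  have h3 : (160 : ℝ) ≤ T ^ 4 := by
    have := pow_le_pow_left₀ (by norm_num) hT5 4
    norm_num at this ⊢
    linarith
  have h4 := mul_le_pow_add (j := 1) hT0 hd0 h3 (by rwa [pow_one])
  have h5 := mul_le_pow_add (j := 1) hT0 (by linarith) h4 (show y ≤ T ^ 1 by rwa [pow_one])
  have h6 := mul_le_pow_add (j := 1) hT0 (by linarith) h5 (show y ≤ T ^ 1 by rwa [pow_one])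
  have h7 := mul_le_pow_add (j := 1) hT0 hr0 h6 (by rwa [pow_one])
  calc 2 * (a * b) ≤ 2 * ((16 * d' * y) * (5 * y * r)) := by linarith
    _ = 160 * d' * y * y * r := by ring
    _ ≤ T ^ 8 := h7

/-- The scale condition keeps the main term at least 1, so it absorbs the ceiling: `88 = 16 · 9/2 +
16`. -/
theorem rollouts_le (hγ1 : P.γ < 1) (hω : 0 < P.ω) (hscale : (P.ω / 4) * (1 - P.γ) < 1)
    {ζ y : ℝ} (hζ0 : 0 < ζ) (hζ : ζ ≤ 2) (hy1 : 1 ≤ y) (hlog : Real.log (2 / ζ) ≤ 9 * y) :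
    (P.rollouts ζ : ℝ) ≤ 88 * ((P.ω ^ 2)⁻¹ * (1 / (1 - P.γ)) ^ 2) * y := by
  have hγ : 0 < 1 - P.γ := by linarith
  have h2 : ((P.ω / 4) ^ 2)⁻¹ * ((1 - P.γ) ^ 2)⁻¹ =
      16 * ((P.ω ^ 2)⁻¹ * (1 / (1 - P.γ)) ^ 2) := by
    field_simp
    ring
  have hbase : 1 ≤ 16 * ((P.ω ^ 2)⁻¹ * (1 / (1 - P.γ)) ^ 2) := by
    rw [← h2, ← mul_inv, ← mul_pow]
    exact (one_le_inv₀ (by positivity)).2 (pow_le_one₀ (by positivity) hscale.le)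
  have hlog0 : 0 ≤ Real.log (2 / ζ) := Real.log_nonneg ((one_le_div hζ0).2 hζ)
  have h1 : (P.rollouts ζ : ℝ) ≤ _ := (Nat.ceil_lt_add_one (R := ℝ)
    (show 0 ≤ ((P.ω / 4) ^ 2)⁻¹ * ((1 - P.γ) ^ 2)⁻¹ * Real.log (2 / ζ) / 2 by positivity)).le
  rw [h2] at h1
  set c := (P.ω ^ 2)⁻¹ * (1 / (1 - P.γ)) ^ 2
  have h3 := mul_le_mul_of_nonneg_left hlog (show 0 ≤ 16 * c by linarith)
  have h4 : 1 ≤ 16 * c * y := one_le_mul_of_one_le_of_one_le hbase hy1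
  linarith

theorem queries_le (hγ0 : 0 < P.γ) (hγ1 : P.γ < 1) (hω : 0 < P.ω) (hB : 0 < P.B) (hL : 0 ≤ P.L)
    (hδ0 : 0 < P.δ) (hδ1 : P.δ ≤ 1) {d : ℕ} (hd : 0 < d) {D : ℕ}
    (hD : (D : ℝ) ≤ P.dTilde d / 2) :
    (((D + P.H * D) * (P.rollouts (P.δ / (P.dTilde d * P.H)) * P.H) : ℕ) : ℝ) ≤
      40000 * (d * ((1 - P.γ) ^ 4)⁻¹ * (P.ω ^ 2)⁻¹) * Real.log (logArg P d) ^ 4 := by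
  have hγ : 0 < 1 - P.γ := by linarith
  obtain ⟨hT5, hTd, hTx, hTω, hTγ, hTδ, hy1, hyT⟩ := logArg_bounds hγ0 hγ1 hω hB hL hδ0 hδ1 hd
  have hx : 0 ≤ P.L * P.B / P.ω := by positivity
  have hdT' : P.dTilde d ≤ 16 * d * Real.log (logArg P d) :=
    (dTilde_le hω hB hL d).trans (mul_le_mul_of_nonneg_left
      (Real.log_le_log (by positivity) hTx) (by positivity))
  have hr0 : 0 < 1 / (1 - P.γ) := by positivity
  have hpow4 : ((1 - P.γ) ^ 4)⁻¹ = (1 / (1 - P.γ)) ^ 4 := by rw [one_div, inv_pow]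
  have hHle := fun hH => H_le hγ0 hγ1 hω hH hT5 hTω hTγ hy1
  rw [hpow4]
  have hrhs : 0 ≤ 40000 * (d * (1 / (1 - P.γ)) ^ 4 * (P.ω ^ 2)⁻¹) *
    Real.log (logArg P d) ^ 4 := by positivity
  rcases Nat.eq_zero_or_pos P.H with hH | hH
  · simpa [hH] using hrhs
  rcases Nat.eq_zero_or_pos D with hD0 | hDpos
  · simpa [hD0] using hrhs
  replace hHle := hHle hH
  have hH1 : (1 : ℝ) ≤ P.H := by exact_mod_cast hH
  have hD1 : (1 : ℝ) ≤ D := by exact_mod_cast hDpos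
  have hden : 2 ≤ P.dTilde d * P.H := by nlinarith
  have hn := rollouts_le (ζ := P.δ / (P.dTilde d * P.H)) hγ1 hω
    (scale_lt_one_of_H_pos hγ0 hγ1 hω hH) (by positivity)
    (by rw [div_le_iff₀ (by linarith)]; linarith) hy1 (by
      have e : 9 * Real.log (logArg P d) = Real.log (logArg P d ^ 9) := by
        rw [Real.log_pow]
        norm_num
      rw [e]
      refine Real.log_le_log (by positivity) ?_
      have h1 : 2 / (P.δ / (P.dTilde d * P.H)) = 2 * (P.dTilde d * P.H) * (1 / P.δ) := by
        rw [div_div_eq_mul_div, mul_one_div]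
      rw [h1]
      exact log_inv_confidence_le hT5 hy1 hyT (by positivity) hTd hr0.le hTγ (by positivity) hTδ
        (by positivity) hdT' hHle)
  generalize Real.log (logArg P d) = y at *
  generalize 1 / (1 - P.γ) = r at *
  have hDle : (D : ℝ) ≤ 8 * d * y := by linarith
  -- One logarithm comes from each of `D`, the rollout count and the two factors `H`; the exponent
  -- of `1/(1-γ)` is 2 from the horizons plus 2 from the rollouts.
  have hcount : (D + P.H * D : ℝ) ≤ 2 * (5 * y * r) * (8 * d * y) := by
    have h1 : (D : ℝ) ≤ P.H * D := le_mul_of_one_le_left (by linarith) hH1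
    have h2 : (P.H * D : ℝ) ≤ (5 * y * r) * (8 * d * y) :=
      mul_le_mul hHle hDle (by linarith) (by positivity)
    linarith
  push_cast
  calc _ ≤ (2 * (5 * y * r) * (8 * d * y)) * ((88 * ((P.ω ^ 2)⁻¹ * r ^ 2) * y) * (5 * y * r)) :=
        mul_le_mul hcount (mul_le_mul hn hHle (by linarith) (by positivity)) (by positivity)
          (by positivity)
    _ = 35200 * (d * r ^ 4 * (P.ω ^ 2)⁻¹ * y ^ 4) := by ring
    _ ≤ 40000 * (d * r ^ 4 * (P.ω ^ 2)⁻¹ * y ^ 4) :=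
        mul_le_mul_of_nonneg_right (by norm_num) (by positivity)
    _ = _ := by ring

end Bounds

/-! ### The invariants at the start -/

section Initial

variable {S A : Type*} {d : ℕ}

theorem inv_initial (P : Params) (φ : S → Row A d) (pol : ℕ → Row A d → A) :
    Inv P φ ⟨fun _ => [], pol⟩ where
  row := by simp
  spread := by
    intro G v hG
    simp at hG
  pre := by simp
  sync := by
    intro l _
    rfl

variable [Fintype A] [LinearOrder A] [Nonempty A] [MeasurableSpace S] [MeasurableSpace A]
  [DiscreteMeasurableSpace A]

/-- The empty core set may cover states with small features. There the least-squares estimate is 0,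
so all action values are within one width of 0 and any action is nearly greedy. -/
theorem accurate_initial {Q : Kernel (S × A) (S × I)} [IsMarkovKernel Q] {P : Params}
    {φ : S → Row A d} (hε : 0 ≤ P.ε) (hω : 0 < P.ω) (hB : 0 < P.B) (hR : Realizable Q P φ) :
    Accurate Q P φ ⟨fun _ => [], fun _ _ => firstAction A⟩ where
  meas := fun _ => measurable_const
  est := by simp
  greedy := by
    intro l s hs g _
    have h := abs_lse_sub_detQ_le Q hε hω hB hR g (C := []) (by simp)
      (by simpa using dTilde_nonneg hω hB d) (by simp) hs
    have h0 : ∀ a, lse P.lam ([] : List (Item S A d)) (φ s) a = 0 := fun a => by simp [lse]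
    refine ⟨le_rfl, fun a => ?_⟩
    have h1 := h a
    have h2 := h (firstAction A)
    rw [h0, abs_le] at h1 h2
    simp only
    linarith [h1.1, h2.2, hω.le.trans (width_ge hε hω d)]
  out := fun _ _ _ => rfl

end Initial

end Capi

/-! ### Assembly -/

theorem theorem1 :
    ∃ (K : ℝ) (k : ℕ), 0 < K ∧
      ∀ (S A : Type*) [MeasurableSpace S] [Fintype A] [LinearOrder A] [Nonempty A]
        [MeasurableSpace A] [DiscreteMeasurableSpace A]
        (Q : Kernel (S × A) (S × I)) [IsMarkovKernel Q]
        (d : ℕ) (φ : S → A → EuclideanSpace ℝ (Fin d))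
        (γ ω ε δ L B : ℝ) (sel : Capi.Selector S A d) (s₀ : S),
        0 < d → (∀ a, Measurable (fun s => φ s a)) → (∀ s a, ‖φ s a‖ ≤ L) →
        0 < γ → γ < 1 → 0 < ω → 0 < δ → δ ≤ 1 → 0 < B →
        MDP.approxError Q γ φ B ≤ ε →
        ∃ N₀ : ℕ, ∀ N ≥ N₀,
          (∀ y : ℕ → S × I,
            ((Capi.capiQpiPlan ⟨γ, ω, ε, δ, L, B⟩ sel s₀ (φ s₀) N).run φ y).2 ≠ none ∧
            LocalAccess s₀ y
              ((Capi.capiQpiPlan ⟨γ, ω, ε, δ, L, B⟩ sel s₀ (φ s₀) N).run φ y).1 ∧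
            (((Capi.capiQpiPlan ⟨γ, ω, ε, δ, L, B⟩ sel s₀ (φ s₀) N).run φ y).1.length : ℝ) ≤
              K * (d * ((1 - γ) ^ 4)⁻¹ * (ω ^ 2)⁻¹) *
                Real.log (2 + d + L * B / ω + 1 / ω + 1 / (1 - γ) + 1 / δ) ^ k) ∧
          1 - ENNReal.ofReal δ ≤
            (Capi.capiQpiPlan ⟨γ, ω, ε, δ, L, B⟩ sel s₀ (φ s₀) N).prob Q φ
              {out | ∃ π : Capi.Row A d → A, out = some π ∧
                ∃ hπ : Measurable (fun s => π (φ s)),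
                  MDP.optValue Q γ s₀ -
                      MDP.value Q γ (Kernel.deterministic (fun s => π (φ s)) hπ) s₀ ≤
                    K * ((ε + ω) * Real.sqrt d * (1 - γ)⁻¹) *
                      Real.log (2 + L * B / ω) ^ k} := by
  -- The query bound determines `K`; the value bound needs only `11 · 40`.
  refine ⟨40000, 4, by norm_num, ?_⟩
  intro S A _ _ _ _ _ _ Q _ d φ γ ω ε δ L B sel s₀ hd hφ hL hγ0 hγ1 hω hδ0 hδ1 hB happ
  let P : Capi.Params := ⟨γ, ω, ε, δ, L, B⟩
  have hε : 0 ≤ ε := (Capi.approxError_nonneg Q γ φ B).trans happ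
  have hL0 : 0 ≤ L := (norm_nonneg _).trans (hL s₀ (Capi.firstAction A))
  have hlam : 0 < P.lam := by
    simp only [Capi.Params.lam, P]
    positivity
  have hR : Capi.Realizable Q P φ :=
    Capi.realizable_of_approxError_le (P := P) hγ0 hγ1 hL hB happ
  have hdT := Capi.dTilde_nonneg (P := P) hω hB d
  have hDle : (⌊P.dTilde d / 2⌋₊ : ℝ) ≤ P.dTilde d / 2 := Nat.floor_le (by linarith)
  have hD : ∀ st : Capi.PlanState S A d, Capi.Inv P φ st →
      (st.core 0).length ≤ ⌊P.dTilde d / 2⌋₊ := fun st hst =>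
    hst.toCoherent.length_le_dTilde hlam hd hL
  have hinit := Capi.inv_initial P φ (fun _ _ => Capi.firstAction A)
  have hrem : Capi.remaining ⌊P.dTilde d / 2⌋₊ P.H
      (⟨fun _ => [], fun _ _ => Capi.firstAction A⟩ : Capi.PlanState S A d) =
        ⌊P.dTilde d / 2⌋₊ + P.H * ⌊P.dTilde d / 2⌋₊ := by
    simp [Capi.remaining, Capi.estCount]
  -- One iteration beyond the progress bound, for the return.
  refine ⟨⌊P.dTilde d / 2⌋₊ + P.H * ⌊P.dTilde d / 2⌋₊ + 1, fun N hN => ⟨fun y => ?_, ?_⟩⟩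
  · have hsafe := (Capi.safe_planLoop hlam hD sel s₀ N _ hinit (K := {s₀}) rfl (by simp)
      (by rw [hrem]; omega)).run y
    obtain ⟨h1, ⟨_, h2⟩, h3⟩ := hsafe
    refine ⟨h2, h3, ?_⟩
    rw [hrem] at h1
    have h4 := Capi.queries_le (P := P) hγ0 hγ1 hω hB hL0 hδ0 hδ1 hd hDle
    exact le_trans (by exact_mod_cast h1) h4
  · have hprob := Capi.prob_planLoop_ge (Q := Q) (P := P) (φ := φ) hγ0 hγ1 hφ hε hω hB hδ0 hδ1 hR
      hD sel s₀ {out | ∃ π : Capi.Row A d → A, out = some π ∧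
                ∃ hπ : Measurable (fun s => π (φ s)),
                  MDP.optValue Q γ s₀ -
                      MDP.value Q γ (Kernel.deterministic (fun s => π (φ s)) hπ) s₀ ≤
                    40000 * ((ε + ω) * Real.sqrt d * (1 - γ)⁻¹) *
                      Real.log (2 + L * B / ω) ^ 4} ?_ N _ hinit
      (Capi.accurate_initial hε hω hB hR) (by rw [hrem]; omega)
    · refine le_trans ?_ hprob
      rw [hrem, ← ENNReal.ofReal_one, ← ENNReal.ofReal_sub _ hδ0.le]
      refine ENNReal.ofReal_le_ofReal (sub_le_sub_left ?_ _)
      push_cast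
      rcases Nat.eq_zero_or_pos P.H with hH | hH
      · simpa [hH] using hδ0.le
      · have hH1 : (1 : ℝ) ≤ P.H := by exact_mod_cast hH
        -- For `H ≥ 1`, `D + H D ≤ 2 H D ≤ d̃ H`, so the measurements together fail with probability
        -- at most `δ`.
        rw [div_mul_eq_mul_div]
        refine div_le_of_le_mul₀ (by positivity) hδ0.le
          (mul_le_mul_of_nonneg_left ?_ hδ0.le)
        nlinarith
    · intro st hst hacc hlev hs₀
      refine ⟨st.pol P.H, rfl, hacc.meas P.H, ?_⟩
      have hlen : ((st.core 0).length : ℝ) ≤ P.dTilde d := by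
        have : ((st.core 0).length : ℝ) ≤ ⌊P.dTilde d / 2⌋₊ := by exact_mod_cast hD st hst
        linarith
      have h1 := MDP.optValue_le Q hγ0.le hγ1 s₀ fun g =>
        Capi.detValue_sub_le hγ0 hγ1 hφ hε hω hB hR hst hacc hlev hlen hs₀ g
      have h2 := Capi.width_le (P := P) hω hB hL0 hε hd
      have hr : 0 ≤ (1 - γ)⁻¹ := inv_nonneg.2 (by linarith)
      have h3 := mul_le_mul_of_nonneg_right h2 hr
      have h4 : 0 ≤ (ε + ω) * Real.sqrt d * (1 - γ)⁻¹ * Real.log (2 + L * B / ω) ^ 4 := by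
        positivity
      rw [sub_le_iff_le_add']
      refine h1.trans (add_le_add le_rfl ?_)
      simp only [P] at h3 ⊢
      linarith
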